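/- **Setting.** Let $\mathfrak T$ be a labelled polygonal tiling of the Euclidean plane: a regular CW decomposition of $\mathbb R^2$ whose $1$-cells are straight segments and whose $2$-cells (tiles) are polygons, with a label on each cell. A *patch* is a finite subcomplex with its labels; patches are *rigid equivalent* if an orientation preserving isometry maps the cells of one bijectively to those of the other, respecting labels. Assume that $\mathfrak T$ has Euclidean finite local complexity (for each $r>0$ there are only finitely many patches of diameter at most $r$ up to rigid equivalence, and there are only finitely many tiles up to rigid equivalence) and trivial cell isotropy: if a rigid motion takes a cell $c$ and its star $\mathrm{St}(c)$ (the patch of the tiles containing $c$) to themselves, then it fixes $c$ pointwise. For $k$-cells $c,c'$ and $r>0$ let $E_{\mathfrak T}(c,c';r)$ be the set of rigid motions taking $c$ to $c'$ and the patch of the tiles within distance $r$ of $c$ to the patch of the tiles within distance $r$ of $c'$. Orient the tiles by the plane, and orient the edges consistently: a rigid motion taking $(e,\mathrm{St}(e))$ to $(e',\mathrm{St}(e'))$ takes the orientation of $e$ to that of $e'$. A cellular $k$-chain $\sigma$ (possibly infinite, with integer coefficients) is *ePE* if for some $r>0$ one has $\sigma(c)=\sigma(c')$ whenever $E_{\mathfrak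 T}(c,c';r)\neq\emptyset$. The ePE chains form a complex $C_\bullet(\mathfrak T^0)$ with homology $H_\bullet(\mathfrak T^0)$. Choose a prototile in each rigid equivalence class of tiles, and let $\tau_t\in\mathbb R/2\pi\mathbb Z$ be the angle of the rotation taking the prototile of $t$ to a translate of $t$. **The spectral sequence.** Let $q\colon SE(2)\to\mathbb R^2$, $q(\phi)=\phi(0)$. Decompose $SE(2)\cong\mathbb R^2\times \mathbb R/2\pi\mathbb Z$ into cells by subdividing, over each open cell $c$ of $\mathfrak T$, the circle fibres at the points $\tau_t$ and $\tau_t+\pi$ for the tiles $t\supseteq c$; the cells over $c$ are the products of $c$ with the subdividing points and with the open arcs between consecutive ones. An (infinite) cellular chain $x$ of this decomposition is *pattern-equivariant* if there is some $r>0$ such that, for all cells $c,c'$ of $\mathfrak T$ and all $\phi\in E_{\mathfrak T}(c,c';r)$, $x$ takes the same value on $y$ and on $\phi\circ y$ for every cell $y$ over $c$. Pattern-equivariant chains form a chain complex $C_\bullet(\mathfrak T^{\mathrm{rot}})$, filtered by the chains supported over the $p$-skeleton of $\mathfrak T$. Let $(E^r_{p,q},d^r)$ be the spectral sequence of this filtered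 complex. For a vertex $v$ let $\nu_v$ be the sum of the anticlockwise oriented arcs of the fibre circle over $v$. **The chain $\omega$.** For each edge $e$ choose $\rho_e\in\mathbb R$ with $\rho_e\equiv\tau_{l}-\tau_{r} \pmod{2\pi}$, where $l$ and $r$ are the tiles to the left and to the right of $e$, such that $\rho_e=\rho_{e'}$ whenever a rigid motion takes $(e,\mathrm{St}(e))$ to $(e',\mathrm{St}(e'))$. For a vertex $v$ with incident edges $e_1,\dots,e_k$ let $$\omega(v)=\frac1{2\pi}\sum_{i=1}^k\epsilon_i\rho_{e_i},$$ where $\epsilon_i=1$ if $e_i$ is oriented outwards from $v$ and $\epsilon_i=-1$ if it is oriented inwards. **Theorem.** For all such choices the following hold. The numbers $\omega(v)$ are integers and define an ePE $0$-chain $\omega\in C_0(\mathfrak T^0)$. Among the differentials $d^r$ with $r\ge 2$, all vanish except possibly $\partial=d^2\colon E^2_{2,0}\to E^2_{0,1}$. There is an isomorphism $E^2_{0,1}\cong H_0(\mathfrak T^0)$ sending $[\sum_v\sigma(v)\,\nu_v]$ to $[\sigma]$ for every $\sigma\in C_0(\mathfrak T^0)$, and $E^2_{2,0}\cong\mathbb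 Z$. With respect to the former isomorphism, $$\partial(\Gamma)=[\omega]$$ for a generator $\Gamma$ of $E^2_{2,0}$. -/

import Mathlib

noncomputable section

/-! ### Rigid motions of the plane -/

/-- An orientation preserving isometry of the Euclidean plane `ℂ`: an element of
`SE(2) = SO(2) ⋉ ℝ²`, given by its rotation part and its translation part. -/
structure RigidMotion where
  rot : Real.Angle
  trans : ℂ

/-- The action of a rigid motion on the plane: `z ↦ rot · z + trans`. In particular the
fibration `q : SE(2) → ℝ²`, `q φ = φ 0`, is `RigidMotion.trans`. -/
def RigidMotion.act (φ : RigidMotion) (z : ℂ) : ℂ :=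
  (φ.rot.toCircle : ℂ) * z + φ.trans

theorem RigidMotion.dist_act (φ : RigidMotion) (z w : ℂ) :
    dist (φ.act z) (φ.act w) = dist z w := by
  simp only [RigidMotion.act, dist_add_right]
  rw [Complex.dist_eq, ← mul_sub, norm_mul, Circle.norm_coe, one_mul, Complex.dist_eq]

theorem RigidMotion.act_injective (φ : RigidMotion) : Function.Injective φ.act := by
  intro z w h
  rw [← dist_eq_zero, ← φ.dist_act, h, dist_self]

/-! ### Labelled polygonal tilings of the plane -/

/-- A polytopal tiling of the plane: a regular CW decomposition of `ℂ` whose closed `1`-cells are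
straight segments and whose closed `2`-cells are (not necessarily convex) polygons, with a
labelling of the cells. Cells are recorded as closed subsets of `ℂ`; only the values of `label`
on cells are ever used. -/
structure PlaneTiling (L : Type*) where
  vertex : Set ℂ
  edge : Set (Set ℂ)
  tile : Set (Set ℂ)
  label : Set ℂ → L
  /-- An edge joins two different vertices and has no vertex in its relative interior. -/
  edge_segment : ∀ e ∈ edge, ∃ a ∈ vertex, ∃ b ∈ vertex, a ≠ b ∧ e = segment ℝ a b ∧
    Disjoint (openSegment ℝ a b) vertex
  /-- Different edges meet at most in vertices. -/
  edge_inter : ∀ e ∈ edge, ∀ e' ∈ edge, e ≠ e' → e ∩ e' ⊆ vertex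
  /-- A tile is the closed region enclosed by a simple closed polygon made of edges. -/
  tile_compact : ∀ t ∈ tile, IsCompact t
  tile_regular : ∀ t ∈ tile, closure (interior t) = t
  tile_connected : ∀ t ∈ tile, IsConnected (interior t)
  tile_frontier : ∀ t ∈ tile, ∃ n : ℕ, 3 ≤ n ∧ ∃ p : ZMod n → ℂ, Function.Injective p ∧
    (∀ i, segment ℝ (p i) (p (i + 1)) ∈ edge) ∧ frontier t = ⋃ i, segment ℝ (p i) (p (i + 1))
  /-- The open tiles are disjoint from the `1`-skeleton and from each other. -/
  tile_vertex : ∀ t ∈ tile, Disjoint (interior t) vertex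
  tile_edge : ∀ t ∈ tile, ∀ e ∈ edge, Disjoint (interior t) e
  tile_tile : ∀ t ∈ tile, ∀ t' ∈ tile, t ≠ t' → Disjoint (interior t) (interior t')
  cover : ⋃₀ tile = Set.univ
  /-- A bounded region meets only finitely many cells. -/
  finite_vertex : ∀ B : Set ℂ, Bornology.IsBounded B → (vertex ∩ B).Finite
  finite_edge : ∀ B : Set ℂ, Bornology.IsBounded B → {e ∈ edge | (e ∩ B).Nonempty}.Finite
  finite_tile : ∀ B : Set ℂ, Bornology.IsBounded B → {t ∈ tile | (t ∩ B).Nonempty}.Finite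

namespace PlaneTiling

variable {L : Type*} (T : PlaneTiling L)

/-- The closed `k`-cells of the tiling. -/
def cell : ℕ → Set (Set ℂ)
  | 0 => {c | ∃ v ∈ T.vertex, c = {v}}
  | 1 => T.edge
  | 2 => T.tile
  | _ => ∅

theorem cell_nonempty_bounded {k : ℕ} {c : Set ℂ} (hc : c ∈ T.cell k) :
    c.Nonempty ∧ Bornology.IsBounded c := by
  match k, hc with
  | 0, hc =>
    obtain ⟨v, -, rfl⟩ := hc
    exact ⟨⟨v, rfl⟩, Bornology.isBounded_singleton⟩
  | 1, hc =>
    obtain ⟨a, -, b, -, -, rfl, -⟩ := T.edge_segment c hc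
    refine ⟨⟨a, left_mem_segment ℝ a b⟩, ?_⟩
    rw [← convexHull_pair]
    exact isBounded_convexHull.2 (Set.toFinite _).isBounded
  | 2, hc =>
    exact ⟨(T.tile_connected c hc).1.mono interior_subset, (T.tile_compact c hc).isBounded⟩
  | _ + 3, hc => exact hc.elim

theorem finite_meeting (k : ℕ) {B : Set ℂ} (hB : Bornology.IsBounded B) :
    {c ∈ T.cell k | (c ∩ B).Nonempty}.Finite := by
  match k with
  | 0 =>
    refine ((T.finite_vertex B hB).image (fun v => ({v} : Set ℂ))).subset ?_
    rintro c ⟨⟨v, hv, rfl⟩, w, hw, hwB⟩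
    obtain rfl : w = v := hw
    exact ⟨w, ⟨hv, hwB⟩, rfl⟩
  | 1 => exact T.finite_edge B hB
  | 2 => exact T.finite_tile B hB
  | k + 3 => exact Set.finite_empty.subset (fun c hc => hc.1)

/-- The `k`-cells which contain a given cell. -/
theorem finite_cofaces (k : ℕ) {j : ℕ} {d : Set ℂ} (hd : d ∈ T.cell j) :
    {c ∈ T.cell k | d ⊆ c}.Finite := by
  obtain ⟨hne, hbd⟩ := T.cell_nonempty_bounded hd
  refine (T.finite_meeting k hbd).subset ?_
  rintro c ⟨hc, hdc⟩
  exact ⟨hc, by rwa [Set.inter_eq_self_of_subset_right hdc]⟩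

/-! ### Patches, rigid equivalence, finite local complexity -/

/-- A finite subcomplex; `Q k` is its set of `k`-cells. -/
def IsPatch (Q : ℕ → Set (Set ℂ)) : Prop :=
  (∀ k, Q k ⊆ T.cell k ∧ (Q k).Finite) ∧
    ∀ k, ∀ c ∈ Q k, ∀ j, ∀ d ∈ T.cell j, d ⊆ c → d ∈ Q j

/-- The rigid motion `φ` maps the cells of `Q` bijectively to the cells of `Q'`, respecting
labels. -/
def MapsPatch (φ : RigidMotion) (Q Q' : ℕ → Set (Set ℂ)) : Prop :=
  ∀ k, (fun c => φ.act '' c) '' Q k = Q' k ∧ ∀ c ∈ Q k, T.label (φ.act '' c) = T.label c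

/-- The subcomplex consisting of the given tiles and all their faces. -/
def patchOf (U : Set (Set ℂ)) : ℕ → Set (Set ℂ) :=
  fun k => {c ∈ T.cell k | ∃ t ∈ U, c ⊆ t}

/-- The star `St(c)` of a cell. -/
def star (c : Set ℂ) : ℕ → Set (Set ℂ) := T.patchOf {t ∈ T.tile | c ⊆ t}

/-- The `r`-patch at a cell: the patch of the tiles within distance `r` of the cell. -/
def radPatch (c : Set ℂ) (r : ℝ) : ℕ → Set (Set ℂ) :=
  T.patchOf {t ∈ T.tile | ∃ x ∈ t, ∃ y ∈ c, dist x y ≤ r}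

/-- The rigid motion `φ` takes the cell `c` to `c'` and the star of `c` to the star of `c'`. -/
def CarriesStar (φ : RigidMotion) (c c' : Set ℂ) : Prop :=
  φ.act '' c = c' ∧ T.MapsPatch φ (T.star c) (T.star c')

/-- The set `E_T(c, c'; r)` of rigid motions which send the cell `c` to `c'` and the `r`-patch at
`c` to the `r`-patch at `c'`. -/
def motions (c c' : Set ℂ) (r : ℝ) : Set RigidMotion :=
  {φ | φ.act '' c = c' ∧ T.MapsPatch φ (T.radPatch c r) (T.radPatch c' r)}

theorem motions_mono {c c' : Set ℂ} {r s : ℝ} (hrs : r ≤ s) :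
    T.motions c c' s ⊆ T.motions c c' r := by
  rintro φ ⟨hc, hφ⟩
  have sub : ∀ d : Set ℂ, ∀ k, T.radPatch d r k ⊆ T.radPatch d s k := by
    rintro d k x ⟨hx, t, ⟨ht, y, hy, z, hz, hyz⟩, hxt⟩
    exact ⟨hx, t, ⟨ht, y, hy, z, hz, hyz.trans hrs⟩, hxt⟩
  have self : ∀ d : Set ℂ, ∀ t ∈ T.tile, ∀ ρ : ℝ, (∃ x ∈ t, ∃ y ∈ d, dist x y ≤ ρ) →
      t ∈ T.radPatch d ρ 2 := fun d t ht ρ h => ⟨ht, t, ⟨ht, h⟩, subset_rfl⟩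
  refine ⟨hc, fun k => ⟨?_, fun d hd => (hφ k).2 d (sub c k hd)⟩⟩
  apply Set.Subset.antisymm
  · rintro _ ⟨d, ⟨hd, t, ⟨ht, x, hx, y, hy, hxy⟩, hdt⟩, rfl⟩
    have h1 : φ.act '' d ∈ T.radPatch c' s k := by
      rw [← (hφ k).1]
      exact ⟨d, sub c k ⟨hd, t, ⟨ht, x, hx, y, hy, hxy⟩, hdt⟩, rfl⟩
    have h2 : φ.act '' t ∈ T.radPatch c' s 2 := by
      rw [← (hφ 2).1]
      exact ⟨t, self c t ht s ⟨x, hx, y, hy, hxy.trans hrs⟩, rfl⟩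
    refine ⟨h1.1, φ.act '' t, ⟨h2.1, φ.act x, ⟨x, hx, rfl⟩, φ.act y, ?_, ?_⟩,
      Set.image_mono hdt⟩
    · rw [← hc]
      exact ⟨y, hy, rfl⟩
    · rwa [φ.dist_act]
  · rintro d' ⟨hd', t', ⟨ht', x', hx', y', hy', hxy'⟩, hdt'⟩
    have h1 : d' ∈ (fun c => φ.act '' c) '' T.radPatch c s k := by
      rw [(hφ k).1]
      exact sub c' k ⟨hd', t', ⟨ht', x', hx', y', hy', hxy'⟩, hdt'⟩
    have h2 : t' ∈ (fun c => φ.act '' c) '' T.radPatch c s 2 := by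
      rw [(hφ 2).1]
      exact self c' t' ht' s ⟨x', hx', y', hy', hxy'.trans hrs⟩
    obtain ⟨d, hd, rfl⟩ := h1
    obtain ⟨t, ht, rfl⟩ := h2
    obtain ⟨x, hx, rfl⟩ := hx'
    rw [← hc] at hy'
    obtain ⟨y, hy, rfl⟩ := hy'
    rw [φ.dist_act] at hxy'
    exact ⟨d, ⟨hd.1, t, ⟨ht.1, x, hx, y, hy, hxy'⟩,
      (Set.image_subset_image_iff φ.act_injective).1 hdt'⟩, rfl⟩

/-- Euclidean finite local complexity: up to rigid equivalence there are only finitely many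
patches of each bounded diameter, and only finitely many tiles. -/
def EFLC : Prop :=
  (∀ r : ℝ, 0 < r → ∃ F : Set (ℕ → Set (Set ℂ)), F.Finite ∧ (∀ Q ∈ F, T.IsPatch Q) ∧
    ∀ Q, T.IsPatch Q → Metric.diam (⋃ k, ⋃₀ Q k) ≤ r → ∃ Q' ∈ F, ∃ φ, T.MapsPatch φ Q' Q) ∧
  ∃ F : Set (Set ℂ), F.Finite ∧ F ⊆ T.tile ∧ ∀ t ∈ T.tile, ∃ t' ∈ F, ∃ φ, T.CarriesStar φ t' t

/-- Trivial cell isotropy, in the form needed to orient cells by their stars: a rigid motion which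
takes a cell and its star to themselves fixes the cell pointwise. -/
def TrivialCellIsotropy : Prop :=
  ∀ k, ∀ c ∈ T.cell k, ∀ φ, T.CarriesStar φ c c → ∀ x ∈ c, φ.act x = x

/-! ### Orientations, prototiles, edge rotations -/

/-- A consistent choice of orientations of the edges. (Tiles carry the orientation of the plane,
vertices the positive orientation; these choices are consistent automatically.) -/
structure EdgeOrientation where
  tail : Set ℂ → ℂ
  head : Set ℂ → ℂ
  ends : ∀ e ∈ T.edge, tail e ≠ head e ∧ e = segment ℝ (tail e) (head e)
  consistent : ∀ e ∈ T.edge, ∀ e' ∈ T.edge, ∀ φ, T.CarriesStar φ e e' →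
    φ.act (tail e) = tail e' ∧ φ.act (head e) = head e'

/-- A choice of a prototile in each rigid equivalence class of tiles. The motion `place t` takes
the prototile of `t` onto `t`, so the prototile is `(place t)⁻¹ t`; the condition says that
rigid equivalent tiles have the same prototile. -/
structure Prototiles where
  place : Set ℂ → RigidMotion
  prototile_eq : ∀ t ∈ T.tile, ∀ t' ∈ T.tile, (∃ φ, T.CarriesStar φ t t') →
    ∃ φ, T.CarriesStar φ t t' ∧ ∀ z, (place t').act z = φ.act ((place t).act z)

variable {T}

/-- The rotation `τ_t` which takes the prototile of `t` to a translate of `t`. -/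
def Prototiles.tau (P : T.Prototiles) (t : Set ℂ) : Real.Angle := (P.place t).rot

namespace EdgeOrientation

variable (o : T.EdgeOrientation)

/-- The tile `t` lies directly to the left of the oriented edge `e`. -/
def IsLeft (t e : Set ℂ) : Prop :=
  ∀ᶠ ε : ℝ in nhdsWithin 0 (Set.Ioi 0),
    midpoint ℝ (o.tail e) (o.head e) + ε * (Complex.I * (o.head e - o.tail e)) ∈ interior t

/-- The tile `t` lies directly to the right of the oriented edge `e`. -/
def IsRight (t e : Set ℂ) : Prop :=
  ∀ᶠ ε : ℝ in nhdsWithin 0 (Set.Ioi 0),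
    midpoint ℝ (o.tail e) (o.head e) - ε * (Complex.I * (o.head e - o.tail e)) ∈ interior t

open Classical in
/-- The incidence number `[c : d]` of a `(k+1)`-cell `c` and a `k`-cell `d`. -/
def inc : ℕ → Set ℂ → Set ℂ → ℤ
  | 0, e, v => (if v = {o.head e} then 1 else 0) - (if v = {o.tail e} then 1 else 0)
  | 1, t, e => (if o.IsLeft t e then 1 else 0) - (if o.IsRight t e then 1 else 0)
  | _, _, _ => 0

/-- The cellular boundary map on (infinite) cellular chains of the tiling. -/
def boundary (k : ℕ) : (T.cell (k + 1) → ℤ) →+ (T.cell k → ℤ) where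
  toFun σ d := ∑ c ∈ (T.finite_cofaces (k + 1) d.2).toFinset.attach,
    o.inc k c.1 d.1 * σ ⟨c.1, ((Set.Finite.mem_toFinset _).1 c.2).1⟩
  map_zero' := by
    funext d
    simp
  map_add' σ τ := by
    funext d
    simp [mul_add, Finset.sum_add_distrib]

end EdgeOrientation

/-- A choice of real numbers `ρ_e`, constant on rigid equivalence classes of edge stars, with
`ρ_e ≡ τ_l - τ_r` modulo `2π` for the tiles `l`, `r` to the left and to the right of `e`. -/
structure EdgeRotations (o : T.EdgeOrientation) (P : T.Prototiles) where
  rho : Set ℂ → ℝ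
  rho_mod : ∀ e ∈ T.edge, ∀ l ∈ T.tile, ∀ r ∈ T.tile, o.IsLeft l e → o.IsRight r e →
    (rho e : Real.Angle) = P.tau l - P.tau r
  rho_eq : ∀ e ∈ T.edge, ∀ e' ∈ T.edge, (∃ φ, T.CarriesStar φ e e') → rho e = rho e'

open Classical in
/-- The sum `∑ ε_i ρ_{e_i}` over the edges at the vertex `v`, where `ε_i` is `1` for edges
oriented outwards from `v` and `-1` for edges oriented inwards. -/
def EdgeRotations.turning {o : T.EdgeOrientation} {P : T.Prototiles} (ρ : EdgeRotations o P)
    (v : T.cell 0) : ℝ :=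
  ∑ e ∈ (T.finite_cofaces 1 v.2).toFinset, (if v.1 = {o.tail e} then 1 else -1) * ρ.rho e

variable (T)

/-! ### Euclidean pattern-equivariant chains -/

/-- The group `C_k(T⁰)` of Euclidean pattern-equivariant `k`-chains. -/
def ePE (k : ℕ) : AddSubgroup (T.cell k → ℤ) where
  carrier := {σ | ∃ r : ℝ, 0 < r ∧ ∀ c c' : T.cell k, (T.motions c.1 c'.1 r).Nonempty →
    σ c = σ c'}
  zero_mem' := ⟨1, one_pos, fun _ _ _ => rfl⟩
  add_mem' := by
    rintro σ τ ⟨r, hr, hσ⟩ ⟨s, hs, hτ⟩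
    refine ⟨max r s, lt_max_of_lt_left hr, fun c c' h => ?_⟩
    simp only [Pi.add_apply]
    rw [hσ c c' (h.mono (T.motions_mono (le_max_left r s))),
      hτ c c' (h.mono (T.motions_mono (le_max_right r s)))]
  neg_mem' := by
    rintro σ ⟨r, hr, hσ⟩
    exact ⟨r, hr, fun c c' h => congrArg Neg.neg (hσ c c' h)⟩

variable {T}

/-- The ePE homology group `H_0(T⁰) = C_0(T⁰) / ∂ C_1(T⁰)`. -/
abbrev EdgeOrientation.H0 (o : T.EdgeOrientation) : Type :=
  ↥(T.ePE 0) ⧸ ((T.ePE 1).map (o.boundary 0)).addSubgroupOf (T.ePE 0)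

/-! ### The cell decomposition of the group of rigid motions -/

/-- The rotations `a` for which the tile `φ⁻¹(t)`, for some tile `t` containing `c`, is rotated by
`0` or `π` against its prototile, where `φ` has rotation part `a`. These points subdivide the
fibre circle of `q : SE(2) → ℝ²` over each point of the open cell `c`. -/
def Prototiles.angles (P : T.Prototiles) (c : Set ℂ) : Set Real.Angle :=
  {a | ∃ t ∈ T.tile, c ⊆ t ∧ (a = P.tau t ∨ a = P.tau t + (Real.pi : Real.Angle))}

/-- The points `a ≠ b` of `S` are consecutive in the anticlockwise direction. -/
def _root_.IsCircleArc (S : Set Real.Angle) (a b : Real.Angle) : Prop :=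
  a ∈ S ∧ b ∈ S ∧ a ≠ b ∧ ∀ u ∈ S, ¬ sbtw a u b

/-- A cell of the decomposition of `SE(2)`: over the open cell `base` of the tiling it is the
product of `base` with a fibre part, which is either one of the subdividing points
(`src = tgt`) or one of the open anticlockwise arcs from `src` to `tgt` between
consecutive subdividing points. It carries the product orientation. -/
@[ext]
structure RotCell (P : T.Prototiles) where
  dim : ℕ
  base : Set ℂ
  src : Real.Angle
  tgt : Real.Angle
  base_mem : base ∈ T.cell dim
  fibre_mem : (src = tgt ∧ src ∈ P.angles base) ∨ IsCircleArc (P.angles base) src tgt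

namespace RotCell

variable {P : T.Prototiles}

/-- The fibre part of the cell. -/
def fibre (y : RotCell P) : Set Real.Angle :=
  {a | (y.src = y.tgt ∧ a = y.src) ∨ sbtw y.src a y.tgt}

open Classical in
/-- The dimension of the cell. -/
def totalDim (y : RotCell P) : ℕ := y.dim + if y.src = y.tgt then 0 else 1

open Classical in
/-- The incidence number `[y : z]`: the boundary of `c × I` is
`∂c × I + (-1) ^ dim c • c × ∂I`, where on a face of `c` the arc `I` is subdivided further. -/
def inc (o : T.EdgeOrientation) (y z : RotCell P) : ℤ :=
  if y.dim = z.dim + 1 ∧ (y.src = y.tgt ↔ z.src = z.tgt) ∧ z.fibre ⊆ y.fibre then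
    o.inc z.dim y.base z.base
  else if y.base = z.base ∧ y.src ≠ y.tgt ∧ z.src = z.tgt then
    (-1) ^ y.dim * ((if z.src = y.tgt then 1 else 0) - (if z.src = y.src then 1 else 0))
  else 0

theorem finite_angles {k : ℕ} {c : Set ℂ} (hc : c ∈ T.cell k) : (P.angles c).Finite := by
  have h := T.finite_cofaces 2 hc
  refine ((h.image P.tau).union
    (h.image fun t => P.tau t + (Real.pi : Real.Angle))).subset ?_
  rintro a ⟨t, ht, hct, rfl | rfl⟩
  · exact Or.inl ⟨t, ⟨ht, hct⟩, rfl⟩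
  · exact Or.inr ⟨t, ⟨ht, hct⟩, rfl⟩

theorem finite_above (z : RotCell P) : {y : RotCell P | z.base ⊆ y.base}.Finite := by
  have hA := finite_angles (P := P) z.base_mem
  have hC : (⋃ k ∈ Finset.range 3, {c ∈ T.cell k | z.base ⊆ c}).Finite :=
    Set.Finite.biUnion (Finset.finite_toSet _) fun k _ => T.finite_cofaces k z.base_mem
  refine Set.Finite.of_finite_image (f := fun y : RotCell P => (y.dim, y.base, y.src, y.tgt))
    (((Finset.range 3).finite_toSet.prod (hC.prod (hA.prod hA))).subset ?_) ?_
  · rintro _ ⟨y, hy, rfl⟩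
    have hd : y.dim < 3 := by
      by_contra h
      obtain ⟨m, hm⟩ := Nat.exists_eq_add_of_le (not_lt.1 h)
      have hb := y.base_mem
      rw [hm, add_comm] at hb
      exact hb.elim
    have hsub : P.angles y.base ⊆ P.angles z.base := by
      rintro a ⟨t, ht, hyt, h⟩
      exact ⟨t, ht, hy.trans hyt, h⟩
    have hs : y.src ∈ P.angles y.base ∧ y.tgt ∈ P.angles y.base := by
      rcases y.fibre_mem with ⟨h, h'⟩ | ⟨h, h', -⟩
      · exact ⟨h', h ▸ h'⟩
      · exact ⟨h, h'⟩
    refine ⟨by simpa using hd, ?_, hsub hs.1, hsub hs.2⟩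
    simp only [Set.mem_iUnion]
    exact ⟨y.dim, by simpa using hd, y.base_mem, hy⟩
  · intro y _ y' _ h
    simp only [Prod.mk.injEq] at h
    exact RotCell.ext h.1 h.2.1 h.2.2.1 h.2.2.2

/-- The rigid motion `φ`, acting on `SE(2)` by composition on the left, takes `y` to `z`. -/
def MapsTo (φ : RigidMotion) (y z : RotCell P) : Prop :=
  φ.act '' y.base = z.base ∧ z.src = φ.rot + y.src ∧ z.tgt = φ.rot + y.tgt

/-- The cellular boundary map on (infinite) chains of the decomposition of `SE(2)`. -/
def boundary (o : T.EdgeOrientation) (P : T.Prototiles) :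
    (RotCell P → ℤ) →+ (RotCell P → ℤ) where
  toFun x z := ∑ y ∈ z.finite_above.toFinset, inc o y z * x y
  map_zero' := by
    funext z
    simp
  map_add' x y := by
    funext z
    simp [mul_add, Finset.sum_add_distrib]

variable (P)

/-- The group of pattern-equivariant chains supported on cells of dimension `n`. -/
def PE (n : ℤ) : AddSubgroup (RotCell P → ℤ) where
  carrier := {x | (∀ y, x y ≠ 0 → (y.totalDim : ℤ) = n) ∧
    ∃ r : ℝ, 0 < r ∧ ∀ y z : RotCell P, y.dim = z.dim →
      ∀ φ ∈ T.motions y.base z.base r, MapsTo φ y z → x y = x z}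
  zero_mem' := ⟨fun _ h => (h rfl).elim, 1, one_pos, fun _ _ _ _ _ _ => rfl⟩
  add_mem' := by
    rintro x x' ⟨hx, r, hr, hxr⟩ ⟨hx', s, hs, hxs⟩
    refine ⟨fun y hy => ?_, max r s, lt_max_of_lt_left hr, fun y z hyz φ hφ hm => ?_⟩
    · by_contra hn
      have h1 : x y = 0 := by
        by_contra h
        exact hn (hx y h)
      have h2 : x' y = 0 := by
        by_contra h
        exact hn (hx' y h)
      exact hy (by simp [h1, h2])
    · simp only [Pi.add_apply]
      rw [hxr y z hyz φ (T.motions_mono (le_max_left r s) hφ) hm,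
        hxs y z hyz φ (T.motions_mono (le_max_right r s) hφ) hm]
  neg_mem' := by
    rintro x ⟨hx, r, hr, hxr⟩
    exact ⟨fun y hy => hx y (by simpa using hy), r, hr,
      fun y z hyz φ hφ hm => congrArg Neg.neg (hxr y z hyz φ hφ hm)⟩

/-- The group of chains supported on the preimage of the `p`-skeleton under `q`. -/
def skeleton (p : ℤ) : AddSubgroup (RotCell P → ℤ) where
  carrier := {x | ∀ y, x y ≠ 0 → (y.dim : ℤ) ≤ p}
  zero_mem' := fun _ h => (h rfl).elim
  add_mem' := by
    intro x x' hx hx' y hy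
    by_contra hn
    have h1 : x y = 0 := by
      by_contra h
      exact hn (hx y h)
    have h2 : x' y = 0 := by
      by_contra h
      exact hn (hx' y h)
    exact hy (by simp [h1, h2])
  neg_mem' := by
    intro x hx y hy
    exact hx y (by simpa using hy)

end RotCell

end PlaneTiling

/-! ### The spectral sequence of a filtered chain complex -/

/-- The data of a filtered chain complex of abelian groups: `deg n` is the group in degree `n` and
`fil p ⊓ deg n` its `p`-th filtration step, all inside one group `A`. -/
structure FilteredData (A : Type*) [AddCommGroup A] where
  d : A →+ A
  deg : ℤ → AddSubgroup A
  fil : ℤ → AddSubgroup A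

namespace FilteredData

variable {A : Type*} [AddCommGroup A] (K : FilteredData A)

/-- The data form a filtered chain complex. -/
structure IsComplex : Prop where
  d_deg : ∀ n, ∀ x ∈ K.deg n, K.d x ∈ K.deg (n - 1)
  d_d : ∀ n, ∀ x ∈ K.deg n, K.d (K.d x) = 0
  fil_mono : Monotone K.fil
  d_fil : ∀ p n, ∀ x ∈ K.fil p ⊓ K.deg n, K.d x ∈ K.fil p

/-- `Z^r_{p,q} = {x ∈ F_p C_{p+q} | d x ∈ F_{p-r}}`. -/
def Z (r p q : ℤ) : AddSubgroup A :=
  K.fil p ⊓ K.deg (p + q) ⊓ (K.fil (p - r)).comap K.d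

/-- `B^r_{p,q} = Z^{r-1}_{p-1,q+1} + d Z^{r-1}_{p+r-1,q-r+2}`. -/
def B (r p q : ℤ) : AddSubgroup A :=
  K.Z (r - 1) (p - 1) (q + 1) ⊔ (K.Z (r - 1) (p + r - 1) (q - r + 2)).map K.d

/-- The term `E^r_{p,q}` of the spectral sequence of the filtration. -/
abbrev E (r p q : ℤ) : Type _ := ↥(K.Z r p q) ⧸ (K.B r p q).addSubgroupOf (K.Z r p q)

variable {K}

theorem IsComplex.d_mem_Z (h : K.IsComplex) {r p q p' q' : ℤ} (hp : p' = p - r)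
    (hq : q' = q + r - 1) {x : A} (hx : x ∈ K.Z r p q) : K.d x ∈ K.Z r p' q' := by
  obtain ⟨⟨hf, hd⟩, hdx⟩ := hx
  subst hp hq
  refine ⟨⟨hdx, ?_⟩, ?_⟩
  · have := h.d_deg _ x hd
    rwa [show p - r + (q + r - 1) = p + q - 1 by ring]
  · change K.d (K.d x) ∈ K.fil (p - r - r)
    rw [h.d_d _ x hd]
    exact zero_mem _

theorem IsComplex.d_mem_B (h : K.IsComplex) {r p q p' q' : ℤ} (hp : p' = p - r)
    (hq : q' = q + r - 1) {x : A} (hx : x ∈ K.B r p q) : K.d x ∈ K.B r p' q' := by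
  obtain ⟨y, hy, _, ⟨z, hz, rfl⟩, rfl⟩ := AddSubgroup.mem_sup.1 hx
  rw [map_add, h.d_d _ z hz.1.2, add_zero]
  refine AddSubgroup.mem_sup_right ⟨y, ?_, rfl⟩
  subst hp hq
  rwa [show p - r + r - 1 = p - 1 by ring, show q + r - 1 - r + 2 = q + 1 by ring]

/-- The differential `d^r : E^r_{p,q} → E^r_{p-r,q+r-1}`, induced by `d`. -/
def diff (h : K.IsComplex) (r p q p' q' : ℤ) (hp : p' = p - r) (hq : q' = q + r - 1) :
    K.E r p q →+ K.E r p' q' :=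
  QuotientAddGroup.map _ _
    ((K.d.comp (K.Z r p q).subtype).codRestrict (K.Z r p' q')
      fun x => h.d_mem_Z hp hq x.2)
    (fun x hx => h.d_mem_B hp hq (x := x.1) hx)

end FilteredData

namespace PlaneTiling

variable {L : Type*} {T : PlaneTiling L}

/-- The complex of pattern-equivariant chains of the decomposition of `SE(2)`, filtered by the
preimages of the skeleta of the tiling. -/
def rotComplex (o : T.EdgeOrientation) (P : T.Prototiles) : FilteredData (RotCell P → ℤ) where
  d := RotCell.boundary o P
  deg := RotCell.PE P
  fil := RotCell.skeleton P

open Classical in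
/-- The `1`-chain `∑ σ(v) ν_v`, where `ν_v` is the sum of the anticlockwise oriented arcs of the
fibre circle over the vertex `v`. -/
def fibreChain (P : T.Prototiles) (σ : T.cell 0 → ℤ) : RotCell P → ℤ := fun y =>
  if h : y.dim = 0 ∧ y.src ≠ y.tgt then σ ⟨y.base, h.1 ▸ y.base_mem⟩ else 0

end PlaneTiling

end

/-! A chain on the cells of `SE(2)` is studied through its slices, which are chains on the tiling.
Cutting every fibre circle at one place selects one arc over each cell, and the coefficients on
these arcs form the slice `arcVal`. The coefficients on the subdividing points at one angle `a` form
the slice `ptVal`. The cellular boundary then takes a simple shape. Arc slices commute with the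
boundary of the tiling (`arcVal_boundary`). A point slice at `a` receives, besides the boundary of
the tiling, the jump of the arc slices across `a`, up to sign (`ptVal_boundary`).

The term `E²_{0,1}`: a cycle over the vertices has no jumps, so it is constant along each circle and
has the form `∑ σ(v) ν_v`. The chains over edges that produce its boundaries are constant along
circles for the same reason, so the quotient is `H_0` (`eq_circleChain_of_mem_Z`,
`circleChain_mem_B_iff`). All differentials other than `d²` from `(2,0)` vanish since the terms live
in the strip `0 ≤ p ≤ 2`, `0 ≤ q ≤ 1` (`Z_le_B`).

The term `E²_{2,0}`: over a tile the total coefficient over its two subdividing points is the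
invariant. Jumps around a circle add up to zero, so boundaries have total `0` and the totals over
two tiles sharing an edge agree. The plane without the vertices is connected, so the total is one
integer (`ptSum_eq`). If it is zero, half circles over the tiles push the chain off the open tiles
(`mem_B_of_ptSum_eq_zero`).

A chain with total `1` is `windChain`: the point `τ_t` over each tile `t`, and over each edge `e` a
path from `τ_r` to `τ_l` of length `ρ_e`. It is pattern-equivariant because trivial isotropy makes
`τ` turn along with the tiles (`Prototiles.tau_of_carriesStar`). Its boundary lies over the
vertices. The winding number there is found by counting the passages of all paths at `v` through one
cut of the circle: the number for `e` is `ρ_e / 2π` plus a difference of lifts of `τ_l` and `τ_r`.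
These differences cancel around `v`, since each tile at `v` is as often to the left as to the right
of an edge. What remains is `-ω(v)` (`EdgeRotations.turning_eq`), so the generator is the class of
`-windChain`. -/

namespace RigidMotion

/-! ### Elementary properties of rigid motions -/

theorem isometry_act (φ : RigidMotion) : Isometry φ.act :=
  Isometry.of_dist_eq φ.dist_act

/-- The motion `ψ⁻¹ ∘ φ`. -/
noncomputable def invComp (ψ φ : RigidMotion) : RigidMotion where
  rot := φ.rot - ψ.rot
  trans := ((-ψ.rot).toCircle : ℂ) * (φ.trans - ψ.trans)

theorem act_invComp (ψ φ : RigidMotion) (z : ℂ) : ψ.act ((ψ.invComp φ).act z) = φ.act z := by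
  have h : (ψ.rot.toCircle : ℂ) * ((ψ.rot.toCircle : ℂ))⁻¹ = 1 :=
    mul_inv_cancel₀ (Circle.coe_ne_zero _)
  simp only [act, invComp, sub_eq_add_neg, Real.Angle.toCircle_add, Real.Angle.toCircle_neg,
    Circle.coe_mul, Circle.coe_inv]
  linear_combination ((φ.rot.toCircle : ℂ) * z + φ.trans - ψ.trans) * h

/-- A rigid motion as a self-isometry of the plane. -/
noncomputable def isometryEquiv (φ : RigidMotion) : ℂ ≃ᵢ ℂ :=
  IsometryEquiv.mk' φ.act (φ.invComp ⟨0, 0⟩).act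
    (fun z => by rw [act_invComp]; simp [act]) φ.isometry_act

theorem image_interior (φ : RigidMotion) (s : Set ℂ) :
    φ.act '' interior s = interior (φ.act '' s) :=
  φ.isometryEquiv.toHomeomorph.image_interior s

theorem image_injective (φ : RigidMotion) :
    Function.Injective (fun c : Set ℂ => φ.act '' c) :=
  φ.act_injective.image_injective

theorem act_sub (φ : RigidMotion) (z w : ℂ) :
    φ.act z - φ.act w = (φ.rot.toCircle : ℂ) * (z - w) := by
  simp only [act]
  ring

theorem act_add (φ : RigidMotion) (z w : ℂ) :
    φ.act (z + w) = φ.act z + (φ.rot.toCircle : ℂ) * w := by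
  simp only [act]
  ring

theorem act_sub_right (φ : RigidMotion) (z w : ℂ) :
    φ.act (z - w) = φ.act z - (φ.rot.toCircle : ℂ) * w := by
  simp only [act]
  ring

theorem act_midpoint (φ : RigidMotion) (z w : ℂ) :
    φ.act (midpoint ℝ z w) = midpoint ℝ (φ.act z) (φ.act w) := by
  simp only [act, midpoint_eq_smul_add, Complex.real_smul]
  have h : ((⅟2 : ℝ) : ℂ) = 1 / 2 := by norm_num
  rw [h]
  ring

/-- The difference of two image points determines the rotation part, so agreement at two different
points is enough. -/
theorem rot_eq_add_of_act_eq {φ ψ χ : RigidMotion} {z w : ℂ} (hzw : z ≠ w)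
    (hz : φ.act z = ψ.act (χ.act z)) (hw : φ.act w = ψ.act (χ.act w)) :
    φ.rot = ψ.rot + χ.rot := by
  have h : ((φ.rot.toCircle : Circle) : ℂ) * (z - w) =
      ((ψ.rot + χ.rot).toCircle : ℂ) * (z - w) := by
    rw [← act_sub, hz, hw, act_sub, act_sub, Real.Angle.toCircle_add, Circle.coe_mul, mul_assoc]
  have h2 := Circle.coe_injective (mul_right_cancel₀ (sub_ne_zero.2 hzw) h)
  have h3 := congrArg (fun u : Circle => ((Complex.arg u : ℝ) : Real.Angle)) h2
  simpa only [Real.Angle.arg_toCircle] using h3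

end RigidMotion

/-! ### Rigid motions acting on patches, stars and prototile angles -/

namespace PlaneTiling

variable {L : Type*} {T : PlaneTiling L}

theorem mem_patchOf_tile {U : Set (Set ℂ)} {t : Set ℂ} (ht : t ∈ T.tile) (hU : t ∈ U) :
    t ∈ T.patchOf U 2 :=
  ⟨ht, t, hU, subset_rfl⟩

/-- A matching of patches restricts to any smaller family of tiles that the motion respects. This
yields at once stars from `r`-patches, stars of cofaces from stars, and patches at neighbouring
cells. -/
theorem mapsPatch_patchOf_of_subset {φ : RigidMotion} {U V U' V' : Set (Set ℂ)}
    (h : T.MapsPatch φ (T.patchOf V) (T.patchOf V')) (hV : V ⊆ T.tile) (hV' : V' ⊆ T.tile)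
    (hU : U ⊆ V) (hU' : U' ⊆ V')
    (hUU : ∀ t ∈ V, t ∈ U ↔ φ.act '' t ∈ U') :
    T.MapsPatch φ (T.patchOf U) (T.patchOf U') := by
  refine fun k => ⟨Set.Subset.antisymm ?_ ?_, ?_⟩
  · rintro _ ⟨d, ⟨hd, t, ht, hdt⟩, rfl⟩
    have h1 : φ.act '' d ∈ T.patchOf V' k := by
      rw [← (h k).1]
      exact ⟨d, ⟨hd, t, hU ht, hdt⟩, rfl⟩
    exact ⟨h1.1, _, (hUU t (hU ht)).1 ht, Set.image_mono hdt⟩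
  · rintro d' ⟨hd', t', ht', hdt'⟩
    have h1 : d' ∈ (fun c => φ.act '' c) '' T.patchOf V k := by
      rw [(h k).1]
      exact ⟨hd', t', hU' ht', hdt'⟩
    have h2 : t' ∈ (fun c => φ.act '' c) '' T.patchOf V 2 := by
      rw [(h 2).1]
      exact mem_patchOf_tile (hV' (hU' ht')) (hU' ht')
    obtain ⟨d, hd, rfl⟩ := h1
    obtain ⟨t, ⟨ht, t₁, ht₁, htt⟩, rfl⟩ := h2
    have hdt : d ⊆ t := (Set.image_subset_image_iff φ.act_injective).1 hdt'
    -- Membership in degree 2 of `patchOf` only places `t` inside some tile of `V`; disjointness of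
    -- open tiles makes the two equal.
    obtain rfl : t = t₁ := by
      by_contra hne
      have hdis := T.tile_tile t ht t₁ (hV ht₁) hne
      obtain ⟨x, hx⟩ := (T.tile_connected t ht).1
      exact Set.disjoint_left.1 hdis hx (interior_mono htt hx)
    exact ⟨d, ⟨hd.1, t, (hUU t ht₁).2 ht', hdt⟩, rfl⟩
  · rintro c ⟨hc, t, ht, hct⟩
    exact (h k).2 c ⟨hc, t, hU ht, hct⟩

theorem MapsPatch.tile_mem {φ : RigidMotion} {V V' : Set (Set ℂ)}
    (h : T.MapsPatch φ (T.patchOf V) (T.patchOf V')) (hV : V ⊆ T.tile) {t : Set ℂ}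
    (ht : t ∈ V) : φ.act '' t ∈ T.tile := by
  have h1 : φ.act '' t ∈ T.patchOf V' 2 := by
    rw [← (h 2).1]
    exact ⟨t, mem_patchOf_tile (hV ht) ht, rfl⟩
  exact h1.1

theorem MapsPatch.cell_mem {φ : RigidMotion} {V V' : Set (Set ℂ)}
    (h : T.MapsPatch φ (T.patchOf V) (T.patchOf V')) {k : ℕ} {c t : Set ℂ}
    (hc : c ∈ T.cell k) (ht : t ∈ V) (hct : c ⊆ t) : φ.act '' c ∈ T.cell k := by
  have h1 : φ.act '' c ∈ T.patchOf V' k := by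
    rw [← (h k).1]
    exact ⟨c, ⟨hc, t, ht, hct⟩, rfl⟩
  exact h1.1

/-- A tile containing the cell is at distance `0` from it, so the star belongs to the patch of every
radius `r ≥ 0`. -/
theorem motions_carriesStar {φ : RigidMotion} {k : ℕ} {c c' : Set ℂ} (hc : c ∈ T.cell k) {r : ℝ}
    (hr : 0 ≤ r) (h : φ ∈ T.motions c c' r) : T.CarriesStar φ c c' := by
  obtain ⟨⟨y, hy⟩, -⟩ := T.cell_nonempty_bounded hc
  obtain ⟨rfl, h⟩ := h
  refine ⟨rfl, mapsPatch_patchOf_of_subset h (fun t ht => ht.1) (fun t ht => ht.1) ?_ ?_ ?_⟩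
  · rintro t ⟨ht, hct⟩
    exact ⟨ht, y, hct hy, y, hy, by simpa⟩
  · rintro t ⟨ht, hct⟩
    exact ⟨ht, _, hct ⟨y, hy, rfl⟩, _, ⟨y, hy, rfl⟩, by simpa⟩
  · intro t ht
    have h2 := h.tile_mem (fun t ht => ht.1) ht
    simp only [Set.mem_ofPred_eq, ht.1, h2, true_and,
      Set.image_subset_image_iff φ.act_injective]

/-- A motion carrying the star of a cell carries the star of each larger cell. -/
theorem CarriesStar.coface {φ : RigidMotion} {c c' d : Set ℂ} (h : T.CarriesStar φ c c')
    (hcd : c ⊆ d) : T.CarriesStar φ d (φ.act '' d) := by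
  obtain ⟨rfl, h⟩ := h
  refine ⟨rfl, mapsPatch_patchOf_of_subset h (fun t ht => ht.1) (fun t ht => ht.1) ?_ ?_ ?_⟩
  · rintro t ⟨ht, hct⟩
    exact ⟨ht, hcd.trans hct⟩
  · rintro t ⟨ht, hct⟩
    exact ⟨ht, (Set.image_mono hcd).trans hct⟩
  · intro t ht
    have h2 := h.tile_mem (fun t ht => ht.1) ht
    simp only [Set.mem_ofPred_eq, ht.1, h2, true_and,
      Set.image_subset_image_iff φ.act_injective]

theorem CarriesStar.tile_mem {φ : RigidMotion} {c c' t : Set ℂ} (h : T.CarriesStar φ c c')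
    (ht : t ∈ T.tile) (hct : c ⊆ t) : φ.act '' t ∈ T.tile :=
  MapsPatch.tile_mem h.2 (fun _ ht => ht.1) ⟨ht, hct⟩

theorem CarriesStar.exists_preimage {φ : RigidMotion} {c c' t' : Set ℂ}
    (h : T.CarriesStar φ c c') (ht : t' ∈ T.tile) (hct : c' ⊆ t') :
    ∃ t ∈ T.tile, c ⊆ t ∧ φ.act '' t = t' := by
  have h2 : t' ∈ (fun c => φ.act '' c) '' T.star c 2 := by
    rw [(h.2 2).1]
    exact mem_patchOf_tile ht ⟨ht, hct⟩
  obtain ⟨t, ⟨hT, -⟩, rfl⟩ := h2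
  refine ⟨t, hT, ?_, rfl⟩
  rw [← h.1] at hct
  exact (Set.image_subset_image_iff φ.act_injective).1 hct

/-- A motion matching large patches at a cell matches smaller patches at each cell nearby. -/
theorem motions_coface {φ : RigidMotion} {d d' c : Set ℂ} {r R D : ℝ}
    (h : φ ∈ T.motions d d' R) (hcd : ∀ x ∈ c, ∃ y ∈ d, dist x y ≤ D) (hR : r + D ≤ R) :
    φ ∈ T.motions c (φ.act '' c) r := by
  obtain ⟨rfl, h⟩ := h
  refine ⟨rfl, mapsPatch_patchOf_of_subset h (fun t ht => ht.1) (fun t ht => ht.1) ?_ ?_ ?_⟩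
  · rintro t ⟨ht, x, hx, y, hy, hxy⟩
    obtain ⟨z, hz, hyz⟩ := hcd y hy
    exact ⟨ht, x, hx, z, hz, (dist_triangle x y z).trans (by linarith)⟩
  · rintro t ⟨ht, x, hx, _, ⟨y, hy, rfl⟩, hxy⟩
    obtain ⟨z, hz, hyz⟩ := hcd y hy
    refine ⟨ht, x, hx, φ.act z, ⟨z, hz, rfl⟩, (dist_triangle x (φ.act y) _).trans ?_⟩
    rw [φ.dist_act]
    linarith
  · intro t ht
    have h2 := h.tile_mem (fun t ht => ht.1) ht
    simp only [Set.mem_ofPred_eq, ht.1, h2, true_and, Set.exists_mem_image, φ.dist_act]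

theorem CarriesStar.invComp_self {φ ψ : RigidMotion} {c c' : Set ℂ} (hφ : T.CarriesStar φ c c')
    (hψ : T.CarriesStar ψ c c') : T.CarriesStar (ψ.invComp φ) c c := by
  have key : ∀ d : Set ℂ, ψ.act '' ((ψ.invComp φ).act '' d) = φ.act '' d := fun d => by
    simp only [Set.image_image, RigidMotion.act_invComp]
  have hmem : ∀ k, ∀ d, d ∈ T.star c k ↔ (ψ.invComp φ).act '' d ∈ T.star c k := fun k d => by
    rw [← φ.image_injective.mem_set_image (s := T.star c k), (hφ.2 k).1,
      ← ψ.image_injective.mem_set_image (s := T.star c k) (a := (ψ.invComp φ).act '' d),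
      (hψ.2 k).1]
    simp only [key]
  refine ⟨ψ.image_injective ?_, fun k => ⟨?_, ?_⟩⟩
  · simp only [key, hφ.1, hψ.1]
  · apply Set.Subset.antisymm
    · rintro _ ⟨d, hd, rfl⟩
      exact (hmem k d).1 hd
    · intro d hd
      have h1 : ψ.act '' d ∈ (fun c => φ.act '' c) '' T.star c k := by
        rw [(hφ.2 k).1, ← (hψ.2 k).1]
        exact ⟨d, hd, rfl⟩
      obtain ⟨b, hb, hbd⟩ := h1
      refine ⟨b, hb, ψ.image_injective ?_⟩
      simp only [key, hbd]
  · intro d hd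
    rw [← (hφ.2 k).2 d hd, ← (hψ.2 k).2 _ ((hmem k d).1 hd), key]

/-- Rigid motions carrying a tile with trivial isotropy to a given place are unique. -/
theorem TrivialCellIsotropy.act_eq (hiso : T.TrivialCellIsotropy) {φ ψ : RigidMotion} {k : ℕ}
    {c c' : Set ℂ} (hc : c ∈ T.cell k) (hφ : T.CarriesStar φ c c') (hψ : T.CarriesStar ψ c c')
    {x : ℂ} (hx : x ∈ c) : φ.act x = ψ.act x := by
  rw [← RigidMotion.act_invComp ψ φ, hiso k c hc _ (hφ.invComp_self hψ) x hx]

theorem exists_ne_mem_tile {t : Set ℂ} (ht : t ∈ T.tile) : ∃ x ∈ t, ∃ y ∈ t, x ≠ y := by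
  obtain ⟨n, hn, p, hp, -, hf⟩ := T.tile_frontier t ht
  have hmem : ∀ i, p i ∈ t := fun i => by
    rw [← (T.tile_compact t ht).isClosed.closure_eq]
    apply frontier_subset_closure
    rw [hf]
    exact Set.mem_iUnion.2 ⟨i, left_mem_segment ℝ _ _⟩
  have : Fact (1 < n) := ⟨by omega⟩
  exact ⟨p 0, hmem 0, p 1, hmem 1, fun h => zero_ne_one (hp h)⟩

/-- By trivial isotropy `φ` agrees on `t` with the motion that is compatible with the placements of
the common prototile. A tile has two different points, so the two motions have the same rotation
part. Equivariance of everything built from `τ` rests on this. -/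
theorem Prototiles.tau_of_carriesStar (hiso : T.TrivialCellIsotropy) (P : T.Prototiles)
    {φ : RigidMotion} {t t' : Set ℂ} (ht : t ∈ T.tile) (ht' : t' ∈ T.tile)
    (h : T.CarriesStar φ t t') : P.tau t' = φ.rot + P.tau t := by
  obtain ⟨ψ, hψ, hP⟩ := P.prototile_eq t ht t' ht' ⟨φ, h⟩
  obtain ⟨x, hx, y, hy, hxy⟩ := exists_ne_mem_tile ht
  have e : ∀ z ∈ t, φ.act z = ψ.act ((⟨0, 0⟩ : RigidMotion).act z) := fun z hz => by
    rw [hiso.act_eq (k := 2) ht h hψ hz]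
    simp [RigidMotion.act]
  have h1 : φ.rot = ψ.rot + 0 :=
    RigidMotion.rot_eq_add_of_act_eq (χ := ⟨0, 0⟩) hxy (e x hx) (e y hy)
  rw [add_zero] at h1
  rw [h1]
  exact RigidMotion.rot_eq_add_of_act_eq zero_ne_one (hP 0) (hP 1)

theorem Prototiles.mem_angles_iff (hiso : T.TrivialCellIsotropy) (P : T.Prototiles)
    {φ : RigidMotion} {c c' : Set ℂ} (h : T.CarriesStar φ c c') (a : Real.Angle) :
    φ.rot + a ∈ P.angles c' ↔ a ∈ P.angles c := by
  have tau : ∀ t ∈ T.tile, c ⊆ t → P.tau (φ.act '' t) = φ.rot + P.tau t := fun t ht hct =>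
    P.tau_of_carriesStar hiso ht (h.tile_mem ht hct) (h.coface hct)
  constructor
  · rintro ⟨t', ht', hct', ha⟩
    obtain ⟨t, ht, hct, rfl⟩ := h.exists_preimage ht' hct'
    refine ⟨t, ht, hct, ?_⟩
    rw [tau t ht hct, add_assoc] at ha
    simpa only [add_right_inj] using ha
  · rintro ⟨t, ht, hct, ha⟩
    refine ⟨φ.act '' t, h.tile_mem ht hct, ?_, ?_⟩
    · rw [← h.1]
      exact Set.image_mono hct
    · rw [tau t ht hct, add_assoc]
      simpa only [add_right_inj] using ha

/-! ### Invariance of incidence numbers and boundaries under motions -/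

namespace EdgeOrientation

variable (o : T.EdgeOrientation)

/-- Rotations commute with multiplication by `I`, so normals go to normals once `consistent` has
matched the ends. -/
theorem isLeft_iff {φ : RigidMotion} {e e' t : Set ℂ} (he : e ∈ T.edge) (he' : e' ∈ T.edge)
    (h : T.CarriesStar φ e e') : o.IsLeft (φ.act '' t) e' ↔ o.IsLeft t e := by
  obtain ⟨h1, h2⟩ := o.consistent e he e' he' φ h
  simp only [IsLeft, ← h1, ← h2, ← φ.image_interior, ← φ.act_midpoint, φ.act_sub]
  refine Filter.eventually_congr (Filter.Eventually.of_forall fun ε => ?_)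
  rw [← φ.act_injective.mem_set_image (s := interior t), φ.act_add]
  congr! 2
  ring

theorem isRight_iff {φ : RigidMotion} {e e' t : Set ℂ} (he : e ∈ T.edge) (he' : e' ∈ T.edge)
    (h : T.CarriesStar φ e e') : o.IsRight (φ.act '' t) e' ↔ o.IsRight t e := by
  obtain ⟨h1, h2⟩ := o.consistent e he e' he' φ h
  simp only [IsRight, ← h1, ← h2, ← φ.image_interior, ← φ.act_midpoint, φ.act_sub]
  refine Filter.eventually_congr (Filter.Eventually.of_forall fun ε => ?_)
  rw [← φ.act_injective.mem_set_image (s := interior t), φ.act_sub_right]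
  congr! 2
  ring

theorem inc_image {φ : RigidMotion} {k : ℕ} {c d : Set ℂ} (hc : c ∈ T.cell (k + 1))
    (hc' : φ.act '' c ∈ T.cell (k + 1)) (hd : d ∈ T.cell k) (hd' : φ.act '' d ∈ T.cell k)
    (h : T.CarriesStar φ d (φ.act '' d)) (hdc : d ⊆ c) :
    o.inc k (φ.act '' c) (φ.act '' d) = o.inc k c d := by
  match k with
  | 0 =>
    obtain ⟨h1, h2⟩ := o.consistent c hc _ hc' φ (h.coface hdc)
    simp only [inc, ← h1, ← h2, ← Set.image_singleton (f := φ.act), φ.image_injective.eq_iff]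
  | 1 =>
    have h1 := o.isLeft_iff (t := c) hd hd' h
    have h2 := o.isRight_iff (t := c) hd hd' h
    classical
    exact congrArg₂ (fun x y : ℤ => x - y) (if_congr h1 rfl rfl) (if_congr h2 rfl rfl)
  | _ + 2 => rfl

/-- If `φ` matches the values of two chains, it matches the values of their boundaries. -/
theorem boundary_eq_of_motions {k : ℕ} {σ σ' : T.cell (k + 1) → ℤ} {φ : RigidMotion} {r R D : ℝ}
    (hr : 0 ≤ r) (hD : 0 ≤ D)
    (hcell : ∀ c ∈ T.cell (k + 1), ∃ t ∈ T.tile, c ⊆ t ∧ ∀ x ∈ t, ∀ y ∈ t, dist x y ≤ D)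
    (hσ : ∀ c c' : T.cell (k + 1), φ ∈ T.motions c.1 c'.1 r → σ c = σ' c') (hR : r + D ≤ R)
    {d d' : T.cell k} (h : φ ∈ T.motions d.1 d'.1 R) :
    o.boundary k σ d = o.boundary k σ' d' := by
  have hstar := motions_carriesStar d.2 (by linarith) h
  obtain ⟨⟨y, hy⟩, -⟩ := T.cell_nonempty_bounded d.2
  have hmem : ∀ c ∈ T.cell (k + 1), d.1 ⊆ c → φ.act '' c ∈ T.cell (k + 1) := fun c hc hdc => by
    obtain ⟨t, ht, hct, -⟩ := hcell c hc
    exact MapsPatch.cell_mem hstar.2 hc ⟨ht, hdc.trans hct⟩ hct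
  -- A coface lies in a tile of diameter at most `D`, so each of its points is within `D` of the
  -- face; this is the loss of radius.
  have hmot : ∀ c ∈ T.cell (k + 1), d.1 ⊆ c → φ ∈ T.motions c (φ.act '' c) r :=
    fun c hc hdc => by
    obtain ⟨t, ht, hct, hdist⟩ := hcell c hc
    exact motions_coface h (fun x hx => ⟨y, hy, hdist x (hct hx) y (hct (hdc hy))⟩) hR
  simp only [boundary, AddMonoidHom.coe_mk, ZeroHom.coe_mk]
  have hf : ∀ (j : ℕ) (b : T.cell j) (c : Set ℂ),
      c ∈ (T.finite_cofaces (j + 1) b.2).toFinset ↔ c ∈ T.cell (j + 1) ∧ b.1 ⊆ c := by simp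
  refine Finset.sum_bij (fun c _ => ⟨φ.act '' c.1, ?_⟩) ?_ ?_ ?_ ?_
  · have := (hf k d _).1 c.2
    refine (hf k d' _).2 ⟨hmem _ this.1 this.2, ?_⟩
    rw [← h.1]
    exact Set.image_mono this.2
  · exact fun c _ => Finset.mem_attach _ _
  · intro c _ c' _ hcc
    exact Subtype.ext (φ.image_injective (congrArg Subtype.val hcc))
  · rintro ⟨c', hc'⟩ -
    obtain ⟨hc'1, hc'2⟩ := (hf k d' _).1 hc'
    obtain ⟨t', ht', hct', -⟩ := hcell c' hc'1
    have h1 : c' ∈ (fun c => φ.act '' c) '' T.star d.1 (k + 1) := by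
      rw [(hstar.2 _).1]
      exact ⟨hc'1, t', ⟨ht', hc'2.trans hct'⟩, hct'⟩
    obtain ⟨c, hc, rfl⟩ := h1
    rw [← h.1] at hc'2
    exact ⟨⟨c, (hf k d _).2 ⟨hc.1, (Set.image_subset_image_iff φ.act_injective).1 hc'2⟩⟩,
      Finset.mem_attach _ _, rfl⟩
  · intro c _
    have hc := (hf k d _).1 c.2
    have hd' : φ.act '' d.1 ∈ T.cell k := h.1 ▸ d'.2
    have hinc := o.inc_image hc.1 (hmem _ hc.1 hc.2) d.2 hd'
      (hstar.coface subset_rfl) hc.2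
    rw [h.1] at hinc
    rw [hinc, hσ ⟨c.1, hc.1⟩ ⟨φ.act '' c.1, hmem _ hc.1 hc.2⟩ (hmot _ hc.1 hc.2)]

end EdgeOrientation

end PlaneTiling

/-! ### Plane geometry around segments -/

-- Off its frontier a set is separated by two open sets, its interior and the complement of its
-- closure; a connected set stays in one of them.
open Filter Topology in
theorem IsPreconnected.subset_interior_of_disjoint_frontier {X : Type*} [TopologicalSpace X]
    {H t : Set X} (hH : IsPreconnected H) (hd : Disjoint H (frontier t))
    (hne : (H ∩ t).Nonempty) : H ⊆ interior t := by
  have hmem : ∀ z ∈ H, z ∈ closure t → z ∈ interior t := fun z hz hzt => by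
    by_contra hzi
    exact Set.disjoint_left.1 hd hz ⟨hzt, hzi⟩
  refine hH.subset_left_of_subset_union isOpen_interior isClosed_closure.isOpen_compl
    (Set.disjoint_left.2 fun z hz hz' => hz' (subset_closure (interior_subset hz)))
    (fun z hz => ?_) ?_
  · by_cases h : z ∈ closure t
    · exact Or.inl (hmem z hz h)
    · exact Or.inr h
  · obtain ⟨z, hz, hzt⟩ := hne
    exact ⟨z, hz, hmem z hz (subset_closure hzt)⟩

/-- An end of a segment is an extreme point: if `c` were strictly between `a` and `b`, a positive
combination of their nonnegative parameters measured from `c` would vanish, forcing `a = b`. -/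
theorem eq_or_eq_of_mem_segment {a b c d : ℂ} (hab : a ≠ b) (hc : c ∈ segment ℝ a b)
    (ha : a ∈ segment ℝ c d) (hb : b ∈ segment ℝ c d) : c = a ∨ c = b := by
  by_contra! h
  obtain ⟨α, β, hα, hβ, hαβ, hc⟩ := mem_openSegment_of_ne_left_right h.1.symm h.2.symm hc
  rw [segment_eq_image'] at ha hb
  obtain ⟨s, ⟨hs, -⟩, rfl⟩ := ha
  obtain ⟨t, ⟨ht, -⟩, rfl⟩ := hb
  simp only [Complex.real_smul] at hc hab
  have h1 : ((α * s + β * t : ℝ) : ℂ) * (d - c) = 0 := by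
    have h2 : (α : ℂ) + β = 1 := by exact_mod_cast hαβ
    push_cast
    linear_combination hc - c * h2
  rcases mul_eq_zero.1 h1 with h0 | h0
  · have h0' : α * s + β * t = 0 := by exact_mod_cast h0
    have h3 : 0 ≤ α * s := by positivity
    have h4 : 0 ≤ β * t := by positivity
    have hs0 : s = 0 := by
      rcases mul_eq_zero.1 (by linarith : α * s = 0) with h | h
      · exact absurd h hα.ne'
      · exact h
    have ht0 : t = 0 := by
      rcases mul_eq_zero.1 (by linarith : β * t = 0) with h | h
      · exact absurd h hβ.ne'
      · exact h
    exact hab (by rw [hs0, ht0])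
  · exact hab (by rw [h0, mul_zero, mul_zero])

theorem eq_or_eq_of_segment_eq {a b c d : ℂ} (hab : a ≠ b)
    (h : segment ℝ a b = segment ℝ c d) : (a = c ∧ b = d) ∨ (a = d ∧ b = c) := by
  have ha : a ∈ segment ℝ c d := h ▸ left_mem_segment ℝ a b
  have hb : b ∈ segment ℝ c d := h ▸ right_mem_segment ℝ a b
  have hc : c ∈ segment ℝ a b := h ▸ left_mem_segment ℝ c d
  have hd : d ∈ segment ℝ a b := h ▸ right_mem_segment ℝ c d
  have hcd : c ≠ d := by
    rintro rfl
    rw [segment_same] at ha hb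
    exact hab (ha.trans hb.symm)
  have h1 := eq_or_eq_of_mem_segment hab hc ha hb
  have h2 := eq_or_eq_of_mem_segment hab hd (segment_symm ℝ c d ▸ ha) (segment_symm ℝ c d ▸ hb)
  rcases h1 with rfl | rfl <;> rcases h2 with rfl | rfl <;> simp_all

/-- The open half disc about `x` on the left of the direction `d`. -/
def sideBall (x d : ℂ) (δ : ℝ) : Set ℂ :=
  {z | dist z x < δ ∧ 0 < ((z - x) * (starRingEnd ℂ) d).im}

theorem isPreconnected_sideBall (x d : ℂ) (δ : ℝ) : IsPreconnected (sideBall x d δ) := by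
  refine Convex.isPreconnected ?_
  have h1 : Convex ℝ {z : ℂ | dist z x < δ} := convex_ball x δ
  suffices h2 : Convex ℝ {z : ℂ | 0 < ((z - x) * (starRingEnd ℂ) d).im} from h1.inter h2
  intro z hz w hw a b ha hb hab
  simp only [Set.mem_ofPred_eq] at hz hw ⊢
  have hab' : (a : ℂ) + b = 1 := by exact_mod_cast hab
  have : (a • z + b • w - x) * (starRingEnd ℂ) d =
      (a : ℂ) * ((z - x) * (starRingEnd ℂ) d) + b * ((w - x) * (starRingEnd ℂ) d) := by
    simp only [Complex.real_smul]
    linear_combination (x * (starRingEnd ℂ) d) * hab'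
  rw [this, Complex.add_im, Complex.im_ofReal_mul, Complex.im_ofReal_mul]
  rcases ha.eq_or_lt with rfl | ha
  · have : b = 1 := by linarith
    subst this
    simpa using hw
  · have := mul_pos ha hz
    have := mul_nonneg hb hw.le
    linarith

theorem im_mul_conj_of_mem_segment {a b x z : ℂ} (hx : x ∈ segment ℝ a b)
    (hz : z ∈ segment ℝ a b) : ((z - x) * (starRingEnd ℂ) (b - a)).im = 0 := by
  rw [segment_eq_image'] at hx hz
  obtain ⟨s, -, rfl⟩ := hx
  obtain ⟨t, -, rfl⟩ := hz
  simp only [Complex.real_smul]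
  rw [show (a + t * (b - a) - (a + s * (b - a))) * (starRingEnd ℂ) (b - a) =
    ((t - s : ℝ) : ℂ) * ((b - a) * (starRingEnd ℂ) (b - a)) by push_cast; ring, Complex.mul_conj,
    ← Complex.ofReal_mul, Complex.ofReal_im]

open Filter Topology in
theorem tendsto_add_mul_I (x d : ℂ) :
    Tendsto (fun ε : ℝ => x + ε * (Complex.I * d)) (𝓝[>] 0) (𝓝 x) := by
  have : Continuous fun ε : ℝ => x + ε * (Complex.I * d) := by fun_prop
  have h := this.tendsto 0
  simp only [Complex.ofReal_zero, zero_mul, add_zero] at h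
  exact h.mono_left nhdsWithin_le_nhds

-- Moving by `ε * I * d` adds `ε |d|²` to the imaginary part that measures the side.
open Filter Topology in
theorem eventually_mem_sideBall {x z d : ℂ} (hd : d ≠ 0) {δ : ℝ} (hz : dist z x < δ)
    (him : 0 ≤ ((z - x) * (starRingEnd ℂ) d).im) :
    ∀ᶠ ε : ℝ in 𝓝[>] 0, z + ε * (Complex.I * d) ∈ sideBall x d δ := by
  have h1 := (tendsto_add_mul_I z d).eventually (Metric.isOpen_ball.mem_nhds (x := z) (s := Metric.ball x δ) hz)
  filter_upwards [h1, self_mem_nhdsWithin] with ε h1 h2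
  refine ⟨h1, ?_⟩
  rw [show (z + ε * (Complex.I * d) - x) * (starRingEnd ℂ) d =
    (z - x) * (starRingEnd ℂ) d + ((ε : ℝ) : ℂ) * (Complex.I * (d * (starRingEnd ℂ) d)) by ring,
    Complex.add_im, Complex.im_ofReal_mul, Complex.mul_conj, Complex.I_mul_im, Complex.ofReal_re]
  have := mul_pos (Set.mem_Ioi.1 h2) (Complex.normSq_pos.2 hd)
  linarith

theorem mem_closure_sideBall {x z d : ℂ} (hd : d ≠ 0) {δ : ℝ} (hz : dist z x < δ)
    (him : 0 ≤ ((z - x) * (starRingEnd ℂ) d).im) : z ∈ closure (sideBall x d δ) :=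
  mem_closure_of_tendsto (tendsto_add_mul_I z d) (eventually_mem_sideBall hd hz him)

theorem sideBall_nonempty {x d : ℂ} (hd : d ≠ 0) {δ : ℝ} (hδ : 0 < δ) :
    (sideBall x d δ).Nonempty :=
  (eventually_mem_sideBall (z := x) hd (by simpa using hδ) (by simp)).exists.imp' _ fun _ h => h

theorem sideBall_subset_sideBall {x y d : ℂ} {δ : ℝ}
    (h : ((y - x) * (starRingEnd ℂ) d).im = 0) :
    sideBall y d (δ - dist y x) ⊆ sideBall x d δ := by
  rintro z ⟨hz, hzi⟩
  refine ⟨(dist_triangle z y x).trans_lt (by linarith), ?_⟩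
  rw [show (z - x) * (starRingEnd ℂ) d =
    (z - y) * (starRingEnd ℂ) d + (y - x) * (starRingEnd ℂ) d by ring, Complex.add_im, h, add_zero]
  exact hzi

-- Leaving the ray from `b` along the circle, anticlockwise for `σ = 1` and clockwise for `σ = -1`,
-- leads to the left of the direction `σ u`: the relevant imaginary part is `s k sin η`.
open Filter Topology in
theorem eventually_arc_mem_sideBall (b : ℂ) {u : ℂ} (hu : ‖u‖ = 1) {s k δ σ : ℝ} (hs : 0 < s)
    (hk : 0 < k) (hδ : 0 < δ) (hσ : σ = 1 ∨ σ = -1) :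
    ∀ᶠ η : ℝ in 𝓝[>] 0,
      b + s * u * Complex.exp ((σ * η : ℝ) * Complex.I) ∈
        sideBall (b + s * u) ((σ * k : ℝ) * u) δ := by
  have hc : Continuous fun η : ℝ => b + s * u * Complex.exp ((σ * η : ℝ) * Complex.I) := by
    fun_prop
  have h0 := hc.tendsto 0
  simp only [mul_zero, Complex.ofReal_zero, zero_mul, Complex.exp_zero, mul_one] at h0
  have h1 := (h0.mono_left (nhdsWithin_le_nhds (s := Set.Ioi 0))).eventually
    (Metric.ball_mem_nhds (b + s * u) hδ)
  have h2 : ∀ᶠ η : ℝ in 𝓝[>] 0, η < Real.pi :=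
    nhdsWithin_le_nhds (gt_mem_nhds Real.pi_pos)
  filter_upwards [h1, h2, self_mem_nhdsWithin] with η h1 h2 h3
  refine ⟨h1, ?_⟩
  have hu' : u * (starRingEnd ℂ) u = 1 := by
    rw [Complex.mul_conj, Complex.normSq_eq_norm_sq, hu]
    simp
  rw [map_mul, Complex.conj_ofReal,
    show (b + s * u * Complex.exp ((σ * η : ℝ) * Complex.I) - (b + s * u)) *
      ((σ * k : ℝ) * (starRingEnd ℂ) u) =
      ((s * (σ * k) : ℝ) : ℂ) * (Complex.exp ((σ * η : ℝ) * Complex.I) - 1) *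
        (u * (starRingEnd ℂ) u) by push_cast; ring, hu', mul_one, Complex.im_ofReal_mul,
    Complex.sub_im, Complex.exp_ofReal_mul_I_im, Complex.one_im, sub_zero]
  have hsin := Real.sin_pos_of_pos_of_lt_pi h3 h2
  rcases hσ with rfl | rfl
  · simp only [one_mul]
    positivity
  · simp only [neg_mul, one_mul, Real.sin_neg, mul_neg, neg_neg]
    positivity

/-- A nonnegative real of norm `1` is `1`. The lemma keeps the inside of a circular sector off its
two bounding rays. -/
theorem exp_mul_I_ne_of_nonneg {θ r : ℝ} (h0 : 0 < θ) (h1 : θ < 2 * Real.pi) (hr : 0 ≤ r) :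
    Complex.exp (θ * Complex.I) ≠ r := by
  intro h
  have hn := congrArg norm h
  rw [Complex.norm_exp_ofReal_mul_I, Complex.norm_real, Real.norm_of_nonneg hr] at hn
  rw [← hn, Complex.ofReal_one, Complex.exp_eq_one_iff] at h
  obtain ⟨n, hn⟩ := h
  have h2 : (θ : ℂ) = ((n * (2 * Real.pi) : ℝ) : ℂ) := by
    have := mul_right_cancel₀ Complex.I_ne_zero
      (hn.trans (by ring : (n : ℂ) * (2 * Real.pi * Complex.I) = (n * (2 * Real.pi)) * Complex.I))
    rw [this]
    push_cast
    ring
  have h3 : θ = n * (2 * Real.pi) := by exact_mod_cast h2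
  have hp := Real.two_pi_pos
  have h4 : (0 : ℝ) < n := by
    by_contra hn
    nlinarith
  have h5 : (n : ℝ) < 1 := by
    by_contra hn
    nlinarith
  have h6 : 0 < n := by exact_mod_cast h4
  have h7 : n < 1 := by exact_mod_cast h5
  omega

/-- The anticlockwise angle from the direction `w` to a direction `u` which is not a positive
multiple of `w`. -/
theorem exists_angle {u w : ℂ} (hu : u ≠ 0) (hw : w ≠ 0)
    (h : ∀ l : ℝ, 0 < l → u ≠ l * w) :
    ∃ φ : ℝ, 0 < φ ∧ φ < 2 * Real.pi ∧
      u / ‖u‖ = w / ‖w‖ * Complex.exp (φ * Complex.I) := by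
  have hn : (‖u‖ : ℂ) ≠ 0 := by simpa using hu
  have hm : (‖w‖ : ℂ) ≠ 0 := by simpa using hw
  have h1 : u / ‖u‖ = w / ‖w‖ * Complex.exp ((u / w).arg * Complex.I) := by
    have := Complex.norm_mul_exp_arg_mul_I (u / w)
    rw [norm_div, Complex.ofReal_div, div_mul_eq_mul_div, div_eq_div_iff hm hw] at this
    field_simp
    linear_combination -this
  have h2 := Complex.neg_pi_lt_arg (u / w)
  have h3 := Complex.arg_le_pi (u / w)
  have hp := Real.pi_pos
  have h4 : (u / w).arg ≠ 0 := by
    intro h4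
    rw [h4, Complex.ofReal_zero, zero_mul, Complex.exp_zero, mul_one] at h1
    refine h (‖u‖ / ‖w‖) (div_pos (norm_pos_iff.2 hu) (norm_pos_iff.2 hw)) ?_
    push_cast
    field_simp at h1 ⊢
    linear_combination h1
  rcases lt_or_gt_of_ne h4 with h5 | h5
  · refine ⟨(u / w).arg + 2 * Real.pi, by linarith, by linarith, ?_⟩
    rw [h1]
    push_cast
    rw [add_mul, Complex.exp_add, Complex.exp_two_pi_mul_I, mul_one]
  · exact ⟨(u / w).arg, h5, by linarith, h1⟩

theorem add_mul_mem_openSegment {b w : ℂ} (hw : w ≠ 0) {s : ℝ} (hs : 0 < s) (hsw : s < ‖w‖) :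
    b + s * (w / ‖w‖) ∈ openSegment ℝ b (b + w) := by
  rw [openSegment_eq_image']
  have hn : 0 < ‖w‖ := norm_pos_iff.2 hw
  refine ⟨s / ‖w‖, ⟨by positivity, (div_lt_one hn).2 hsw⟩, ?_⟩
  simp only [Complex.real_smul, add_sub_cancel_left]
  push_cast
  ring

namespace PlaneTiling

variable {L : Type*} {T : PlaneTiling L}

/-! ### Local structure of a polygonal tiling -/

theorem exists_edge_of_mem_frontier {t : Set ℂ} (ht : t ∈ T.tile) {x : ℂ} (hx : x ∈ frontier t) :
    ∃ e ∈ T.edge, x ∈ e ∧ e ⊆ frontier t := by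
  obtain ⟨n, -, p, -, he, hf⟩ := T.tile_frontier t ht
  rw [hf] at hx ⊢
  obtain ⟨i, hi⟩ := Set.mem_iUnion.1 hx
  exact ⟨_, he i, hi, Set.subset_iUnion (fun i => segment ℝ (p i) (p (i + 1))) i⟩

theorem frontier_subset_tile {t : Set ℂ} (ht : t ∈ T.tile) : frontier t ⊆ t :=
  (T.tile_compact t ht).isClosed.frontier_subset

theorem exists_tile (x : ℂ) : ∃ t ∈ T.tile, x ∈ t := by
  have : x ∈ ⋃₀ T.tile := T.cover ▸ Set.mem_univ x
  exact this

theorem tile_eq_of_mem_interior {t t' : Set ℂ} (ht : t ∈ T.tile) (ht' : t' ∈ T.tile) {x : ℂ}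
    (hx : x ∈ interior t) (hx' : x ∈ interior t') : t = t' := by
  by_contra h
  exact Set.disjoint_left.1 (T.tile_tile t ht t' ht' h) hx hx'

theorem edge_ends {a b : ℂ} (he : segment ℝ a b ∈ T.edge) :
    a ≠ b ∧ a ∈ T.vertex ∧ b ∈ T.vertex ∧ Disjoint (openSegment ℝ a b) T.vertex := by
  obtain ⟨c, hc, d, hd, hcd, h, hdis⟩ := T.edge_segment _ he
  rcases eq_or_eq_of_segment_eq hcd h.symm with ⟨rfl, rfl⟩ | ⟨rfl, rfl⟩
  · exact ⟨hcd, hc, hd, hdis⟩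
  · exact ⟨hcd.symm, hd, hc, openSegment_symm ℝ c d ▸ hdis⟩

theorem edge_isClosed {e : Set ℂ} (he : e ∈ T.edge) : IsClosed e := by
  obtain ⟨a, -, b, -, -, rfl, -⟩ := T.edge_segment e he
  rw [segment_eq_image']
  exact (isCompact_Icc.image (by fun_prop)).isClosed

theorem edge_eq_of_mem_openSegment {a b x : ℂ} (he : segment ℝ a b ∈ T.edge)
    (hx : x ∈ openSegment ℝ a b) {e' : Set ℂ} (he' : e' ∈ T.edge) (hxe : x ∈ e') :
    e' = segment ℝ a b := by
  by_contra h
  exact Set.disjoint_left.1 (edge_ends he).2.2.2 hx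
    (T.edge_inter e' he' _ he h ⟨hxe, openSegment_subset_segment ℝ a b hx⟩)

/-- By local finiteness the members of `S` that meet the unit ball but miss `x` have a closed union,
so a small ball about `x` avoids it. -/
theorem exists_ball_meets {S : Set (Set ℂ)} (hS : ∀ c ∈ S, IsClosed c) (x : ℂ)
    (hfin : {c ∈ S | (c ∩ Metric.ball x 1).Nonempty}.Finite) :
    ∃ δ > 0, ∀ c ∈ S, ∀ z ∈ c, dist z x < δ → x ∈ c := by
  have hcl : IsClosed (⋃ c ∈ {c ∈ S | (c ∩ Metric.ball x 1).Nonempty ∧ x ∉ c}, c) := by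
    refine Set.Finite.isClosed_biUnion (hfin.subset ?_) fun c hc => hS c hc.1
    exact fun c hc => ⟨hc.1, hc.2.1⟩
  have hx : x ∉ ⋃ c ∈ {c ∈ S | (c ∩ Metric.ball x 1).Nonempty ∧ x ∉ c}, c := by
    simp only [Set.mem_iUnion, not_exists]
    exact fun c hc hxc => hc.2.2 hxc
  obtain ⟨δ, hδ, hsub⟩ := Metric.isOpen_iff.1 hcl.isOpen_compl x hx
  refine ⟨min δ 1, lt_min hδ one_pos, fun c hc z hz hzx => ?_⟩
  by_contra hxc
  refine hsub (Metric.mem_ball.2 (hzx.trans_le (min_le_left _ _))) ?_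
  simp only [Set.mem_iUnion]
  exact ⟨c, ⟨hc, ⟨z, hz, Metric.mem_ball.2 (hzx.trans_le (min_le_right _ _))⟩, hxc⟩, hz⟩

theorem exists_ball_meets_edge (x : ℂ) :
    ∃ δ > 0, ∀ e ∈ T.edge, ∀ z ∈ e, dist z x < δ → x ∈ e :=
  exists_ball_meets (fun _ he => edge_isClosed he) x (T.finite_edge _ Metric.isBounded_ball)

theorem exists_ball_meets_tile (x : ℂ) :
    ∃ δ > 0, ∀ t ∈ T.tile, ∀ z ∈ t, dist z x < δ → x ∈ t :=
  exists_ball_meets (fun _ ht => (T.tile_compact _ ht).isClosed) x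
    (T.finite_tile _ Metric.isBounded_ball)

/-- The tile `t` contains a half disc about `x` on the left of the direction from `a` to `b`. -/
def IsSide (t : Set ℂ) (a b x : ℂ) : Prop :=
  ∃ δ > 0, sideBall x (b - a) δ ⊆ interior t

/-- Near a relative interior point there is no other edge, so a small open half disc meets no
frontier. A tile through one of its points therefore contains all of it. -/
theorem exists_side_tile {a b x : ℂ} (he : segment ℝ a b ∈ T.edge)
    (hx : x ∈ openSegment ℝ a b) : ∃ l ∈ T.tile, IsSide l a b x := by
  obtain ⟨δ, hδ, hball⟩ := T.exists_ball_meets_edge x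
  obtain ⟨hab, -⟩ := edge_ends he
  have hx' := openSegment_subset_segment ℝ a b hx
  have hdis : ∀ t ∈ T.tile, Disjoint (sideBall x (b - a) δ) (frontier t) := fun t ht => by
    refine Set.disjoint_left.2 fun z hz hzt => ?_
    obtain ⟨e', he', hze, -⟩ := exists_edge_of_mem_frontier ht hzt
    have h1 := edge_eq_of_mem_openSegment he hx he' (hball e' he' z hze hz.1)
    have h2 := im_mul_conj_of_mem_segment hx' (h1 ▸ hze)
    exact hz.2.ne' h2
  obtain ⟨z, hz⟩ := sideBall_nonempty (x := x) (sub_ne_zero.2 hab.symm) hδ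
  obtain ⟨l, hl, hzl⟩ := T.exists_tile z
  exact ⟨l, hl, δ, hδ, (isPreconnected_sideBall x (b - a) δ).subset_interior_of_disjoint_frontier
    (hdis l hl) ⟨z, hz, hzl⟩⟩

theorem sideBall_mono (x d : ℂ) {δ δ' : ℝ} (h : δ ≤ δ') : sideBall x d δ ⊆ sideBall x d δ' :=
  fun _ hz => ⟨hz.1.trans_le h, hz.2⟩

theorem IsSide.unique {a b x : ℂ} (hab : a ≠ b) {l t : Set ℂ} (hl : l ∈ T.tile)
    (ht : t ∈ T.tile) (h : IsSide l a b x) (h' : IsSide t a b x) : t = l := by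
  obtain ⟨δ, hδ, h⟩ := h
  obtain ⟨δ', hδ', h'⟩ := h'
  obtain ⟨z, hz⟩ := sideBall_nonempty (x := x) (sub_ne_zero.2 hab.symm) (lt_min hδ hδ')
  exact tile_eq_of_mem_interior ht hl (h' (sideBall_mono _ _ (min_le_right _ _) hz))
    (h (sideBall_mono _ _ (min_le_left _ _) hz))

-- The tile on a given side is locally constant along the open edge, which is connected.
open Filter Topology in
theorem isSide_of_isSide {a b x y : ℂ} (he : segment ℝ a b ∈ T.edge)
    (hx : x ∈ openSegment ℝ a b) (hy : y ∈ openSegment ℝ a b) {t : Set ℂ} (ht : t ∈ T.tile) :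
    IsSide t a b x ↔ IsSide t a b y := by
  obtain ⟨hab, -⟩ := edge_ends he
  refine (convex_openSegment a b).isPreconnected.induction₂
    (fun x y => IsSide t a b x ↔ IsSide t a b y) ?_ (fun _ _ _ _ _ _ => Iff.trans)
    (fun _ _ _ _ => Iff.symm) hx hy
  intro x hx
  obtain ⟨l, hl, hlx⟩ := exists_side_tile he hx
  obtain ⟨δ, hδ, hsub⟩ := id hlx
  filter_upwards [self_mem_nhdsWithin,
    nhdsWithin_le_nhds (Metric.ball_mem_nhds x hδ)] with y hy hyx
  have hly : IsSide l a b y := by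
    refine ⟨δ - dist y x, sub_pos.2 hyx, (sideBall_subset_sideBall ?_).trans hsub⟩
    exact im_mul_conj_of_mem_segment (openSegment_subset_segment ℝ a b hx)
      (openSegment_subset_segment ℝ a b hy)
  constructor
  · intro h
    rwa [IsSide.unique hab hl ht hlx h]
  · intro h
    rwa [IsSide.unique hab hl ht hly h]

theorem IsSide.mem {a b x : ℂ} (hab : a ≠ b) {t : Set ℂ} (ht : t ∈ T.tile)
    (h : IsSide t a b x) : x ∈ t := by
  obtain ⟨δ, hδ, h⟩ := h
  rw [← T.tile_regular t ht]
  exact closure_mono h (mem_closure_sideBall (sub_ne_zero.2 hab.symm) (by simpa using hδ)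
    (by simp))

theorem segment_subset_frontier {a b x : ℂ} (he : segment ℝ a b ∈ T.edge)
    (hx : x ∈ openSegment ℝ a b) {t : Set ℂ} (ht : t ∈ T.tile) (hxt : x ∈ t) :
    segment ℝ a b ⊆ frontier t := by
  have h1 : x ∈ frontier t := by
    refine ⟨subset_closure hxt, fun h => ?_⟩
    exact Set.disjoint_left.1 (T.tile_edge t ht _ he) h (openSegment_subset_segment ℝ a b hx)
  obtain ⟨e', he', hxe, hsub⟩ := exists_edge_of_mem_frontier ht h1
  rwa [edge_eq_of_mem_openSegment he hx he' hxe] at hsub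

/-- Were one tile on both sides, then, being closed, it would contain a full disc about `x`, and the
edge would meet its interior. -/
theorem IsSide.ne {a b x : ℂ} (he : segment ℝ a b ∈ T.edge) (hx : x ∈ openSegment ℝ a b)
    {l r : Set ℂ} (hl : l ∈ T.tile) (h : IsSide l a b x) (h' : IsSide r b a x) : l ≠ r := by
  rintro rfl
  obtain ⟨hab, -⟩ := edge_ends he
  obtain ⟨δ, hδ, h⟩ := h
  obtain ⟨δ', hδ', h'⟩ := h'
  have hball : Metric.ball x (min δ δ') ⊆ l := by
    intro z hz
    rw [← T.tile_regular l hl]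
    rcases le_total 0 ((z - x) * (starRingEnd ℂ) (b - a)).im with him | him
    · exact closure_mono h (mem_closure_sideBall (sub_ne_zero.2 hab.symm)
        (hz.trans_le (min_le_left _ _)) him)
    · refine closure_mono h' (mem_closure_sideBall (sub_ne_zero.2 hab)
        (hz.trans_le (min_le_right _ _)) ?_)
      rw [← neg_sub b a, map_neg, mul_neg, Complex.neg_im]
      linarith
  have hint : x ∈ interior l :=
    mem_interior.2 ⟨_, hball, Metric.isOpen_ball, Metric.mem_ball_self (lt_min hδ hδ')⟩
  exact Set.disjoint_left.1 (T.tile_edge l hl _ he) hint (openSegment_subset_segment ℝ a b hx)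

/-- Regularity makes `x` a limit of interior points of `t`. Near `x` such a point lies in the
closure of one of the two half discs, so `t` overlaps the tile on that side. -/
theorem isSide_or_isSide {a b x : ℂ} (he : segment ℝ a b ∈ T.edge)
    (hx : x ∈ openSegment ℝ a b) {t : Set ℂ} (ht : t ∈ T.tile) (hxt : x ∈ t) :
    IsSide t a b x ∨ IsSide t b a x := by
  have he' : segment ℝ b a ∈ T.edge := segment_symm ℝ a b ▸ he
  have hx' : x ∈ openSegment ℝ b a := openSegment_symm ℝ a b ▸ hx
  obtain ⟨l, hl, hl'⟩ := exists_side_tile he hx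
  obtain ⟨r, hr, hr'⟩ := exists_side_tile he' hx'
  obtain ⟨δ, hδ, h⟩ := id hl'
  obtain ⟨δ', hδ', h'⟩ := id hr'
  obtain ⟨ε, hε, hball⟩ := T.exists_ball_meets_edge x
  rw [← T.tile_regular t ht] at hxt
  have hpos : 0 < min (min δ δ') ε := lt_min (lt_min hδ hδ') hε
  obtain ⟨z, hzt, hzx⟩ := Metric.mem_closure_iff.1 hxt _ hpos
  rw [dist_comm] at hzx
  have h1 : dist z x < δ := hzx.trans_le ((min_le_left _ _).trans (min_le_left _ _))
  have h2 : dist z x < δ' := hzx.trans_le ((min_le_left _ _).trans (min_le_right _ _))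
  obtain ⟨ρ, hρ, hρt⟩ := Metric.isOpen_iff.1 (isOpen_interior (s := t)) z hzt
  obtain ⟨hab, -⟩ := edge_ends he
  rcases le_total 0 ((z - x) * (starRingEnd ℂ) (b - a)).im with him | him
  · obtain ⟨w, hw, hwz⟩ := Metric.mem_closure_iff.1
      (mem_closure_sideBall (sub_ne_zero.2 hab.symm) h1 him) ρ hρ
    rw [dist_comm] at hwz
    rw [tile_eq_of_mem_interior ht hl (hρt hwz) (h hw)]
    exact Or.inl hl'
  · obtain ⟨w, hw, hwz⟩ := Metric.mem_closure_iff.1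
      (mem_closure_sideBall (x := x) (z := z) (sub_ne_zero.2 hab) h2 (by
        rw [← neg_sub b a, map_neg, mul_neg, Complex.neg_im]
        linarith)) ρ hρ
    rw [dist_comm] at hwz
    rw [tile_eq_of_mem_interior ht hr (hρt hwz) (h' hw)]
    exact Or.inr hr'

theorem isSide_iff_not {a b x : ℂ} (he : segment ℝ a b ∈ T.edge)
    (hx : x ∈ openSegment ℝ a b) {t : Set ℂ} (ht : t ∈ T.tile) (hxt : x ∈ t) :
    IsSide t b a x ↔ ¬ IsSide t a b x :=
  ⟨fun h h' => h'.ne he hx ht h rfl, fun h => (isSide_or_isSide he hx ht hxt).resolve_left h⟩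

open Filter Topology in
/-- Along the boundary of a tile the tile stays on the same side. -/
theorem isSide_turn {a b c x y : ℂ} (hab : segment ℝ a b ∈ T.edge) (hbc : segment ℝ b c ∈ T.edge)
    (hne : segment ℝ a b ≠ segment ℝ b c) {t : Set ℂ} (ht : t ∈ T.tile)
    (hfr : ∀ e ∈ T.edge, e ⊆ frontier t → b ∈ e → e = segment ℝ a b ∨ e = segment ℝ b c)
    (hx : x ∈ openSegment ℝ a b) (hy : y ∈ openSegment ℝ b c) :
    IsSide t a b x ↔ IsSide t b c y := by
  have hu : a - b ≠ 0 := sub_ne_zero.2 (edge_ends hab).1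
  have hw : c - b ≠ 0 := sub_ne_zero.2 (edge_ends hbc).1.symm
  have hun := norm_pos_iff.2 hu
  have hwn := norm_pos_iff.2 hw
  have hba : segment ℝ b a ∈ T.edge := segment_symm ℝ a b ▸ hab
  -- Two edges leaving `b` in the same direction would share a relative interior point and coincide.
  have hray : ∀ l : ℝ, 0 < l → a - b ≠ l * (c - b) := by
    intro l hl h
    have hn : ‖a - b‖ = l * ‖c - b‖ := by
      rw [h, norm_mul, Complex.norm_real, Real.norm_of_nonneg hl.le]
    obtain ⟨s, hs0, hs⟩ := exists_between (lt_min hun hwn)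
    have h1 := add_mul_mem_openSegment (b := b) hw hs0 (hs.trans_le (min_le_right _ _))
    have h2 := add_mul_mem_openSegment (b := b) hu hs0 (hs.trans_le (min_le_left _ _))
    rw [add_sub_cancel] at h1 h2
    have h3 : (a - b) / (‖a - b‖ : ℂ) = (c - b) / (‖c - b‖ : ℂ) := by
      have hl' : (l : ℂ) ≠ 0 := by exact_mod_cast hl.ne'
      have hwn' : (‖c - b‖ : ℂ) ≠ 0 := by exact_mod_cast hwn.ne'
      rw [hn, h]
      push_cast
      field_simp
    rw [h3] at h2
    have h4 := edge_eq_of_mem_openSegment hbc h1 hba (openSegment_subset_segment ℝ b a h2)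
    rw [segment_symm ℝ b a] at h4
    exact hne h4
  obtain ⟨φ, hφ0, hφ1, hφ⟩ := exists_angle hu hw hray
  obtain ⟨δ, hδ, hball⟩ := T.exists_ball_meets_edge b
  obtain ⟨s, hs0, hs⟩ := exists_between (lt_min (lt_min hun hwn) hδ)
  have hsu : s < ‖a - b‖ := hs.trans_le ((min_le_left _ _).trans (min_le_left _ _))
  have hsw : s < ‖c - b‖ := hs.trans_le ((min_le_left _ _).trans (min_le_right _ _))
  have hsδ : s < δ := hs.trans_le (min_le_right _ _)
  set w₀ : ℂ := (c - b) / ‖c - b‖ with hw₀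
  set u₀ : ℂ := (a - b) / ‖a - b‖ with hu₀
  have hw₀n : ‖w₀‖ = 1 := by
    rw [hw₀, norm_div, Complex.norm_real, norm_norm, div_self hwn.ne']
  have hu₀n : ‖u₀‖ = 1 := by
    rw [hu₀, norm_div, Complex.norm_real, norm_norm, div_self hun.ne']
  have hw₀0 : w₀ ≠ 0 := norm_ne_zero_iff.1 (by rw [hw₀n]; exact one_ne_zero)
  have hu₀0 : u₀ ≠ 0 := norm_ne_zero_iff.1 (by rw [hu₀n]; exact one_ne_zero)
  have hs0' : (s : ℂ) ≠ 0 := by exact_mod_cast hs0.ne'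
  have hww : (‖c - b‖ : ℂ) * w₀ = c - b := by
    have hwn' : (‖c - b‖ : ℂ) ≠ 0 := by exact_mod_cast hwn.ne'
    rw [hw₀]
    field_simp
  have huu : (‖a - b‖ : ℂ) * u₀ = a - b := by
    have hun' : (‖a - b‖ : ℂ) ≠ 0 := by exact_mod_cast hun.ne'
    rw [hu₀]
    field_simp
  -- A small circle about `b`, run anticlockwise from the edge to `c` at angle `0` to the edge to
  -- `a` at angle `φ`. The factor `1` matches the parameter `σ` of `eventually_arc_mem_sideBall`.
  let z : ℝ → ℂ := fun θ => b + s * w₀ * Complex.exp ((1 * θ : ℝ) * Complex.I)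
  have hzu : ∀ η : ℝ, z (φ - η) = b + s * u₀ * Complex.exp ((-1 * η : ℝ) * Complex.I) := by
    intro η
    simp only [z]
    rw [hφ, one_mul, Complex.ofReal_sub, sub_mul, sub_eq_add_neg, Complex.exp_add]
    push_cast
    ring_nf
  have hzconn : IsPreconnected (z '' Set.Ioo 0 φ) := by
    refine isPreconnected_Ioo.image z ?_
    have : Continuous z := by fun_prop
    exact this.continuousOn
  have hzray : ∀ (v : ℂ) (k : ℝ) (θ : ℝ), 0 < k → z θ ∈ segment ℝ b (b + k * v) →
      ∃ m : ℝ, 0 ≤ m ∧ w₀ * Complex.exp (θ * Complex.I) = m * v := by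
    intro v k θ hk h
    rw [segment_eq_image'] at h
    obtain ⟨m, ⟨hm, -⟩, h⟩ := h
    refine ⟨m * k / s, by positivity, ?_⟩
    simp only [z, one_mul, Complex.real_smul, add_sub_cancel_left] at h
    push_cast
    field_simp
    linear_combination -h
  -- Near `b` the frontier of `t` consists of the two given edges only, and the open arc runs
  -- strictly between their rays.
  have hzdis : Disjoint (z '' Set.Ioo 0 φ) (frontier t) := by
    refine Set.disjoint_left.2 ?_
    rintro _ ⟨θ, ⟨hθ0, hθ1⟩, rfl⟩ hθ
    obtain ⟨e, he, hze, hef⟩ := exists_edge_of_mem_frontier ht hθ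
    have hd : dist (z θ) b < δ := by
      simp only [z, dist_eq_norm, add_sub_cancel_left]
      rw [norm_mul, norm_mul, hw₀n, Complex.norm_exp_ofReal_mul_I, Complex.norm_real,
        Real.norm_of_nonneg hs0.le]
      linarith
    rcases hfr e he hef (hball e he _ hze hd) with rfl | rfl
    · rw [segment_symm, show a = b + (‖a - b‖ : ℝ) * u₀ by rw [huu]; ring] at hze
      obtain ⟨m, hm, h⟩ := hzray u₀ _ θ hun hze
      refine exp_mul_I_ne_of_nonneg (θ := φ - θ) (r := m⁻¹) (by linarith) (by linarith)
        (by positivity) ?_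
      have hm0 : (m : ℂ) ≠ 0 := by
        rintro h0
        rw [h0, zero_mul] at h
        exact mul_ne_zero hw₀0 (Complex.exp_ne_zero _) h
      rw [hφ] at h
      have h5 : Complex.exp (θ * Complex.I) = m * Complex.exp (φ * Complex.I) :=
        mul_left_cancel₀ hw₀0 (by linear_combination h)
      rw [Complex.ofReal_sub, sub_mul, Complex.exp_sub, h5, Complex.ofReal_inv]
      have := Complex.exp_ne_zero (φ * Complex.I)
      field_simp
    · rw [show c = b + (‖c - b‖ : ℝ) * w₀ by rw [hww]; ring] at hze
      obtain ⟨m, hm, h⟩ := hzray w₀ _ θ hwn hze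
      refine exp_mul_I_ne_of_nonneg (θ := θ) hθ0 (by linarith) hm ?_
      exact mul_left_cancel₀ hw₀0 (by linear_combination h)
  have hx₁ : b + s * u₀ ∈ openSegment ℝ a b := by
    rw [openSegment_symm]
    have := add_mul_mem_openSegment (b := b) hu hs0 hsu
    rwa [add_sub_cancel] at this
  have hy₁ : b + s * w₀ ∈ openSegment ℝ b c := by
    have := add_mul_mem_openSegment (b := b) hw hs0 hsw
    rwa [add_sub_cancel] at this
  rw [isSide_of_isSide hab hx hx₁ ht, isSide_of_isSide hbc hy hy₁ ht]
  have hlt : ∀ᶠ η : ℝ in 𝓝[>] 0, η < φ := nhdsWithin_le_nhds (gt_mem_nhds hφ0)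
  have key1 : ∀ r ∈ T.tile, IsSide r a b (b + s * u₀) →
      (interior r ∩ z '' Set.Ioo 0 φ).Nonempty := by
    rintro r hr ⟨ε, hε, hsub⟩
    have h1 := eventually_arc_mem_sideBall b hu₀n hs0 hun hε (Or.inr rfl)
    obtain ⟨η, ⟨h1, h2⟩, h3⟩ := ((h1.and hlt).and self_mem_nhdsWithin).exists
    refine ⟨z (φ - η), hsub ?_, φ - η, ⟨by linarith, by linarith [show 0 < η from h3]⟩, rfl⟩
    rw [hzu]
    convert h1 using 1
    rw [Complex.ofReal_mul, mul_assoc, huu]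
    push_cast
    ring_nf
  have key2 : ∀ r ∈ T.tile, IsSide r b c (b + s * w₀) →
      (interior r ∩ z '' Set.Ioo 0 φ).Nonempty := by
    rintro r hr ⟨ε, hε, hsub⟩
    have h1 := eventually_arc_mem_sideBall b hw₀n hs0 hwn hε (Or.inl rfl)
    obtain ⟨η, ⟨h1, h2⟩, h3⟩ := ((h1.and hlt).and self_mem_nhdsWithin).exists
    refine ⟨z η, hsub ?_, η, ⟨h3, h2⟩, rfl⟩
    convert h1 using 1
    rw [Complex.ofReal_mul, mul_assoc, hww]
    push_cast
    ring_nf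
  -- The arc starts on the left of `b → c` and ends on the left of `a → b`. If `t` meets it, then
  -- `t` contains it and is the tile on the left of both edges.
  have key3 : (interior t ∩ z '' Set.Ioo 0 φ).Nonempty → z '' Set.Ioo 0 φ ⊆ interior t :=
    fun ⟨w, hw1, hw2⟩ =>
      hzconn.subset_interior_of_disjoint_frontier hzdis ⟨w, hw2, interior_subset hw1⟩
  obtain ⟨l₁, hl₁, hl₁'⟩ := exists_side_tile hab hx₁
  obtain ⟨l₂, hl₂, hl₂'⟩ := exists_side_tile hbc hy₁
  constructor
  · intro h
    obtain ⟨w, hw1, hw2⟩ := key2 l₂ hl₂ hl₂'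
    rwa [tile_eq_of_mem_interior ht hl₂ (key3 (key1 t ht h) hw2) hw1]
  · intro h
    obtain ⟨w, hw1, hw2⟩ := key1 l₁ hl₁ hl₁'
    rwa [tile_eq_of_mem_interior ht hl₁ (key3 (key2 t ht h) hw2) hw1]

end PlaneTiling

/-! ### The two tiles at an edge, the vanishing of the double boundary, connectivity -/

namespace PlaneTiling

variable {L : Type*} {T : PlaneTiling L}

-- `IsLeft` and `IsRight` test only a normal ray at the midpoint. Such a ray also enters the tile
-- that fills the half disc, and open tiles are disjoint.
open Filter Topology in
theorem eventually_mem_interior_iff {a b x : ℂ} (he : segment ℝ a b ∈ T.edge)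
    (hx : x ∈ openSegment ℝ a b) {t : Set ℂ} (ht : t ∈ T.tile) :
    (∀ᶠ ε : ℝ in 𝓝[>] 0, x + ε * (Complex.I * (b - a)) ∈ interior t) ↔ IsSide t a b x := by
  have hba : b - a ≠ 0 := sub_ne_zero.2 (edge_ends he).1.symm
  have hev : ∀ r, IsSide r a b x →
      ∀ᶠ ε : ℝ in 𝓝[>] 0, x + ε * (Complex.I * (b - a)) ∈ interior r := by
    rintro r ⟨δ, hδ, hsub⟩
    filter_upwards [eventually_mem_sideBall (x := x) (z := x) hba (by simpa using hδ) (by simp)]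
      with ε h using hsub h
  refine ⟨fun h => ?_, hev t⟩
  obtain ⟨l, hl, hl'⟩ := exists_side_tile he hx
  obtain ⟨ε, h1, h2⟩ := (h.and (hev l hl')).exists
  rwa [tile_eq_of_mem_interior ht hl h1 h2]

namespace EdgeOrientation

variable (o : T.EdgeOrientation)

/-- The tile on the left of an edge. -/
noncomputable def left (e : Set ℂ) : Set ℂ :=
  Classical.epsilon fun t => t ∈ T.tile ∧ o.IsLeft t e

/-- The tile on the right of an edge. -/
noncomputable def right (e : Set ℂ) : Set ℂ :=
  Classical.epsilon fun t => t ∈ T.tile ∧ o.IsRight t e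

variable {e t : Set ℂ}

theorem segment_mem (he : e ∈ T.edge) : segment ℝ (o.tail e) (o.head e) ∈ T.edge := by
  rwa [← (o.ends e he).2]

theorem isLeft_iff_isSide (he : e ∈ T.edge) (ht : t ∈ T.tile) :
    o.IsLeft t e ↔ IsSide t (o.tail e) (o.head e) (midpoint ℝ (o.tail e) (o.head e)) :=
  eventually_mem_interior_iff (o.segment_mem he) (midpoint_mem_openSegment _ _) ht

theorem isRight_iff_isSide (he : e ∈ T.edge) (ht : t ∈ T.tile) :
    o.IsRight t e ↔ IsSide t (o.head e) (o.tail e) (midpoint ℝ (o.tail e) (o.head e)) := by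
  have h := o.segment_mem he
  rw [← eventually_mem_interior_iff (segment_symm ℝ (o.tail e) (o.head e) ▸ h)
    (openSegment_symm ℝ (o.tail e) (o.head e) ▸ midpoint_mem_openSegment _ _) ht, IsRight]
  refine Filter.eventually_congr (Filter.Eventually.of_forall fun ε => ?_)
  rw [show midpoint ℝ (o.tail e) (o.head e) + (ε : ℂ) * (Complex.I * (o.tail e - o.head e)) =
    midpoint ℝ (o.tail e) (o.head e) - ε * (Complex.I * (o.head e - o.tail e)) by ring]

theorem exists_isLeft (he : e ∈ T.edge) : ∃ t, t ∈ T.tile ∧ o.IsLeft t e := by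
  obtain ⟨l, hl, h⟩ := exists_side_tile (o.segment_mem he) (midpoint_mem_openSegment _ _)
  exact ⟨l, hl, (o.isLeft_iff_isSide he hl).2 h⟩

theorem exists_isRight (he : e ∈ T.edge) : ∃ t, t ∈ T.tile ∧ o.IsRight t e := by
  have h := o.segment_mem he
  obtain ⟨l, hl, h⟩ := exists_side_tile (segment_symm ℝ (o.tail e) (o.head e) ▸ h)
    (openSegment_symm ℝ (o.tail e) (o.head e) ▸ midpoint_mem_openSegment _ _)
  exact ⟨l, hl, (o.isRight_iff_isSide he hl).2 h⟩

theorem left_mem (he : e ∈ T.edge) : o.left e ∈ T.tile :=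
  (Classical.epsilon_spec (o.exists_isLeft he)).1

theorem right_mem (he : e ∈ T.edge) : o.right e ∈ T.tile :=
  (Classical.epsilon_spec (o.exists_isRight he)).1

theorem isLeft_left (he : e ∈ T.edge) : o.IsLeft (o.left e) e :=
  (Classical.epsilon_spec (o.exists_isLeft he)).2

theorem isRight_right (he : e ∈ T.edge) : o.IsRight (o.right e) e :=
  (Classical.epsilon_spec (o.exists_isRight he)).2

theorem isLeft_iff_eq (he : e ∈ T.edge) (ht : t ∈ T.tile) : o.IsLeft t e ↔ t = o.left e := by
  refine ⟨fun h => ?_, fun h => h ▸ o.isLeft_left he⟩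
  exact IsSide.unique (o.ends e he).1 (o.left_mem he) ht
    ((o.isLeft_iff_isSide he (o.left_mem he)).1 (o.isLeft_left he))
    ((o.isLeft_iff_isSide he ht).1 h)

theorem isRight_iff_eq (he : e ∈ T.edge) (ht : t ∈ T.tile) : o.IsRight t e ↔ t = o.right e := by
  refine ⟨fun h => ?_, fun h => h ▸ o.isRight_right he⟩
  exact IsSide.unique (o.ends e he).1.symm (o.right_mem he) ht
    ((o.isRight_iff_isSide he (o.right_mem he)).1 (o.isRight_right he))
    ((o.isRight_iff_isSide he ht).1 h)

theorem midpoint_mem (he : e ∈ T.edge) : midpoint ℝ (o.tail e) (o.head e) ∈ e := by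
  have := openSegment_subset_segment ℝ _ _ (midpoint_mem_openSegment (𝕜 := ℝ) (o.tail e) (o.head e))
  rwa [← (o.ends e he).2] at this

theorem subset_of_mem {x : ℂ} (he : e ∈ T.edge) (hx : x ∈ openSegment ℝ (o.tail e) (o.head e))
    (ht : t ∈ T.tile) (hxt : x ∈ t) : e ⊆ t := by
  have h := segment_subset_frontier (o.segment_mem he) hx ht hxt
  rw [← (o.ends e he).2] at h
  exact h.trans (frontier_subset_tile ht)

theorem subset_tile_iff (he : e ∈ T.edge) (ht : t ∈ T.tile) :
    e ⊆ t ↔ t = o.left e ∨ t = o.right e := by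
  rw [← o.isLeft_iff_eq he ht, ← o.isRight_iff_eq he ht, o.isLeft_iff_isSide he ht,
    o.isRight_iff_isSide he ht]
  constructor
  · intro h
    exact isSide_or_isSide (o.segment_mem he) (midpoint_mem_openSegment _ _) ht
      (h (o.midpoint_mem he))
  · rintro (h | h)
    · exact o.subset_of_mem he (midpoint_mem_openSegment _ _) ht (h.mem (o.ends e he).1 ht)
    · exact o.subset_of_mem he (midpoint_mem_openSegment _ _) ht (h.mem (o.ends e he).1.symm ht)

theorem subset_left (he : e ∈ T.edge) : e ⊆ o.left e :=
  (o.subset_tile_iff he (o.left_mem he)).2 (Or.inl rfl)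

theorem subset_right (he : e ∈ T.edge) : e ⊆ o.right e :=
  (o.subset_tile_iff he (o.right_mem he)).2 (Or.inr rfl)

open Classical in
theorem inc_one (he : e ∈ T.edge) (ht : t ∈ T.tile) :
    o.inc 1 t e = (if t = o.left e then 1 else 0) - (if t = o.right e then 1 else 0) := by
  have h1 := o.isLeft_iff_eq he ht
  have h2 := o.isRight_iff_eq he ht
  exact congrArg₂ (fun x y : ℤ => x - y) (if_congr h1 rfl rfl) (if_congr h2 rfl rfl)

/-- The coefficients lie in a general ring since the formula serves integral chains as well as real
lifts of angles. -/
theorem sum_inc_one {R : Type*} [Ring R] (he : e ∈ T.edge) (F : Finset (Set ℂ))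
    (hF : ∀ t ∈ F, t ∈ T.tile) (hl : o.left e ∈ F) (hr : o.right e ∈ F) (g : Set ℂ → R) :
    ∑ t ∈ F, (o.inc 1 t e : R) * g t = g (o.left e) - g (o.right e) := by
  classical
  have : ∀ t ∈ F, (o.inc 1 t e : R) * g t =
      (if t = o.left e then g t else 0) - (if t = o.right e then g t else 0) := by
    intro t ht
    rw [o.inc_one he (hF t ht)]
    split_ifs <;> simp
  rw [Finset.sum_congr rfl this, Finset.sum_sub_distrib, Finset.sum_ite_eq', Finset.sum_ite_eq',
    if_pos hl, if_pos hr]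

theorem boundary_one (σ : T.cell 2 → ℤ) (e : T.cell 1) :
    o.boundary 1 σ e = σ ⟨o.left e, o.left_mem e.2⟩ - σ ⟨o.right e, o.right_mem e.2⟩ := by
  classical
  have hF : ∀ t, t ∈ (T.finite_cofaces 2 e.2).toFinset ↔ t ∈ T.tile ∧ e.1 ⊆ t := fun t => by
    simp [cell]
  have h := o.sum_inc_one e.2 (T.finite_cofaces 2 e.2).toFinset (fun t ht => ((hF t).1 ht).1)
    ((hF _).2 ⟨o.left_mem e.2, o.subset_left e.2⟩) ((hF _).2 ⟨o.right_mem e.2, o.subset_right e.2⟩)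
    (fun t => if h : t ∈ T.tile then σ ⟨t, h⟩ else 0)
  rw [dif_pos (o.left_mem e.2), dif_pos (o.right_mem e.2), ← Finset.sum_attach] at h
  rw [← h]
  refine Finset.sum_congr rfl fun t _ => ?_
  rw [dif_pos ((hF t).1 t.2).1]
  simp

/-- The boundary of the boundary of a tile vanishes. -/
theorem sum_inc_mul_inc (ht : t ∈ T.tile) (v : T.cell 0) :
    ∑ e ∈ (T.finite_cofaces 1 v.2).toFinset, o.inc 0 e v.1 * o.inc 1 t e = 0 := by
  classical
  obtain ⟨n, hn, p, hp, he, hf⟩ := T.tile_frontier t ht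
  have : NeZero n := ⟨by omega⟩
  have hone : Fact (1 < n) := ⟨by omega⟩
  have hsub : ∀ i, segment ℝ (p i) (p (i + 1)) ⊆ frontier t := fun i => by
    rw [hf]
    exact Set.subset_iUnion (fun i => segment ℝ (p i) (p (i + 1))) i
  have hsubt := fun i => (hsub i).trans (frontier_subset_tile ht)
  have hmid : ∀ i, midpoint ℝ (p i) (p (i + 1)) ∈ openSegment ℝ (p i) (p (i + 1)) := fun i =>
    midpoint_mem_openSegment _ _
  have hmidt : ∀ i, midpoint ℝ (p i) (p (i + 1)) ∈ t := fun i =>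
    hsubt i (openSegment_subset_segment ℝ _ _ (hmid i))
  -- This uses `3 ≤ n`: in a polygon with two sides both sides would be the same segment.
  have h20 : (1 : ZMod n) + 1 ≠ 0 := by
    intro h
    have h2 : ((2 : ℕ) : ZMod n) = 0 := by
      push_cast
      rw [← one_add_one_eq_two]
      exact h
    have := Nat.le_of_dvd two_pos ((ZMod.natCast_eq_zero_iff 2 n).1 h2)
    omega
  have hinj : Function.Injective fun i => segment ℝ (p i) (p (i + 1)) := by
    intro i j hij
    rcases eq_or_eq_of_segment_eq (edge_ends (he i)).1 hij with ⟨h, -⟩ | ⟨h1, h2⟩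
    · exact hp h
    · exfalso
      have h3 := hp h1
      have h4 := hp h2
      rw [h3, add_assoc] at h4
      exact h20 (by simpa using h4)
  have hedge : ∀ e ∈ T.edge, e ⊆ frontier t → ∃ i, segment ℝ (p i) (p (i + 1)) = e := by
    intro e he' hef
    have h1 := hef (o.midpoint_mem he')
    rw [hf] at h1
    obtain ⟨i, hi⟩ := Set.mem_iUnion.1 h1
    refine ⟨i, ?_⟩
    rw [edge_eq_of_mem_openSegment (o.segment_mem he') (midpoint_mem_openSegment _ _) (he i) hi]
    exact (o.ends e he').2.symm
  have hends : ∀ i j, p j ∈ segment ℝ (p i) (p (i + 1)) → j = i ∨ j = i + 1 := by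
    intro i j h
    by_contra! hne
    have h1 := mem_openSegment_of_ne_left_right (fun h => hne.1 (hp h.symm))
      (fun h => hne.2 (hp h.symm)) h
    exact Set.disjoint_left.1 (edge_ends (he i)).2.2.2 h1 (edge_ends (he j)).2.1
  -- The sign records whether `t` is to the left of the polygon in its direction of traversal;
  -- `isSide_turn` makes it independent of the side.
  let s : ZMod n → ℤ := fun i =>
    if IsSide t (p i) (p (i + 1)) (midpoint ℝ (p i) (p (i + 1))) then 1 else -1
  have hs : ∀ i, s (i + 1) = s i := by
    intro i
    refine if_congr (Iff.symm ?_) rfl rfl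
    refine isSide_turn (he i) (he (i + 1)) (fun h => ?_) ht ?_ (hmid i) (hmid (i + 1))
    · exact one_ne_zero (α := ZMod n) (by simpa using hinj h)
    · intro e he' hef hb
      obtain ⟨j, rfl⟩ := hedge e he' hef
      rcases hends j (i + 1) hb with h | h
      · exact Or.inr (by rw [h])
      · exact Or.inl (by rw [add_right_cancel h])
  -- Reversing the orientation of an edge changes the sign of both incidence numbers, so their
  -- product can be computed from the direction of traversal.
  have hinc : ∀ i, o.inc 0 (segment ℝ (p i) (p (i + 1))) v.1 *
      o.inc 1 t (segment ℝ (p i) (p (i + 1))) =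
      s i * ((if v.1 = {p (i + 1)} then 1 else 0) - (if v.1 = {p i} then 1 else 0)) := by
    intro i
    set e := segment ℝ (p i) (p (i + 1)) with hedef
    have hei : e ∈ T.edge := he i
    have h1 : o.inc 0 e v.1 = (if v.1 = {o.head e} then 1 else 0) -
      (if v.1 = {o.tail e} then 1 else 0) := rfl
    have h2 : o.inc 1 t e = (if o.IsLeft t e then 1 else 0) -
      (if o.IsRight t e then 1 else 0) := rfl
    have h3 := isSide_iff_not (he i) (hmid i) ht (hmidt i)
    simp only [o.isLeft_iff_isSide hei ht, o.isRight_iff_isSide hei ht] at h2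
    rw [h1, h2]
    rcases eq_or_eq_of_segment_eq (edge_ends (he i)).1 (o.ends e hei).2 with ⟨h4, h5⟩ | ⟨h4, h5⟩
    · rw [← h4, ← h5]
      simp only [h3, s]
      split_ifs <;> simp
    · rw [← h4, ← h5, midpoint_comm]
      simp only [h3, s]
      split_ifs <;> simp
  have hF : ∀ e, e ∈ (T.finite_cofaces 1 v.2).toFinset ↔ e ∈ T.edge ∧ v.1 ⊆ e := fun e => by
    simp [cell]
  have hsum : ∑ i ∈ Finset.univ.filter (fun i => v.1 ⊆ segment ℝ (p i) (p (i + 1))),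
      s i * ((if v.1 = {p (i + 1)} then 1 else 0) - (if v.1 = {p i} then 1 else 0)) =
      ∑ e ∈ (T.finite_cofaces 1 v.2).toFinset, o.inc 0 e v.1 * o.inc 1 t e := by
    refine Finset.sum_of_injOn (fun i => segment ℝ (p i) (p (i + 1))) hinj.injOn ?_ ?_ ?_
    · intro i hi
      exact (hF _).2 ⟨he i, by simpa using hi⟩
    · intro e he' hne
      obtain ⟨he', hve⟩ := (hF e).1 he'
      have hnt : ¬ e ⊆ t := by
        intro het
        have h1 := segment_subset_frontier (o.segment_mem he')
          (midpoint_mem_openSegment _ _) ht (het (o.midpoint_mem he'))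
        rw [← (o.ends e he').2] at h1
        obtain ⟨i, rfl⟩ := hedge e he' h1
        exact hne ⟨i, by simpa using hve, rfl⟩
      rw [o.subset_tile_iff he' ht, not_or] at hnt
      rw [o.inc_one he' ht, if_neg hnt.1, if_neg hnt.2, sub_zero, mul_zero]
    · intro i _
      exact (hinc i).symm
  rw [← hsum, Finset.sum_filter_of_ne]
  -- With a constant sign the sum telescopes around the polygon.
  · simp only [mul_sub, Finset.sum_sub_distrib]
    rw [sub_eq_zero, ← Equiv.sum_comp (Equiv.addRight (1 : ZMod n))
      (fun i => s i * (if v.1 = {p i} then 1 else 0))]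
    simp only [Equiv.coe_addRight, hs]
    congr!
  · intro i _ hne
    by_contra h
    refine hne ?_
    rw [if_neg, if_neg, sub_zero, mul_zero]
    · intro hv
      exact h (by rw [hv]; exact Set.singleton_subset_iff.2 (left_mem_segment ℝ _ _))
    · intro hv
      exact h (by rw [hv]; exact Set.singleton_subset_iff.2 (right_mem_segment ℝ _ _))

/-- Around a vertex each tile is as often on the left as on the right of an edge. -/
theorem sum_inc_mul_left_sub_right {R : Type*} [CommRing R] (g : Set ℂ → R) (v : T.cell 0) :
    ∑ e ∈ (T.finite_cofaces 1 v.2).toFinset,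
      (o.inc 0 e v.1 : R) * (g (o.left e) - g (o.right e)) = 0 := by
  have hF : ∀ e, e ∈ (T.finite_cofaces 1 v.2).toFinset ↔ e ∈ T.edge ∧ v.1 ⊆ e := fun e => by
    simp [cell]
  have hF' : ∀ e, e ∈ (T.finite_cofaces 2 v.2).toFinset ↔ e ∈ T.tile ∧ v.1 ⊆ e := fun e => by
    simp [cell]
  have h1 : ∀ e ∈ (T.finite_cofaces 1 v.2).toFinset,
      (o.inc 0 e v.1 : R) * (g (o.left e) - g (o.right e)) =
      ∑ t ∈ (T.finite_cofaces 2 v.2).toFinset, (o.inc 0 e v.1 * o.inc 1 t e : ℤ) * g t := by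
    intro e he
    obtain ⟨he, hve⟩ := (hF e).1 he
    rw [← o.sum_inc_one he (T.finite_cofaces 2 v.2).toFinset (fun t ht => ((hF' t).1 ht).1)
      ((hF' _).2 ⟨o.left_mem he, hve.trans (o.subset_left he)⟩)
      ((hF' _).2 ⟨o.right_mem he, hve.trans (o.subset_right he)⟩) g, Finset.mul_sum]
    refine Finset.sum_congr rfl fun t _ => ?_
    push_cast
    ring
  rw [Finset.sum_congr rfl h1, Finset.sum_comm]
  refine Finset.sum_eq_zero fun t ht => ?_
  rw [← Finset.sum_mul, ← Int.cast_sum, o.sum_inc_mul_inc ((hF' t).1 ht).1 v, Int.cast_zero,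
    zero_mul]

theorem boundary_zero (σ : T.cell 1 → ℤ) (g : Set ℂ → ℤ) (h : ∀ e : T.cell 1, σ e = g e)
    (v : T.cell 0) :
    o.boundary 0 σ v = ∑ e ∈ (T.finite_cofaces 1 v.2).toFinset, o.inc 0 e v.1 * g e := by
  rw [← Finset.sum_attach]
  exact Finset.sum_congr rfl fun e _ => by rw [h]

theorem boundary_boundary (k : ℕ) (σ : T.cell (k + 2) → ℤ) :
    o.boundary k (o.boundary (k + 1) σ) = 0 := by
  classical
  match k with
  | 0 =>
    funext v
    have h := o.sum_inc_mul_left_sub_right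
      (fun t => if h : t ∈ T.tile then σ ⟨t, h⟩ else (0 : ℤ)) v
    rw [o.boundary_zero _ _ (fun e => ?_) v]
    · exact h
    · rw [o.boundary_one]
      simp only [dif_pos (o.left_mem e.2), dif_pos (o.right_mem e.2)]
  | k + 1 =>
    have : σ = 0 := funext fun c => c.2.elim
    rw [this, map_zero, map_zero]

open Filter Topology in
/-- The plane stays connected when the vertices are removed, so any two tiles are joined by a
chain of tiles which share edges. -/
theorem eq_of_left_eq_right {α : Type*} (g : Set ℂ → α)
    (hg : ∀ e ∈ T.edge, g (o.left e) = g (o.right e)) {t t' : Set ℂ} (ht : t ∈ T.tile)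
    (ht' : t' ∈ T.tile) : g t = g t' := by
  have hcount : T.vertex.Countable := by
    have : T.vertex = ⋃ n : ℕ, T.vertex ∩ Metric.ball 0 n := by
      rw [← Set.inter_iUnion, Metric.iUnion_ball_nat, Set.inter_univ]
    rw [this]
    exact Set.countable_iUnion fun n => (T.finite_vertex _ Metric.isBounded_ball).countable
  -- The complement of a countable set is path connected in real dimension greater than one.
  have hconn : IsPreconnected T.vertexᶜ :=
    (hcount.isPathConnected_compl_of_one_lt_rank
      (by rw [Complex.rank_real_complex]; exact Nat.one_lt_ofNat)).isConnected.isPreconnected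
  -- Two tiles through a point that is not a vertex are equal or are among the two tiles at one
  -- edge.
  have hat : ∀ x ∈ T.vertexᶜ, ∀ r ∈ T.tile, ∀ r' ∈ T.tile, x ∈ r → x ∈ r' → g r = g r' := by
    intro x hx r hr r' hr' hxr hxr'
    by_cases hxi : x ∈ interior r
    · have h1 : (closure (interior r') ∩ interior r).Nonempty := ⟨x, by
        rwa [T.tile_regular r' hr'], hxi⟩
      obtain ⟨y, hy, hy'⟩ := (closure_inter_open_nonempty_iff isOpen_interior).1 h1
      rw [tile_eq_of_mem_interior hr hr' hy' hy]
    · obtain ⟨e, he, hxe, -⟩ := exists_edge_of_mem_frontier hr ⟨subset_closure hxr, hxi⟩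
      have hv := edge_ends (o.segment_mem he)
      have hxo : x ∈ openSegment ℝ (o.tail e) (o.head e) := by
        rw [(o.ends e he).2] at hxe
        refine mem_openSegment_of_ne_left_right ?_ ?_ hxe
        · rintro rfl
          exact hx hv.2.1
        · rintro rfl
          exact hx hv.2.2.1
      have key : ∀ q ∈ T.tile, x ∈ q → g q = g (o.left e) := fun q hq hxq => by
        rcases (o.subset_tile_iff he hq).1 (o.subset_of_mem he hxo hq hxq) with rfl | rfl
        · rfl
        · exact (hg e he).symm
      rw [key r hr hxr, key r' hr' hxr']
  have hpt : ∀ r ∈ T.tile, ∃ x ∈ T.vertexᶜ, x ∈ r := fun r hr => by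
    obtain ⟨x, hx⟩ := (T.tile_connected r hr).1
    exact ⟨x, Set.disjoint_left.1 (T.tile_vertex r hr) hx, interior_subset hx⟩
  obtain ⟨x, hxv, hx⟩ := hpt t ht
  obtain ⟨y, hyv, hy⟩ := hpt t' ht'
  refine hconn.induction₂
    (fun x y => ∀ r ∈ T.tile, ∀ r' ∈ T.tile, x ∈ r → y ∈ r' → g r = g r') ?_ ?_ ?_ hxv hyv
    t ht t' ht' hx hy
  · intro x hx
    obtain ⟨δ, hδ, hball⟩ := T.exists_ball_meets_tile x
    filter_upwards [nhdsWithin_le_nhds (Metric.ball_mem_nhds x hδ)] with y hy r hr r' hr' hxr hyr'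
    exact hat x hx r hr r' hr' hxr (hball r' hr' y hyr' hy)
  · intro x y z _ _ _ h1 h2 r hr r' hr' hxr hzr'
    obtain ⟨q, hq, hyq⟩ := T.exists_tile y
    rw [h1 r hr q hq hxr hyq, h2 q hq r' hr' hyq hzr']
  · exact fun x y _ _ h r hr r' hr' hyr hxr' => (h r' hr' r hr hxr' hyr).symm

end EdgeOrientation

/-- Every tile is an isometric copy of one of finitely many compact tiles. The bound controls how
far the boundary map enlarges the radius of pattern-equivariance. -/
theorem EFLC.exists_dist_le (hT : T.EFLC) :
    ∃ D : ℝ, 0 ≤ D ∧ ∀ t ∈ T.tile, ∀ x ∈ t, ∀ y ∈ t, dist x y ≤ D := by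
  obtain ⟨-, F, hF, hFt, h⟩ := hT
  have hb : Bornology.IsBounded (⋃₀ F) :=
    (Bornology.isBounded_sUnion hF).2 fun t ht => (T.tile_compact t (hFt ht)).isBounded
  refine ⟨Metric.diam (⋃₀ F), Metric.diam_nonneg, ?_⟩
  intro t ht x hx y hy
  obtain ⟨t', ht', φ, hφ, -⟩ := h t ht
  rw [← hφ] at hx hy
  obtain ⟨x, hx, rfl⟩ := hx
  obtain ⟨y, hy, rfl⟩ := hy
  rw [φ.dist_act]
  exact Metric.dist_le_diam_of_mem hb ⟨t', ht', hx⟩ ⟨t', ht', hy⟩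

theorem EFLC.exists_tile_dist_le (hT : T.EFLC) (o : T.EdgeOrientation) :
    ∃ D : ℝ, 0 ≤ D ∧ ∀ k, ∀ c ∈ T.cell (k + 1), ∃ t ∈ T.tile, c ⊆ t ∧
      ∀ x ∈ t, ∀ y ∈ t, dist x y ≤ D := by
  obtain ⟨D, hD, h⟩ := hT.exists_dist_le
  refine ⟨D, hD, fun k c hc => ?_⟩
  match k, hc with
  | 0, hc => exact ⟨_, o.left_mem hc, o.subset_left hc, h _ (o.left_mem hc)⟩
  | 1, hc => exact ⟨c, hc, subset_rfl, h c hc⟩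
  | _ + 2, hc => exact hc.elim

/-- Cells are recorded as bare sets, so the dimension of a `RotCell` has to be recovered from its
base. -/
theorem cell_disjoint {j k : ℕ} {c : Set ℂ} (hj : c ∈ T.cell j) (hk : c ∈ T.cell k) : j = k := by
  have h01 : c ∈ T.cell 0 → c ∈ T.cell 1 → False := by
    rintro ⟨v, -, rfl⟩ h1
    obtain ⟨a, -, b, -, hab, h, -⟩ := T.edge_segment _ h1
    have ha : a ∈ ({v} : Set ℂ) := h ▸ left_mem_segment ℝ a b
    have hb : b ∈ ({v} : Set ℂ) := h ▸ right_mem_segment ℝ a b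
    exact hab (ha.trans hb.symm)
  have h02 : c ∈ T.cell 0 → c ∈ T.cell 2 → False := by
    rintro ⟨v, hv, rfl⟩ h2
    obtain ⟨x, hx⟩ := (T.tile_connected _ h2).1
    obtain rfl : x = v := Set.mem_singleton_iff.1 (interior_subset hx)
    exact Set.disjoint_left.1 (T.tile_vertex _ h2) hx hv
  have h12 : c ∈ T.cell 1 → c ∈ T.cell 2 → False := by
    intro h1 h2
    obtain ⟨x, hx⟩ := (T.tile_connected _ h2).1
    exact Set.disjoint_left.1 (T.tile_edge _ h2 _ h1) hx (interior_subset hx)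
  match j, k, hj, hk with
  | 0, 0, _, _ => rfl
  | 0, 1, hj, hk => exact (h01 hj hk).elim
  | 0, 2, hj, hk => exact (h02 hj hk).elim
  | 1, 0, hj, hk => exact (h01 hk hj).elim
  | 1, 1, _, _ => rfl
  | 1, 2, hj, hk => exact (h12 hj hk).elim
  | 2, 0, hj, hk => exact (h02 hk hj).elim
  | 2, 1, hj, hk => exact (h12 hk hj).elim
  | 2, 2, _, _ => rfl
  | _ + 3, _, hj, _ => exact hj.elim
  | _, _ + 3, _, hk => exact hk.elim

end PlaneTiling

/-! ### Circular order and real lifts of angles -/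

namespace Real.Angle

/-- The representative of an angle in `[0, 2π)`. -/
noncomputable def turn (a : Real.Angle) : ℝ :=
  toIcoMod Real.two_pi_pos 0 a.toReal

theorem turn_coe (x : ℝ) : turn x = toIcoMod Real.two_pi_pos 0 x := by
  obtain ⟨k, hk⟩ := angle_eq_iff_two_pi_dvd_sub.1 (coe_toReal (x : Real.Angle))
  rw [turn, show (x : Real.Angle).toReal = x + k • (2 * Real.pi) by
    rw [zsmul_eq_mul]; linarith, toIcoMod_add_zsmul]

theorem coe_turn (a : Real.Angle) : (turn a : Real.Angle) = a := by
  obtain ⟨z, hz⟩ := ((toIcoMod_eq_iff Real.two_pi_pos (b := a.toReal)).1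
    (rfl : _ = turn a)).2
  conv_rhs => rw [← coe_toReal a, hz]
  simp

theorem turn_nonneg (a : Real.Angle) : 0 ≤ turn a := left_le_toIcoMod _ _ _

theorem turn_lt (a : Real.Angle) : turn a < 2 * Real.pi := by
  have h := toIcoMod_lt_right Real.two_pi_pos 0 a.toReal
  rwa [zero_add] at h

theorem turn_eq_of_coe_eq {a : Real.Angle} {x : ℝ} (hx : (x : Real.Angle) = a) (h0 : 0 ≤ x)
    (h1 : x < 2 * Real.pi) : turn a = x := by
  rw [← hx, turn_coe, toIcoMod_eq_self]
  exact ⟨h0, by simpa using h1⟩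

theorem turn_zero : turn 0 = 0 := turn_eq_of_coe_eq coe_zero le_rfl Real.two_pi_pos

theorem turn_eq_zero_iff {a : Real.Angle} : turn a = 0 ↔ a = 0 := by
  refine ⟨fun h => ?_, fun h => h ▸ turn_zero⟩
  rw [← coe_turn a, h, coe_zero]

/-- The library's circular order compares a representative in `[0, 2π)` with one in `(0, 2π]`; they
differ only at the zero angle, which is treated apart. -/
theorem sbtw_iff_turn {a u b : Real.Angle} :
    sbtw a u b ↔ 0 < turn (u - a) ∧ turn (u - a) < turn (b - a) := by
  induction a using Real.Angle.induction_on with | _ a =>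
  induction u using Real.Angle.induction_on with | _ u =>
  induction b using Real.Angle.induction_on with | _ b =>
  have : Fact (0 < 2 * Real.pi) := ⟨Real.two_pi_pos⟩
  have h1 : btw (a : Real.Angle) b u ↔ toIcoMod Real.two_pi_pos 0 (b - a) ≤
      toIocMod Real.two_pi_pos 0 (u - a) := QuotientAddGroup.btw_coe_iff'
  rw [sbtw_iff_not_btw, btw_cyclic, h1, not_le, ← coe_sub, ← coe_sub, turn_coe, turn_coe]
  have hb := toIcoMod_mem_Ico Real.two_pi_pos 0 (b - a)
  have hu := toIcoMod_mem_Ico Real.two_pi_pos 0 (u - a)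
  obtain ⟨z, hz⟩ := ((toIcoMod_eq_iff Real.two_pi_pos (b := u - a)).1
    (rfl : _ = toIcoMod Real.two_pi_pos 0 (u - a))).2
  rcases hu.1.eq_or_lt with h | h
  · have h2 : toIocMod Real.two_pi_pos 0 (u - a) = 2 * Real.pi := by
      rw [toIocMod_eq_iff]
      refine ⟨⟨Real.two_pi_pos, by simp⟩, z - 1, ?_⟩
      rw [← h] at hz
      rw [hz, sub_smul, one_smul]
      ring
    rw [h2, ← h]
    simp only [lt_irrefl, false_and, iff_false, not_lt]
    simpa using hb.2.le
  · have h2 : toIocMod Real.two_pi_pos 0 (u - a) = toIcoMod Real.two_pi_pos 0 (u - a) := by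
      rw [toIocMod_eq_iff]
      exact ⟨⟨h, hu.2.le⟩, z, hz⟩
    rw [h2]
    simp only [h, true_and]

end Real.Angle

open Real.Angle in
/-- A choice of real lifts of the angles `base - s` in some interval of length `2π`. -/
structure AngleLag where
  toFun : Real.Angle → ℝ
  base : Real.Angle
  coe_toFun : ∀ s, (toFun s : Real.Angle) = base - s
  sub_lt : ∀ s t, toFun s - toFun t < 2 * Real.pi

namespace AngleLag

open Real.Angle

instance : CoeFun AngleLag fun _ => Real.Angle → ℝ := ⟨toFun⟩

variable (f : AngleLag)

theorem injective : Function.Injective f := fun s t h => by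
  have := f.coe_toFun s
  rw [h, f.coe_toFun t] at this
  exact (sub_right_injective this).symm

theorem turn_sub_of_le {s t : Real.Angle} (h : f t ≤ f s) : turn (t - s) = f s - f t := by
  refine turn_eq_of_coe_eq ?_ (sub_nonneg.2 h) (f.sub_lt s t)
  rw [coe_sub, f.coe_toFun, f.coe_toFun]
  abel

theorem turn_sub_of_lt {s t : Real.Angle} (h : f s < f t) :
    turn (t - s) = f s - f t + 2 * Real.pi := by
  refine turn_eq_of_coe_eq ?_ (by linarith [f.sub_lt t s]) (by linarith)
  rw [coe_add, coe_sub, f.coe_toFun, f.coe_toFun, coe_two_pi]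
  abel

/-- Lags ending at `a`, in `[0, 2π)`. -/
noncomputable def right (a : Real.Angle) : AngleLag where
  toFun s := turn (a - s)
  base := a
  coe_toFun _ := coe_turn _
  sub_lt s t := by linarith [turn_lt (a - s), turn_nonneg (a - t)]

/-- Lags ending at `a`, in `(0, 2π]`. -/
noncomputable def left (a : Real.Angle) : AngleLag where
  toFun s := 2 * Real.pi - turn (s - a)
  base := a
  coe_toFun s := by
    rw [coe_sub, coe_two_pi, coe_turn]
    abel
  sub_lt s t := by linarith [turn_lt (t - a), turn_nonneg (s - a)]

/-- The lag function turned by `θ`. -/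
noncomputable def shift (θ : Real.Angle) : AngleLag where
  toFun s := f (s - θ)
  base := θ + f.base
  coe_toFun s := by
    rw [f.coe_toFun]
    abel
  sub_lt _ _ := f.sub_lt _ _

theorem shift_apply (θ s : Real.Angle) : f.shift θ (θ + s) = f s := by
  simp [shift]

theorem right_self (a : Real.Angle) : right a a = 0 := by simp [right, turn_zero]

theorem left_self (a : Real.Angle) : left a a = 2 * Real.pi := by simp [left, turn_zero]

theorem right_pos {a s : Real.Angle} (h : s ≠ a) : 0 < right a s :=
  (turn_nonneg _).lt_of_ne' fun h' => h (sub_eq_zero.1 (turn_eq_zero_iff.1 h')).symm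

theorem left_lt {a s : Real.Angle} (h : s ≠ a) : left a s < 2 * Real.pi := by
  have : 0 < turn (s - a) :=
    (turn_nonneg _).lt_of_ne' fun h' => h (sub_eq_zero.1 (turn_eq_zero_iff.1 h'))
  simp only [left]
  linarith

/-- `right a` cuts the circle just after `a` and `left a` just before it, so only the lift at `a`
itself can change. -/
theorem left_eq_right {a s : Real.Angle} (h : s ≠ a) : left a s = right a s := by
  have h1 := (right a).turn_sub_of_lt (s := a) (t := s) (by rw [right_self]; exact right_pos h)
  rw [right_self] at h1
  simp only [left, h1]
  ring

theorem shift_right (a θ : Real.Angle) : (right a).shift θ = right (θ + a) := by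
  simp only [shift, right, AngleLag.mk.injEq, and_true]
  funext s
  congr 1
  abel

theorem shift_left (a θ : Real.Angle) : (left a).shift θ = left (θ + a) := by
  simp only [shift, left, AngleLag.mk.injEq, and_true]
  funext s
  congr 2
  abel

/-- Going anticlockwise, `f` decreases except for one jump of `2π` at the cut. Hence `f s < f t`
says that the arc from `s` to `t` crosses the cut, and the two alternatives put `u` before or after
it. -/
theorem sbtw_iff_of_lt {s t u : Real.Angle} (h : f s < f t) :
    sbtw s u t ↔ f u < f s ∨ f t < f u := by
  rw [sbtw_iff_turn, f.turn_sub_of_lt h]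
  rcases lt_trichotomy (f s) (f u) with h1 | h1 | h1
  · rw [f.turn_sub_of_lt h1]
    have := f.sub_lt u s
    constructor
    · rintro ⟨-, h2⟩
      exact Or.inr (by linarith)
    · rintro (h2 | h2)
      · linarith
      · exact ⟨by linarith, by linarith⟩
  · rw [f.turn_sub_of_le h1.ge, h1]
    simp only [sub_self, lt_irrefl, false_and, false_or, false_iff, not_lt]
    linarith
  · rw [f.turn_sub_of_le h1.le]
    have := f.sub_lt t u
    exact ⟨fun _ => Or.inl h1, fun _ => ⟨by linarith, by linarith⟩⟩

/-- The arc across the cut runs from the smallest to the largest value of `f` on `S`; this gives its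
existence and uniqueness. -/
theorem isCircleArc_iff_of_lt {S : Set Real.Angle} {s t : Real.Angle} (h : f s < f t) :
    IsCircleArc S s t ↔ s ∈ S ∧ t ∈ S ∧ ∀ u ∈ S, f s ≤ f u ∧ f u ≤ f t := by
  simp only [IsCircleArc, f.sbtw_iff_of_lt h, not_or, not_lt]
  have : s ≠ t := by
    rintro rfl
    exact lt_irrefl _ h
  simp only [ne_eq, this, not_false_iff, true_and]

theorem exists_isCircleArc {S : Set Real.Angle} (hS : S.Finite) (hne : S.Nontrivial) :
    ∃ s t, f s < f t ∧ IsCircleArc S s t := by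
  obtain ⟨s, hs, hmin⟩ := Set.exists_min_image S f hS hne.nonempty
  obtain ⟨t, ht, hmax⟩ := Set.exists_max_image S f hS hne.nonempty
  have hst : f s < f t := by
    refine (hmin t ht).lt_of_ne fun h => ?_
    obtain ⟨u, hu, hut⟩ := hne.exists_ne t
    exact hut (f.injective (le_antisymm (hmax u hu) (h ▸ hmin u hu)))
  exact ⟨s, t, hst, (f.isCircleArc_iff_of_lt hst).2 ⟨hs, ht, fun u hu => ⟨hmin u hu, hmax u hu⟩⟩⟩

theorem lt_of_sbtw {s t u : Real.Angle} (h : sbtw s u t) : right u s < right u t := by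
  by_contra! hle
  rw [sbtw_iff_turn, (right u).turn_sub_of_le hle, (right u).turn_sub_of_le (s := s) (t := u)
    (by rw [right_self]; exact turn_nonneg _), right_self] at h
  have : 0 ≤ right u t := turn_nonneg _
  linarith [h.2]

theorem sub_eq_of_le {s τ : Real.Angle} (h : f s ≤ f τ) :
    right s τ = f τ - f s :=
  f.turn_sub_of_le h

end AngleLag

/-! ### The arcs and points over a given cell -/

namespace PlaneTiling

variable {L : Type*} {T : PlaneTiling L}

theorem exists_tile_superset {k : ℕ} {c : Set ℂ} (hc : c ∈ T.cell k) : ∃ t ∈ T.tile, c ⊆ t := by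
  match k, hc with
  | 0, hc =>
    obtain ⟨v, -, rfl⟩ := hc
    obtain ⟨t, ht, hvt⟩ := T.exists_tile v
    exact ⟨t, ht, Set.singleton_subset_iff.2 hvt⟩
  | 1, hc =>
    obtain ⟨a, -, b, -, -, h, -⟩ := T.edge_segment c hc
    obtain ⟨t, ht, hmt⟩ := T.exists_tile (midpoint ℝ a b)
    subst h
    exact ⟨t, ht, (segment_subset_frontier hc (midpoint_mem_openSegment a b) ht hmt).trans
      (frontier_subset_tile ht)⟩
  | 2, hc => exact ⟨c, hc, subset_rfl⟩
  | _ + 3, hc => exact hc.elim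

theorem Prototiles.tau_mem_angles (P : T.Prototiles) {c t : Set ℂ} (ht : t ∈ T.tile)
    (hct : c ⊆ t) : P.tau t ∈ P.angles c :=
  ⟨t, ht, hct, Or.inl rfl⟩

theorem Prototiles.angles_anti (P : T.Prototiles) {c d : Set ℂ} (h : d ⊆ c) :
    P.angles c ⊆ P.angles d := by
  rintro a ⟨t, ht, hct, ha⟩
  exact ⟨t, ht, h.trans hct, ha⟩

theorem Prototiles.tau_ne (P : T.Prototiles) (t : Set ℂ) :
    P.tau t ≠ P.tau t + (Real.pi : Real.Angle) := by
  intro h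
  exact Real.Angle.pi_ne_zero (by simpa using h)

/-- Subdividing at `τ_t + π` as well as at `τ_t` ensures that every arc has two different ends. -/
theorem Prototiles.angles_nontrivial (P : T.Prototiles) {k : ℕ} {c : Set ℂ} (hc : c ∈ T.cell k) :
    (P.angles c).Nontrivial := by
  obtain ⟨t, ht, hct⟩ := T.exists_tile_superset hc
  exact ⟨_, P.tau_mem_angles ht hct, _, ⟨t, ht, hct, Or.inr rfl⟩, P.tau_ne t⟩

namespace RotCell

variable {P : T.Prototiles}

theorem isCircleArc (y : RotCell P) (h : y.src ≠ y.tgt) :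
    IsCircleArc (P.angles y.base) y.src y.tgt :=
  y.fibre_mem.resolve_left fun h' => h h'.1

theorem src_mem (y : RotCell P) : y.src ∈ P.angles y.base := by
  rcases y.fibre_mem with h | h
  · exact h.2
  · exact h.1

theorem tgt_mem (y : RotCell P) : y.tgt ∈ P.angles y.base := by
  rcases y.fibre_mem with h | h
  · exact h.1 ▸ h.2
  · exact h.2.1

theorem ne_of_lt {f : AngleLag} {y : RotCell P} (h : f y.src < f y.tgt) : y.src ≠ y.tgt :=
  fun h' => lt_irrefl _ (h' ▸ h)

theorem le_and_le {f : AngleLag} {y : RotCell P} (h : f y.src < f y.tgt) {u : Real.Angle}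
    (hu : u ∈ P.angles y.base) : f y.src ≤ f u ∧ f u ≤ f y.tgt :=
  ((f.isCircleArc_iff_of_lt h).1 (y.isCircleArc (ne_of_lt h))).2.2 u hu

/-- The arc over `c` which contains the base point of `f` (or has it as an end, on the side
determined by `f`). -/
noncomputable def arcOver (P : T.Prototiles) {k : ℕ} (c : T.cell k) (f : AngleLag) :
    RotCell P where
  dim := k
  base := c.1
  src := (f.exists_isCircleArc (finite_angles c.2) (P.angles_nontrivial c.2)).choose
  tgt := (f.exists_isCircleArc (finite_angles c.2) (P.angles_nontrivial c.2)).choose_spec.choose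
  base_mem := c.2
  fibre_mem := Or.inr
    (f.exists_isCircleArc (finite_angles c.2)
      (P.angles_nontrivial c.2)).choose_spec.choose_spec.2

theorem arcOver_lt {k : ℕ} (c : T.cell k) (f : AngleLag) :
    f (arcOver P c f).src < f (arcOver P c f).tgt :=
  (f.exists_isCircleArc (finite_angles c.2)
      (P.angles_nontrivial c.2)).choose_spec.choose_spec.1

theorem arcOver_ne {k : ℕ} (c : T.cell k) (f : AngleLag) :
    (arcOver P c f).src ≠ (arcOver P c f).tgt :=
  ne_of_lt (arcOver_lt c f)

theorem eq_of_lt {f : AngleLag} {y z : RotCell P} (hd : y.dim = z.dim) (hb : y.base = z.base)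
    (hy : f y.src < f y.tgt) (hz : f z.src < f z.tgt) : y = z := by
  have h1 := le_and_le hy (hb ▸ z.src_mem)
  have h2 := le_and_le hz (hb ▸ y.src_mem)
  have h3 := le_and_le hy (hb ▸ z.tgt_mem)
  have h4 := le_and_le hz (hb ▸ y.tgt_mem)
  exact RotCell.ext hd hb (f.injective (le_antisymm h1.1 h2.1))
    (f.injective (le_antisymm h4.2 h3.2))

theorem eq_arcOver {k : ℕ} {c : T.cell k} {f : AngleLag} {y : RotCell P} (hd : y.dim = k)
    (hb : y.base = c.1) (h : f y.src < f y.tgt) : y = arcOver P c f :=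
  eq_of_lt hd hb h (arcOver_lt c f)

/-- The cell over `c` given by a subdividing point. -/
def pointOver {k : ℕ} (c : T.cell k) (a : Real.Angle) (ha : a ∈ P.angles c.1) : RotCell P where
  dim := k
  base := c.1
  src := a
  tgt := a
  base_mem := c.2
  fibre_mem := Or.inl ⟨rfl, ha⟩

theorem tgt_eq_iff {y : RotCell P} (hy : y.src ≠ y.tgt) {a : Real.Angle}
    (ha : a ∈ P.angles y.base) :
    y.tgt = a ↔ AngleLag.left a y.src < AngleLag.left a y.tgt := by
  constructor
  · rintro rfl
    rw [AngleLag.left_self]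
    exact AngleLag.left_lt hy
  · intro h
    by_contra hne
    have := (le_and_le h ha).2
    rw [AngleLag.left_self] at this
    exact absurd (AngleLag.left_lt hne) this.not_gt

theorem src_eq_iff {y : RotCell P} (hy : y.src ≠ y.tgt) {a : Real.Angle}
    (ha : a ∈ P.angles y.base) :
    y.src = a ↔ AngleLag.right a y.src < AngleLag.right a y.tgt := by
  constructor
  · rintro rfl
    rw [AngleLag.right_self]
    exact AngleLag.right_pos hy.symm
  · intro h
    by_contra hne
    have := (le_and_le h ha).1
    rw [AngleLag.right_self] at this
    exact absurd (AngleLag.right_pos hne) this.not_gt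

theorem not_sbtw_self {a u : Real.Angle} : ¬ sbtw a u a := by
  rw [Real.Angle.sbtw_iff_turn, sub_self, Real.Angle.turn_zero]
  intro h
  linarith

theorem mem_fibre_iff_of_eq {y : RotCell P} (h : y.src = y.tgt) {u : Real.Angle} :
    u ∈ y.fibre ↔ u = y.src := by
  simp only [fibre, Set.mem_ofPred_eq, ← h, true_and, not_sbtw_self, or_false]

theorem mem_fibre_iff_sbtw {y : RotCell P} (h : y.src ≠ y.tgt) {u : Real.Angle} :
    u ∈ y.fibre ↔ sbtw y.src u y.tgt := by
  simp only [fibre, Set.mem_ofPred_eq, h, false_and, false_or]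

theorem fibre_nonempty {y : RotCell P} (h : y.src ≠ y.tgt) : y.fibre.Nonempty := by
  have h0 : 0 < Real.Angle.turn (y.tgt - y.src) :=
    (Real.Angle.turn_nonneg _).lt_of_ne'
      fun h' => h (sub_eq_zero.1 (Real.Angle.turn_eq_zero_iff.1 h')).symm
  have h1 := Real.Angle.turn_lt (y.tgt - y.src)
  refine ⟨y.src + ((Real.Angle.turn (y.tgt - y.src) / 2 : ℝ) : Real.Angle), ?_⟩
  rw [mem_fibre_iff_sbtw h, Real.Angle.sbtw_iff_turn, add_sub_cancel_left,
    Real.Angle.turn_eq_of_coe_eq rfl (by linarith) (by linarith)]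
  exact ⟨by linarith, by linarith⟩

/-- Over a face there are more subdividing angles, so the arc across a cut lies inside the arc
across the same cut over the coface. Distinct arcs over one cell are disjoint, which gives the
converse. -/
theorem fibre_subset_iff {f : AngleLag} {y z : RotCell P} (hzy : z.base ⊆ y.base)
    (hz : f z.src < f z.tgt) (hy : y.src ≠ y.tgt) :
    z.fibre ⊆ y.fibre ↔ f y.src < f y.tgt := by
  have key : ∀ w : RotCell P, w.base = y.base → f w.src < f w.tgt → z.fibre ⊆ w.fibre := by
    intro w hw hlt u hu
    rw [mem_fibre_iff_sbtw (ne_of_lt hz), f.sbtw_iff_of_lt hz] at hu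
    rw [mem_fibre_iff_sbtw (ne_of_lt hlt), f.sbtw_iff_of_lt hlt]
    rw [← hw] at hzy
    have h1 := (le_and_le hz (P.angles_anti hzy w.src_mem)).1
    have h2 := (le_and_le hz (P.angles_anti hzy w.tgt_mem)).2
    exact hu.imp (fun h => h.trans_le h1) fun h => h2.trans_lt h
  refine ⟨fun hsub => ?_, key y rfl⟩
  obtain ⟨u, hu⟩ := fibre_nonempty (ne_of_lt hz)
  let w := arcOver P ⟨y.base, y.base_mem⟩ f
  have hw : f w.src < f w.tgt := arcOver_lt _ _
  have hu1 := hsub hu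
  have hu2 := key w rfl hw hu
  rw [mem_fibre_iff_sbtw hy] at hu1
  rw [mem_fibre_iff_sbtw (ne_of_lt hw)] at hu2
  rw [eq_of_lt (y := y) (z := w) rfl rfl (AngleLag.lt_of_sbtw hu1) (AngleLag.lt_of_sbtw hu2)]
  exact hw

end RotCell

end PlaneTiling

namespace PlaneTiling

variable {L : Type*} {T : PlaneTiling L}

namespace RotCell

variable {P : T.Prototiles}

/-! ### Chains in coordinates -/

/-- The coefficients of a chain on the arcs at the base point of `f`. -/
noncomputable def arcVal (x : RotCell P → ℤ) (f : AngleLag) (k : ℕ) : T.cell k → ℤ :=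
  fun c => x (arcOver P c f)

open Classical in
/-- The coefficients of a chain on the subdividing points at the angle `a`. -/
noncomputable def ptVal (x : RotCell P → ℤ) (a : Real.Angle) (k : ℕ) : T.cell k → ℤ :=
  fun c => if h : a ∈ P.angles c.1 then x (pointOver c a h) else 0

theorem ptVal_add (x y : RotCell P → ℤ) (a : Real.Angle) (k : ℕ) :
    ptVal (x + y) a k = ptVal x a k + ptVal y a k := by
  funext c
  simp only [ptVal, Pi.add_apply]
  split_ifs <;> simp

theorem arcVal_zero (f : AngleLag) (k : ℕ) : arcVal (0 : RotCell P → ℤ) f k = 0 := rfl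

theorem ptVal_zero (a : Real.Angle) (k : ℕ) : ptVal (0 : RotCell P → ℤ) a k = 0 := by
  funext c
  simp [ptVal]

theorem eq_arcOver_right (y : RotCell P) (h : y.src ≠ y.tgt) :
    y = arcOver P ⟨y.base, y.base_mem⟩ (AngleLag.right y.src) :=
  eq_arcOver rfl rfl ((src_eq_iff h y.src_mem).1 rfl)

theorem eq_pointOver (y : RotCell P) (h : y.src = y.tgt) :
    y = pointOver ⟨y.base, y.base_mem⟩ y.src y.src_mem :=
  RotCell.ext rfl rfl rfl h.symm

theorem apply_of_ne (x : RotCell P → ℤ) (y : RotCell P) (h : y.src ≠ y.tgt) :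
    x y = arcVal x (AngleLag.right y.src) y.dim ⟨y.base, y.base_mem⟩ :=
  congrArg x (eq_arcOver_right y h)

theorem apply_of_eq (x : RotCell P → ℤ) (y : RotCell P) (h : y.src = y.tgt) :
    x y = ptVal x y.src y.dim ⟨y.base, y.base_mem⟩ := by
  rw [ptVal, dif_pos y.src_mem]
  exact congrArg x (eq_pointOver y h)

theorem chain_ext {x x' : RotCell P → ℤ} (h1 : ∀ f k, arcVal x f k = arcVal x' f k)
    (h2 : ∀ a k, ptVal x a k = ptVal x' a k) : x = x' := by
  funext y
  by_cases h : y.src = y.tgt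
  · rw [apply_of_eq x y h, apply_of_eq x' y h, h2]
  · rw [apply_of_ne x y h, apply_of_ne x' y h, h1]

theorem arcOver_left_eq_right {k : ℕ} (c : T.cell k) {a : Real.Angle} (ha : a ∉ P.angles c.1) :
    arcOver P c (AngleLag.left a) = arcOver P c (AngleLag.right a) := by
  refine eq_arcOver rfl rfl ?_
  have h := arcOver_lt (P := P) c (AngleLag.left a)
  rwa [AngleLag.left_eq_right, AngleLag.left_eq_right] at h
  · intro h'
    have h1 := tgt_mem (arcOver P c (AngleLag.left a))
    rw [h'] at h1
    exact ha h1
  · intro h'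
    have h1 := src_mem (arcOver P c (AngleLag.left a))
    rw [h'] at h1
    exact ha h1

variable (o : T.EdgeOrientation)

theorem mem_cofaces {j k : ℕ} (d : T.cell j) (c : Set ℂ) :
    c ∈ (T.finite_cofaces k d.2).toFinset ↔ c ∈ T.cell k ∧ d.1 ⊆ c := by simp

/-- Over each coface exactly one arc contains the given arc, namely the one across the same cut, so
the incidence numbers are those of the tiling. -/
theorem arcVal_boundary (x : RotCell P → ℤ) (f : AngleLag) (k : ℕ) :
    arcVal (boundary o P x) f k = o.boundary k (arcVal x f (k + 1)) := by
  funext d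
  symm
  have hz := arcOver_lt (P := P) d f
  have hzn := arcOver_ne (P := P) d f
  change ∑ c ∈ (T.finite_cofaces (k + 1) d.2).toFinset.attach, _ =
    ∑ y ∈ (finite_above (arcOver P d f)).toFinset, _
  refine Finset.sum_of_injOn
    (fun c => arcOver P ⟨c.1, ((mem_cofaces d c.1).1 c.2).1⟩ f) ?_ ?_ ?_ ?_
  · intro c _ c' _ h
    exact Subtype.ext (congrArg RotCell.base h)
  · intro c _
    exact (Set.Finite.mem_toFinset _).2 ((mem_cofaces d c.1).1 c.2).2
  · intro y hy hne
    have hy' : d.1 ⊆ y.base := (Set.Finite.mem_toFinset _).1 hy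
    rw [inc, if_neg, if_neg, zero_mul]
    · exact fun h => hzn h.2.2
    · rintro ⟨h1, h2, h3⟩
      have hyn : y.src ≠ y.tgt := fun h => hzn (h2.1 h)
      have hbase : y.base ∈ T.cell (k + 1) := h1 ▸ y.base_mem
      refine hne ⟨⟨y.base, (mem_cofaces d _).2 ⟨hbase, hy'⟩⟩, Finset.mem_coe.2 (Finset.mem_attach _ _), ?_⟩
      exact (eq_arcOver (c := ⟨y.base, hbase⟩) h1 rfl ((fibre_subset_iff hy' hz hyn).1 h3)).symm
  · intro c _
    have hc := (mem_cofaces d c.1).1 c.2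
    have hcn := arcOver_ne (P := P) ⟨c.1, hc.1⟩ f
    rw [inc, if_pos ⟨rfl, iff_of_false hcn hzn,
      (fibre_subset_iff hc.2 hz hcn).2 (arcOver_lt _ _)⟩]
    rfl

/-- A point over `d` at `a` lies in the boundary of the points at `a` over cofaces of `d` and of the
two arcs over `d` that end or start at `a`. -/
theorem ptVal_boundary (x : RotCell P → ℤ) (a : Real.Angle) (k : ℕ) :
    ptVal (boundary o P x) a k = o.boundary k (ptVal x a (k + 1)) +
      (-1) ^ k * (arcVal x (AngleLag.left a) k - arcVal x (AngleLag.right a) k) := by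
  classical
  funext d
  -- If `a` does not subdivide the fibre over `d`, it subdivides none over a coface, and the cuts
  -- just before and just after `a` select the same arc.
  by_cases ha : a ∈ P.angles d.1
  swap
  · rw [ptVal, dif_neg ha]
    simp only [Pi.add_apply, Pi.mul_apply, Pi.sub_apply, arcVal, arcOver_left_eq_right d ha,
      sub_self, mul_zero, add_zero]
    symm
    refine Finset.sum_eq_zero fun c _ => ?_
    have hc := (mem_cofaces d c.1).1 c.2
    rw [ptVal, dif_neg fun h => ha (P.angles_anti hc.2 h), mul_zero]
  rw [ptVal, dif_pos ha]
  set z := pointOver d a ha with hz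
  have hinc : ∀ y : RotCell P, inc o y z * x y =
      (if y.dim = k + 1 ∧ y.src = a ∧ y.tgt = a then o.inc k y.base d.1 * x y else 0) +
      (-1) ^ k * ((if y = arcOver P d (AngleLag.left a) then x y else 0) -
        (if y = arcOver P d (AngleLag.right a) then x y else 0)) := by
    intro y
    have hL : y = arcOver P d (AngleLag.left a) ↔
        y.base = d.1 ∧ y.src ≠ y.tgt ∧ y.tgt = a := by
      constructor
      · rintro rfl
        exact ⟨rfl, arcOver_ne _ _, (tgt_eq_iff (arcOver_ne _ _) ha).2 (arcOver_lt _ _)⟩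
      · rintro ⟨h1, h2, h3⟩
        exact eq_arcOver (cell_disjoint (h1 ▸ y.base_mem) d.2) h1
          ((tgt_eq_iff h2 (h1.symm ▸ ha)).1 h3)
    have hR : y = arcOver P d (AngleLag.right a) ↔
        y.base = d.1 ∧ y.src ≠ y.tgt ∧ y.src = a := by
      constructor
      · rintro rfl
        exact ⟨rfl, arcOver_ne _ _, (src_eq_iff (arcOver_ne _ _) ha).2 (arcOver_lt _ _)⟩
      · rintro ⟨h1, h2, h3⟩
        exact eq_arcOver (cell_disjoint (h1 ▸ y.base_mem) d.2) h1
          ((src_eq_iff h2 (h1.symm ▸ ha)).1 h3)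
    have hdim : y.base = d.1 → y.dim = k := fun h => cell_disjoint (h ▸ y.base_mem) d.2
    have hC : (y.dim = z.dim + 1 ∧ (y.src = y.tgt ↔ z.src = z.tgt) ∧ z.fibre ⊆ y.fibre) ↔
        (y.dim = k + 1 ∧ y.src = a ∧ y.tgt = a) := by
      have hzz : z.src = z.tgt := rfl
      have hza : z.src = a := rfl
      have hzd : z.dim = k := rfl
      rw [hzd]
      refine and_congr_right fun _ => ?_
      constructor
      · rintro ⟨h1, h2⟩
        have h3 := h1.2 hzz
        have h4 := h2 ((mem_fibre_iff_of_eq hzz).2 hza.symm)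
        rw [mem_fibre_iff_of_eq h3] at h4
        exact ⟨h4.symm, h3.symm.trans h4.symm⟩
      · rintro ⟨h1, h2⟩
        have h3 : y.src = y.tgt := h1.trans h2.symm
        refine ⟨iff_of_true h3 hzz, fun u hu => ?_⟩
        rw [mem_fibre_iff_of_eq hzz] at hu
        rw [mem_fibre_iff_of_eq h3, h1, hu, hza]
    rw [inc]
    simp only [hC, hL, hR]
    have hzb : z.base = d.1 := rfl
    have hzz : (a = z.tgt) ↔ True := iff_of_true rfl trivial
    have hza : z.src = a := rfl
    have hzd : z.dim = k := rfl
    rw [hzb, hza, hzd]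
    simp only [hzz, and_true]
    by_cases h1 : y.dim = k + 1 ∧ y.src = a ∧ y.tgt = a
    · have hb : y.base ≠ d.1 := fun h => by
        have := hdim h
        omega
      simp [h1, hb]
    · rw [if_neg h1, if_neg h1, zero_add]
      by_cases h2 : y.base = d.1 ∧ y.src ≠ y.tgt
      · rw [if_pos h2, hdim h2.1]
        simp only [h2.1, h2.2, ne_eq, not_false_iff, true_and, eq_comm (a := a)]
        split_ifs <;> ring
      · rw [if_neg h2, if_neg fun h => h2 ⟨h.1, h.2.1⟩, if_neg fun h => h2 ⟨h.1, h.2.1⟩]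
        simp
  change ∑ y ∈ (finite_above z).toFinset, inc o y z * x y = _
  rw [Finset.sum_congr rfl fun y _ => hinc y, Finset.sum_add_distrib, ← Finset.mul_sum,
    Finset.sum_sub_distrib, Finset.sum_ite_eq', Finset.sum_ite_eq', if_pos, if_pos]
  · simp only [Pi.add_apply, Pi.mul_apply, Pi.sub_apply]
    congr 1
    let g : Set ℂ → ℤ := fun c => if h : c ∈ T.cell (k + 1) ∧ a ∈ P.angles c then
      o.inc k c d.1 * x (pointOver ⟨c, h.1⟩ a h.2) else 0
    have hR : o.boundary k (ptVal x a (k + 1)) d =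
        ∑ c ∈ (T.finite_cofaces (k + 1) d.2).toFinset, g c := by
      rw [← Finset.sum_attach]
      refine Finset.sum_congr rfl fun c _ => ?_
      have hc := ((mem_cofaces d c.1).1 c.2).1
      simp only [ptVal, g, hc, true_and]
      split_ifs <;> simp
    rw [hR, ← Finset.sum_filter]
    refine Finset.sum_of_injOn RotCell.base ?_ ?_ ?_ ?_
    · intro y hy y' hy' h
      simp only [Finset.coe_filter, Set.mem_ofPred_eq] at hy hy'
      exact RotCell.ext (hy.2.1.trans hy'.2.1.symm) h (hy.2.2.1.trans hy'.2.2.1.symm)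
        (hy.2.2.2.trans hy'.2.2.2.symm)
    · intro y hy
      simp only [Finset.coe_filter, Set.mem_ofPred_eq, Set.Finite.mem_toFinset] at hy
      exact (mem_cofaces d _).2 ⟨hy.2.1 ▸ y.base_mem, hy.1⟩
    · intro c hc hne
      simp only [g]
      by_contra h0
      obtain ⟨h, -⟩ := dite_ne_right_iff.1 h0
      refine hne ⟨pointOver ⟨c, h.1⟩ a h.2, ?_, rfl⟩
      simp only [Finset.coe_filter, Set.mem_ofPred_eq, Set.Finite.mem_toFinset]
      exact ⟨((mem_cofaces d c).1 hc).2, rfl, rfl, rfl⟩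
    · intro y hy
      simp only [Finset.mem_filter] at hy
      have h : y.base ∈ T.cell (k + 1) ∧ a ∈ P.angles y.base :=
        ⟨hy.2.1 ▸ y.base_mem, hy.2.2.1 ▸ y.src_mem⟩
      simp only [g]
      rw [dif_pos h]
      congr 2
      exact RotCell.ext hy.2.1 rfl hy.2.2.1 hy.2.2.2
  · exact (Set.Finite.mem_toFinset _).2 (subset_rfl : d.1 ⊆ d.1)
  · exact (Set.Finite.mem_toFinset _).2 (subset_rfl : d.1 ⊆ d.1)

/-- For the point slices the two jump terms cancel because their signs are `(-1)^k` and
`(-1)^(k+1)`. -/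
theorem boundary_boundary (x : RotCell P → ℤ) : boundary o P (boundary o P x) = 0 := by
  refine chain_ext (fun f k => ?_) fun a k => ?_
  · rw [arcVal_boundary, arcVal_boundary, o.boundary_boundary, arcVal_zero]
  · rw [ptVal_boundary, ptVal_boundary, arcVal_boundary, arcVal_boundary, map_add,
      o.boundary_boundary, zero_add, ptVal_zero, ← map_sub, pow_succ]
    have h : ∀ (s : ℤ) (g : T.cell (k + 1) → ℤ),
        o.boundary k ((s : T.cell (k + 1) → ℤ) * g) = (s : T.cell k → ℤ) * o.boundary k g := by
      intro s g
      rw [← zsmul_eq_mul, map_zsmul, zsmul_eq_mul]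
    have h2 := h ((-1) ^ k * -1)
    push_cast at h2
    rw [h2]
    ring

/-- If the values of `x` agree on the two arcs at each subdividing point, they agree on all arcs
over the cell. -/
theorem arcVal_eq_of_left_eq_right (x : RotCell P → ℤ) {k : ℕ} (c : T.cell k)
    (h : ∀ a ∈ P.angles c.1,
      arcVal x (AngleLag.left a) k c = arcVal x (AngleLag.right a) k c)
    (f f' : AngleLag) : arcVal x f k c = arcVal x f' k c := by
  have key : ∀ a ∈ P.angles c.1, arcVal x (AngleLag.right a) k c = arcVal x f k c := by
    by_contra! hbad
    have hfin : {a ∈ P.angles c.1 | arcVal x (AngleLag.right a) k c ≠ arcVal x f k c}.Finite :=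
      (finite_angles c.2).subset fun a ha => ha.1
    -- Let `s` be the exceptional starting point with the largest lift. The preceding arc carries
    -- the same wrong value, so it does not cross the cut, and its starting point is exceptional
    -- with a larger lift.
    obtain ⟨s, ⟨hs, hsx⟩, hmax⟩ := Set.exists_max_image _ f hfin hbad
    let y := arcOver P c (AngleLag.left s)
    have hy : y.src ≠ y.tgt := arcOver_ne _ _
    have hys : y.tgt = s := (tgt_eq_iff hy hs).2 (arcOver_lt _ _)
    have hyx : x y ≠ arcVal x f k c := by
      have := h s hs
      rwa [← this] at hsx
    have h1 : ¬ f y.src < f y.tgt := fun hlt => by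
      rw [eq_arcOver (c := c) rfl rfl hlt] at hyx
      exact hyx rfl
    have h2 : f y.tgt < f y.src :=
      (not_lt.1 h1).lt_of_ne fun h' => hy (f.injective h'.symm)
    refine absurd (hmax y.src ⟨y.src_mem, ?_⟩) (not_le.2 (hys ▸ h2))
    rw [arcVal, ← eq_arcOver (c := c) (y := y) rfl rfl ((src_eq_iff hy y.src_mem).1 rfl)]
    exact hyx
  have h3 := apply_of_ne x (arcOver P c f') (arcOver_ne _ _)
  have h4 := key _ (arcOver P c f').src_mem
  rw [← h4]
  exact h3.symm

/-- Both sums run once over all arcs in the fibre, listed by their ends or by their starting points: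
the jumps around a circle add up to zero. -/
theorem sum_arcVal_left_eq_right (x : RotCell P → ℤ) {k : ℕ} (c : T.cell k) :
    ∑ a ∈ (finite_angles (P := P) c.2).toFinset, arcVal x (AngleLag.left a) k c =
      ∑ a ∈ (finite_angles (P := P) c.2).toFinset, arcVal x (AngleLag.right a) k c := by
  have hL : ∀ a ∈ P.angles c.1, (arcOver P c (AngleLag.left a)).tgt = a := fun a ha =>
    (tgt_eq_iff (arcOver_ne _ _) ha).2 (arcOver_lt _ _)
  have hR : ∀ a ∈ P.angles c.1, (arcOver P c (AngleLag.right a)).src = a := fun a ha =>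
    (src_eq_iff (arcOver_ne _ _) ha).2 (arcOver_lt _ _)
  have hLR : ∀ a, arcOver P c (AngleLag.right (arcOver P c (AngleLag.left a)).src) =
      arcOver P c (AngleLag.left a) := fun a =>
    (eq_arcOver rfl rfl ((src_eq_iff (arcOver_ne _ _) (src_mem _)).1 rfl)).symm
  have hRL : ∀ a, arcOver P c (AngleLag.left (arcOver P c (AngleLag.right a)).tgt) =
      arcOver P c (AngleLag.right a) := fun a =>
    (eq_arcOver rfl rfl ((tgt_eq_iff (arcOver_ne _ _) (tgt_mem _)).1 rfl)).symm
  refine Finset.sum_nbij' (fun a => (arcOver P c (AngleLag.left a)).src)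
    (fun a => (arcOver P c (AngleLag.right a)).tgt) ?_ ?_ ?_ ?_ ?_
  · exact fun a _ => (Set.Finite.mem_toFinset _).2 (src_mem (arcOver P c (AngleLag.left a)))
  · exact fun a _ => (Set.Finite.mem_toFinset _).2 (tgt_mem (arcOver P c (AngleLag.right a)))
  · intro a ha
    simp only [hLR, hL a ((Set.Finite.mem_toFinset _).1 ha)]
  · intro a ha
    simp only [hRL, hR a ((Set.Finite.mem_toFinset _).1 ha)]
  · intro a _
    simp only [arcVal, hLR]

end RotCell

end PlaneTiling

namespace PlaneTiling

variable {L : Type*} {T : PlaneTiling L}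

namespace RotCell

variable {P : T.Prototiles}

/-! ### Pattern-equivariance in coordinates -/

/-- The image of a cell under a rigid motion that carries stars. -/
noncomputable def moved (hiso : T.TrivialCellIsotropy) (φ : RigidMotion) (y : RotCell P)
    {c' : Set ℂ} (hc' : c' ∈ T.cell y.dim) (h : T.CarriesStar φ y.base c') : RotCell P where
  dim := y.dim
  base := c'
  src := φ.rot + y.src
  tgt := φ.rot + y.tgt
  base_mem := hc'
  fibre_mem := by
    rcases y.fibre_mem with ⟨h1, h2⟩ | h1
    · exact Or.inl ⟨by rw [h1], (P.mem_angles_iff hiso h _).2 h2⟩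
    · right
      have hlt : AngleLag.right y.src y.src < AngleLag.right y.src y.tgt := by
        rw [AngleLag.right_self]
        exact AngleLag.right_pos h1.2.2.1.symm
      have h2 := ((AngleLag.right y.src).isCircleArc_iff_of_lt hlt).1 h1
      rw [← AngleLag.shift_apply _ φ.rot y.src, ← AngleLag.shift_apply _ φ.rot y.tgt] at hlt
      refine (AngleLag.isCircleArc_iff_of_lt _ hlt).2
        ⟨(P.mem_angles_iff hiso h _).2 h2.1, (P.mem_angles_iff hiso h _).2 h2.2.1, ?_⟩
      intro u hu
      rw [← add_sub_cancel φ.rot u] at hu ⊢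
      simp only [AngleLag.shift_apply]
      exact h2.2.2 _ ((P.mem_angles_iff hiso h _).1 hu)

theorem mapsTo_arcOver (hiso : T.TrivialCellIsotropy) {φ : RigidMotion} {k : ℕ} {c c' : T.cell k}
    (h : T.CarriesStar φ c.1 c'.1) (f : AngleLag) :
    MapsTo φ (arcOver P c f) (arcOver P c' (f.shift φ.rot)) := by
  have h1 : moved hiso φ (arcOver P c f) c'.2 h = arcOver P c' (f.shift φ.rot) := by
    refine eq_arcOver rfl rfl ?_
    simp only [moved, AngleLag.shift_apply]
    exact arcOver_lt _ _
  rw [← h1]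
  exact ⟨h.1, rfl, rfl⟩

/-- The chain `x` takes the same values on cells which correspond under the motions in
`E_T(c, c'; r)`. -/
def IsEquivariant (x : RotCell P → ℤ) (r : ℝ) : Prop :=
  ∀ k, ∀ c c' : T.cell k, ∀ φ ∈ T.motions c.1 c'.1 r,
    (∀ f, arcVal x f k c = arcVal x (f.shift φ.rot) k c') ∧
      ∀ a, ptVal x a k c = ptVal x (φ.rot + a) k c'

theorem isEquivariant_iff (hiso : T.TrivialCellIsotropy) {x : RotCell P → ℤ} {r : ℝ}
    (hr : 0 ≤ r) :
    (∀ y z : RotCell P, y.dim = z.dim → ∀ φ ∈ T.motions y.base z.base r, MapsTo φ y z →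
      x y = x z) ↔ IsEquivariant x r := by
  constructor
  · intro h k c c' φ hφ
    have hst := motions_carriesStar c.2 hr hφ
    refine ⟨fun f => h _ _ rfl φ hφ (mapsTo_arcOver hiso hst f), fun a => ?_⟩
    have ha := P.mem_angles_iff hiso hst a
    by_cases h1 : a ∈ P.angles c.1
    · rw [ptVal, ptVal, dif_pos h1, dif_pos (ha.2 h1)]
      exact h _ _ rfl φ hφ ⟨hst.1, rfl, rfl⟩
    · rw [ptVal, ptVal, dif_neg h1, dif_neg fun h2 => h1 (ha.1 h2)]
  · intro h y z hd φ hφ hyz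
    obtain ⟨-, h1, h2⟩ := hyz
    by_cases hy : y.src = y.tgt
    · have hz : z.src = z.tgt := by rw [h1, h2, hy]
      rw [apply_of_eq x y hy, apply_of_eq x z hz, h1]
      have := (h y.dim ⟨y.base, y.base_mem⟩ ⟨z.base, hd ▸ z.base_mem⟩ φ hφ).2 y.src
      rw [this]
      congr!
    · have hz : z.src ≠ z.tgt := by
        rw [h1, h2]
        exact fun h' => hy (add_left_cancel h')
      rw [apply_of_ne x y hy, apply_of_ne x z hz, h1, ← AngleLag.shift_right]
      have := (h y.dim ⟨y.base, y.base_mem⟩ ⟨z.base, hd ▸ z.base_mem⟩ φ hφ).1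
        (AngleLag.right y.src)
      rw [this]
      congr!

theorem mem_PE_iff (hiso : T.TrivialCellIsotropy) {x : RotCell P → ℤ} {n : ℤ} :
    x ∈ PE P n ↔ (∀ y, x y ≠ 0 → (y.totalDim : ℤ) = n) ∧ ∃ r : ℝ, 0 < r ∧ IsEquivariant x r := by
  change (_ ∧ _) ↔ _
  refine and_congr_right fun _ => exists_congr fun r => and_congr_right fun hr => ?_
  exact isEquivariant_iff hiso hr.le

theorem IsEquivariant.boundary (hT : T.EFLC) (o : T.EdgeOrientation) {x : RotCell P → ℤ} {r : ℝ}
    (hr : 0 ≤ r) (h : IsEquivariant x r) :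
    ∃ R, r ≤ R ∧ IsEquivariant (boundary o P x) R := by
  obtain ⟨D, hD, hcell⟩ := hT.exists_tile_dist_le o
  refine ⟨r + D, by linarith, fun k c c' φ hφ => ⟨fun f => ?_, fun a => ?_⟩⟩
  · rw [arcVal_boundary, arcVal_boundary]
    -- The motion turns the cut, so slices of `x` at two different cuts are compared; hence the form
    -- of this lemma with two chains.
    exact o.boundary_eq_of_motions hr hD (hcell k)
      (fun e e' he => (h (k + 1) e e' φ he).1 f) le_rfl hφ
  · rw [ptVal_boundary, ptVal_boundary]
    have h1 := h k c c' φ (T.motions_mono (by linarith) hφ)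
    have h2 := h1.1 (AngleLag.left a)
    have h3 := h1.1 (AngleLag.right a)
    rw [AngleLag.shift_left] at h2
    rw [AngleLag.shift_right] at h3
    simp only [Pi.add_apply, Pi.mul_apply, Pi.sub_apply, h2, h3]
    congr 1
    exact o.boundary_eq_of_motions hr hD (hcell k)
      (fun e e' he => (h (k + 1) e e' φ he).2 a) le_rfl hφ

/-! ### The filtered complex -/

theorem dim_le_two (y : RotCell P) : y.dim ≤ 2 := by
  by_contra h
  obtain ⟨m, hm⟩ := Nat.exists_eq_add_of_le (not_le.1 h)
  have hb := y.base_mem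
  rw [hm, show (2 : ℕ).succ + m = m + 3 by omega] at hb
  exact hb.elim

theorem totalDim_of_eq {y : RotCell P} (h : y.src = y.tgt) : y.totalDim = y.dim := by
  rw [totalDim, if_pos h, add_zero]

theorem totalDim_of_ne {y : RotCell P} (h : y.src ≠ y.tgt) : y.totalDim = y.dim + 1 := by
  rw [totalDim, if_neg h]

theorem dim_le_totalDim (y : RotCell P) : y.dim ≤ y.totalDim ∧ y.totalDim ≤ y.dim + 1 := by
  by_cases h : y.src = y.tgt
  · rw [totalDim_of_eq h]
    omega
  · rw [totalDim_of_ne h]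
    omega

theorem dim_of_inc_ne_zero {o : T.EdgeOrientation} {y z : RotCell P} (h : inc o y z ≠ 0) :
    y.totalDim = z.totalDim + 1 ∧ z.dim ≤ y.dim := by
  by_cases h1 : y.dim = z.dim + 1 ∧ (y.src = y.tgt ↔ z.src = z.tgt) ∧ z.fibre ⊆ y.fibre
  · refine ⟨?_, by omega⟩
    by_cases hy : y.src = y.tgt
    · rw [totalDim_of_eq hy, totalDim_of_eq (h1.2.1.1 hy), h1.1]
    · rw [totalDim_of_ne hy, totalDim_of_ne fun hz => hy (h1.2.1.2 hz), h1.1]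
  · by_cases h2 : y.base = z.base ∧ y.src ≠ y.tgt ∧ z.src = z.tgt
    · have hd : y.dim = z.dim := cell_disjoint y.base_mem (h2.1 ▸ z.base_mem)
      rw [totalDim_of_ne h2.2.1, totalDim_of_eq h2.2.2, hd]
      exact ⟨rfl, le_rfl⟩
    · rw [inc, if_neg h1, if_neg h2] at h
      exact (h rfl).elim

theorem exists_of_boundary_ne_zero {o : T.EdgeOrientation} {x : RotCell P → ℤ} {z : RotCell P}
    (h : boundary o P x z ≠ 0) : ∃ y, x y ≠ 0 ∧ y.totalDim = z.totalDim + 1 ∧ z.dim ≤ y.dim := by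
  obtain ⟨y, -, hy⟩ := Finset.exists_ne_zero_of_sum_ne_zero h
  exact ⟨y, right_ne_zero_of_mul hy, dim_of_inc_ne_zero (left_ne_zero_of_mul hy)⟩

theorem boundary_mem_PE (hT : T.EFLC) (hiso : T.TrivialCellIsotropy) (o : T.EdgeOrientation)
    {n : ℤ} {x : RotCell P → ℤ} (hx : x ∈ PE P n) : boundary o P x ∈ PE P (n - 1) := by
  obtain ⟨h1, r, hr, h2⟩ := (mem_PE_iff hiso).1 hx
  obtain ⟨R, hR, h3⟩ := h2.boundary hT o hr.le
  refine (mem_PE_iff hiso).2 ⟨fun z hz => ?_, R, by linarith, h3⟩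
  obtain ⟨y, hy, hd, -⟩ := exists_of_boundary_ne_zero hz
  have := h1 y hy
  rw [hd] at this
  push_cast at this
  linarith

theorem boundary_mem_skeleton (o : T.EdgeOrientation) {p : ℤ} {x : RotCell P → ℤ}
    (hx : x ∈ skeleton P p) : boundary o P x ∈ skeleton P p := by
  intro z hz
  obtain ⟨y, hy, -, hd⟩ := exists_of_boundary_ne_zero hz
  have := hx y hy
  have : (z.dim : ℤ) ≤ y.dim := by exact_mod_cast hd
  linarith

theorem skeleton_mono {p p' : ℤ} (h : p ≤ p') : skeleton P p ≤ skeleton P p' :=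
  fun _ hx y hy => (hx y hy).trans h

theorem mem_skeleton_two (x : RotCell P → ℤ) {p : ℤ} (hp : 2 ≤ p) : x ∈ skeleton P p := by
  intro y _
  have := dim_le_two y
  omega

theorem eq_zero_of_mem_skeleton {x : RotCell P → ℤ} {p : ℤ} (hp : p < 0)
    (hx : x ∈ skeleton P p) : x = 0 := by
  funext y
  by_contra h
  have := hx y h
  omega

theorem arcVal_eq_zero_of_mem_skeleton {x : RotCell P → ℤ} {p : ℤ} (hx : x ∈ skeleton P p)
    {k : ℕ} (hk : p < k) (f : AngleLag) : arcVal x f k = 0 := by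
  funext c
  by_contra h
  have : (k : ℤ) ≤ p := hx _ h
  omega

theorem ptVal_eq_zero_of_mem_skeleton {x : RotCell P → ℤ} {p : ℤ} (hx : x ∈ skeleton P p)
    {k : ℕ} (hk : p < k) (a : Real.Angle) : ptVal x a k = 0 := by
  funext c
  rw [ptVal]
  split_ifs with ha
  · by_contra h
    have : (k : ℤ) ≤ p := hx _ h
    omega
  · rfl

theorem ptVal_eq_zero_of_mem_PE {x : RotCell P → ℤ} {n : ℤ} (hx : x ∈ PE P n)
    {k : ℕ} (hk : (k : ℤ) ≠ n) (a : Real.Angle) : ptVal x a k = 0 := by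
  funext c
  rw [ptVal]
  split_ifs with ha
  · by_contra h
    have h1 := hx.1 _ h
    rw [totalDim_of_eq (by rfl)] at h1
    exact hk h1
  · rfl

end RotCell

open RotCell

variable {o : T.EdgeOrientation} {P : T.Prototiles}

theorem rotComplex_isComplex (hT : T.EFLC) (hiso : T.TrivialCellIsotropy)
    (o : T.EdgeOrientation) (P : T.Prototiles) : (rotComplex o P).IsComplex where
  d_deg _ _ hx := boundary_mem_PE hT hiso o hx
  d_d _ x _ := RotCell.boundary_boundary o x
  fil_mono _ _ h := skeleton_mono h
  d_fil _ _ _ hx := boundary_mem_skeleton o hx.1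

theorem mem_Z_iff {r p q : ℤ} {x : RotCell P → ℤ} :
    x ∈ (rotComplex o P).Z r p q ↔
      (x ∈ skeleton P p ∧ x ∈ PE P (p + q)) ∧ boundary o P x ∈ skeleton P (p - r) :=
  Iff.rfl

/-- The terms of the spectral sequence vanish outside `0 ≤ p ≤ 2`, `0 ≤ q ≤ 1`. -/
theorem Z_le_B {r p q : ℤ} (h : ¬ (0 ≤ p ∧ p ≤ 2 ∧ 0 ≤ q ∧ q ≤ 1)) {x : RotCell P → ℤ}
    (hx : x ∈ (rotComplex o P).Z r p q) : x ∈ (rotComplex o P).B r p q := by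
  obtain ⟨⟨hs, hd⟩, hb⟩ := mem_Z_iff.1 hx
  -- In these cases no cell qualifies, since the total dimension exceeds that of the base by at most
  -- one.
  by_cases h0 : p < 0 ∨ 2 ≤ q
  · have : x = 0 := by
      funext y
      by_contra hy
      have h1 := hs y hy
      have h2 := hd.1 y hy
      have h3 := dim_le_totalDim y
      omega
    rw [this]
    exact zero_mem _
  -- Here `p ≥ 3` or `q < 0`, and either one forces the chain to lie over the `(p-1)`-skeleton
  -- already.
  · refine AddSubgroup.mem_sup_left (mem_Z_iff.2 ⟨⟨fun y hy => ?_, ?_⟩, ?_⟩)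
    · have h1 := hs y hy
      have h2 := hd.1 y hy
      have h3 := dim_le_totalDim y
      have h4 := dim_le_two y
      omega
    · rwa [show p - 1 + (q + 1) = p + q by ring]
    · rwa [show p - 1 - (r - 1) = p - r by ring]

/-- For `r ≥ 2` source and target both meet the strip only for `(r, p, q) = (2, 2, 0)`. -/
theorem diff_eq_zero (hK : (rotComplex o P).IsComplex) (r p q p' q' : ℤ) (hp : p' = p - r)
    (hq : q' = q + r - 1) (hr : 2 ≤ r) (hne : ¬ (r = 2 ∧ p = 2 ∧ q = 0)) :
    FilteredData.diff hK r p q p' q' hp hq = 0 := by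
  ext x
  change FilteredData.diff hK r p q p' q' hp hq (QuotientAddGroup.mk x) = 0
  by_cases h : 0 ≤ p ∧ p ≤ 2 ∧ 0 ≤ q ∧ q ≤ 1
  · refine (QuotientAddGroup.eq_zero_iff _).2 ?_
    exact Z_le_B (by omega) (hK.d_mem_Z hp hq x.2)
  · have : (QuotientAddGroup.mk x : (rotComplex o P).E r p q) = 0 :=
      (QuotientAddGroup.eq_zero_iff _).2 (Z_le_B h x.2)
    rw [this, map_zero]

theorem boundary_mem_ePE (hT : T.EFLC) (o : T.EdgeOrientation) {k : ℕ}
    {σ : T.cell (k + 1) → ℤ} (hσ : σ ∈ T.ePE (k + 1)) : o.boundary k σ ∈ T.ePE k := by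
  obtain ⟨r, hr, hσ⟩ := hσ
  obtain ⟨D, hD, hcell⟩ := hT.exists_tile_dist_le o
  refine ⟨r + D, by linarith, ?_⟩
  rintro c c' ⟨φ, hφ⟩
  exact o.boundary_eq_of_motions hr.le hD (hcell k) (fun e e' he => hσ e e' ⟨φ, he⟩) le_rfl hφ

end PlaneTiling

namespace PlaneTiling

variable {L : Type*} {T : PlaneTiling L}

open RotCell

variable {o : T.EdgeOrientation} {P : T.Prototiles}

/-! ### Chains which are constant along the fibre circles -/

open Classical in
/-- The chain `∑ σ(c) c × (fibre circle)`. -/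
noncomputable def circleChain (P : T.Prototiles) (k : ℕ) (σ : T.cell k → ℤ) : RotCell P → ℤ :=
  fun y => if h : y.dim = k ∧ y.src ≠ y.tgt then σ ⟨y.base, h.1 ▸ y.base_mem⟩ else 0

theorem arcVal_circleChain (k : ℕ) (σ : T.cell k → ℤ) (f : AngleLag) :
    arcVal (circleChain P k σ) f k = σ := by
  funext c
  exact dif_pos ⟨rfl, arcOver_ne c f⟩

theorem arcVal_circleChain_of_ne {j k : ℕ} (h : j ≠ k) (σ : T.cell k → ℤ) (f : AngleLag) :
    arcVal (circleChain P k σ) f j = 0 := by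
  funext c
  exact dif_neg fun h' => h h'.1

theorem ptVal_circleChain (j k : ℕ) (σ : T.cell k → ℤ) (a : Real.Angle) :
    ptVal (circleChain P k σ) a j = 0 := by
  funext c
  rw [ptVal]
  split_ifs with h
  · exact dif_neg fun h' => h'.2 rfl
  · rfl

theorem circleChain_add (k : ℕ) (σ τ : T.cell k → ℤ) :
    circleChain P k (σ + τ) = circleChain P k σ + circleChain P k τ := by
  funext y
  simp only [circleChain, Pi.add_apply]
  split_ifs <;> simp

theorem boundary_circleChain_succ (k : ℕ) (σ : T.cell (k + 1) → ℤ) :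
    boundary o P (circleChain P (k + 1) σ) = circleChain P k (o.boundary k σ) := by
  refine chain_ext (fun f j => ?_) fun a j => ?_
  · rw [arcVal_boundary]
    by_cases h : j = k
    · subst h
      rw [arcVal_circleChain, arcVal_circleChain]
    · rw [arcVal_circleChain_of_ne (by omega), arcVal_circleChain_of_ne h, map_zero]
  · rw [ptVal_boundary, ptVal_circleChain, ptVal_circleChain, map_zero, zero_add]
    by_cases h : j = k + 1
    · subst h
      rw [arcVal_circleChain, arcVal_circleChain, sub_self, mul_zero]
    · rw [arcVal_circleChain_of_ne h, arcVal_circleChain_of_ne h, sub_self, mul_zero]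

theorem boundary_circleChain_zero (σ : T.cell 0 → ℤ) :
    boundary o P (circleChain P 0 σ) = 0 := by
  refine chain_ext (fun f j => ?_) fun a j => ?_
  · rw [arcVal_boundary, arcVal_circleChain_of_ne (by omega), map_zero, arcVal_zero]
  · rw [ptVal_boundary, ptVal_circleChain, map_zero, zero_add, ptVal_zero]
    by_cases h : j = 0
    · subst h
      rw [arcVal_circleChain, arcVal_circleChain, sub_self, mul_zero]
    · rw [arcVal_circleChain_of_ne h, arcVal_circleChain_of_ne h, sub_self, mul_zero]

theorem circleChain_mem_skeleton (k : ℕ) (σ : T.cell k → ℤ) :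
    circleChain P k σ ∈ skeleton P k := by
  intro y hy
  have h : y.dim = k ∧ y.src ≠ y.tgt := by
    by_contra h
    exact hy (dif_neg h)
  rw [h.1]

theorem circleChain_mem_PE (hiso : T.TrivialCellIsotropy) {k : ℕ} {σ : T.cell k → ℤ}
    (hσ : σ ∈ T.ePE k) : circleChain P k σ ∈ PE P (k + 1) := by
  obtain ⟨r, hr, hσ⟩ := hσ
  refine (mem_PE_iff hiso).2 ⟨fun y hy => ?_, r, hr, fun j c c' φ hφ => ⟨fun f => ?_, fun a => ?_⟩⟩
  · have h : y.dim = k ∧ y.src ≠ y.tgt := by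
      by_contra h
      exact hy (dif_neg h)
    rw [totalDim_of_ne h.2, h.1]
    push_cast
    rfl
  · by_cases h : j = k
    · subst h
      rw [arcVal_circleChain, arcVal_circleChain]
      exact hσ c c' ⟨φ, hφ⟩
    · rw [arcVal_circleChain_of_ne h, arcVal_circleChain_of_ne h]
      rfl
  · rw [ptVal_circleChain, ptVal_circleChain]
    rfl

theorem arcVal_mem_ePE (hiso : T.TrivialCellIsotropy) {x : RotCell P → ℤ} {n : ℤ}
    (hx : x ∈ PE P n) {k : ℕ} (hconst : ∀ f f', arcVal x f k = arcVal x f' k) (f : AngleLag) :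
    arcVal x f k ∈ T.ePE k := by
  obtain ⟨-, r, hr, h⟩ := (mem_PE_iff hiso).1 hx
  refine ⟨r, hr, ?_⟩
  rintro c c' ⟨φ, hφ⟩
  rw [(h k c c' φ hφ).1 f, hconst (f.shift φ.rot) f]

/-- Under these hypotheses the formula for point slices says that the arc slices have no jump at any
angle. -/
theorem arcVal_const {x : RotCell P → ℤ} {k : ℕ} (h1 : ∀ a, ptVal (boundary o P x) a k = 0)
    (h2 : ∀ a, ptVal x a (k + 1) = 0) (f f' : AngleLag) : arcVal x f k = arcVal x f' k := by
  funext c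
  refine arcVal_eq_of_left_eq_right x c (fun a _ => ?_) f f'
  have h := congrFun (h1 a) c
  rw [ptVal_boundary, h2, map_zero, zero_add] at h
  have h3 : (-1 : ℤ) ^ k * (arcVal x (AngleLag.left a) k c - arcVal x (AngleLag.right a) k c) = 0 :=
    h
  rcases mul_eq_zero.1 h3 with h4 | h4
  · exact absurd h4 (pow_ne_zero k (by norm_num))
  · exact sub_eq_zero.1 h4

/-! ### The term `E²_{0,1}` -/

theorem circleChain_mem_Z (hiso : T.TrivialCellIsotropy) {σ : T.cell 0 → ℤ} (hσ : σ ∈ T.ePE 0) :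
    circleChain P 0 σ ∈ (rotComplex o P).Z 2 0 1 := by
  refine mem_Z_iff.2 ⟨⟨circleChain_mem_skeleton 0 σ, circleChain_mem_PE hiso hσ⟩, ?_⟩
  rw [boundary_circleChain_zero]
  exact zero_mem _

/-- Such a chain consists of arcs over vertices, and its boundary, lying over the `(-2)`-skeleton,
is zero. Hence there are no jumps. -/
theorem eq_circleChain_of_mem_Z (hiso : T.TrivialCellIsotropy) {x : RotCell P → ℤ}
    (hx : x ∈ (rotComplex o P).Z 2 0 1) (f : AngleLag) :
    arcVal x f 0 ∈ T.ePE 0 ∧ x = circleChain P 0 (arcVal x f 0) := by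
  obtain ⟨⟨hs, hd⟩, hb⟩ := mem_Z_iff.1 hx
  have hb0 : boundary o P x = 0 := eq_zero_of_mem_skeleton (by norm_num) hb
  have hpt : ∀ a k, ptVal x a k = 0 := fun a k => by
    by_cases hk : k = 0
    · exact ptVal_eq_zero_of_mem_PE hd (by subst hk; norm_num) a
    · exact ptVal_eq_zero_of_mem_skeleton hs (by omega) a
  have hconst : ∀ f f', arcVal x f 0 = arcVal x f' 0 :=
    arcVal_const (o := o) (fun a => by rw [hb0, ptVal_zero]) fun a => hpt a 1
  refine ⟨arcVal_mem_ePE hiso hd hconst f, chain_ext (fun f' k => ?_) fun a k => ?_⟩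
  · by_cases hk : k = 0
    · subst hk
      rw [arcVal_circleChain, hconst f' f]
    · rw [arcVal_circleChain_of_ne hk, arcVal_eq_zero_of_mem_skeleton hs (by omega)]
  · rw [hpt, ptVal_circleChain]

theorem arcVal_of_mem_Z_one (hiso : T.TrivialCellIsotropy) {z : RotCell P → ℤ}
    (hz : z ∈ (rotComplex o P).Z 1 1 1) (f : AngleLag) : arcVal z f 1 ∈ T.ePE 1 := by
  obtain ⟨⟨hs, hd⟩, hb⟩ := mem_Z_iff.1 hz
  refine arcVal_mem_ePE hiso hd (arcVal_const (o := o) (fun a => ?_) fun a => ?_) f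
  · exact ptVal_eq_zero_of_mem_skeleton hb (by norm_num) a
  · exact ptVal_eq_zero_of_mem_skeleton hs (by norm_num) a

theorem circleChain_mem_B_iff (hiso : T.TrivialCellIsotropy) (σ : T.cell 0 → ℤ) :
    circleChain P 0 σ ∈ (rotComplex o P).B 2 0 1 ↔ σ ∈ (T.ePE 1).map (o.boundary 0) := by
  constructor
  · intro h
    obtain ⟨y, hy, _, ⟨z, hz, rfl⟩, hyz⟩ := AddSubgroup.mem_sup.1 h
    -- This summand lies over the `(-1)`-skeleton, so only boundaries of chains in `Z¹_{1,1}`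
    -- matter.
    have hy0 : y = 0 := eq_zero_of_mem_skeleton (by norm_num) (mem_Z_iff.1 hy).1.1
    have hz' : z ∈ (rotComplex o P).Z 1 1 1 := hz
    refine ⟨_, arcVal_of_mem_Z_one hiso hz' (AngleLag.right 0), ?_⟩
    rw [hy0, zero_add] at hyz
    have h1 : boundary o P z = circleChain P 0 σ := hyz
    rw [← arcVal_boundary (P := P), h1, arcVal_circleChain]
  · rintro ⟨τ, hτ, rfl⟩
    refine AddSubgroup.mem_sup_right ⟨circleChain P 1 τ, ?_, boundary_circleChain_succ 0 τ⟩
    change circleChain P 1 τ ∈ (rotComplex o P).Z 1 1 1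
    refine mem_Z_iff.2 ⟨⟨circleChain_mem_skeleton 1 τ, circleChain_mem_PE hiso hτ⟩, ?_⟩
    rw [boundary_circleChain_succ]
    exact circleChain_mem_skeleton 0 _

/-- The isomorphism from the group of ePE `0`-chains to `Z²_{0,1}`. -/
noncomputable def circleEquiv (hiso : T.TrivialCellIsotropy) (o : T.EdgeOrientation)
    (P : T.Prototiles) : T.ePE 0 ≃+ (rotComplex o P).Z 2 0 1 where
  toFun σ := ⟨circleChain P 0 σ.1, circleChain_mem_Z hiso σ.2⟩
  invFun x := ⟨arcVal x.1 (AngleLag.right 0) 0, (eq_circleChain_of_mem_Z hiso x.2 _).1⟩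
  left_inv σ := Subtype.ext (arcVal_circleChain 0 σ.1 _)
  right_inv x := Subtype.ext (eq_circleChain_of_mem_Z hiso x.2 _).2.symm
  map_add' σ τ := Subtype.ext (circleChain_add 0 σ.1 τ.1)

/-- The isomorphism `H_0(T⁰) ≅ E²_{0,1}`. -/
noncomputable def homologyEquiv (hiso : T.TrivialCellIsotropy) (o : T.EdgeOrientation)
    (P : T.Prototiles) : o.H0 ≃+ (rotComplex o P).E 2 0 1 :=
  QuotientAddGroup.congr _ _ (circleEquiv hiso o P) (by
    ext x
    obtain ⟨σ, rfl⟩ := (circleEquiv hiso o P).surjective x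
    refine ((circleEquiv hiso o P).injective.mem_set_image (s := (((T.ePE 1).map
      (o.boundary 0)).addSubgroupOf (T.ePE 0) : Set (T.ePE 0)))).trans ?_
    exact (circleChain_mem_B_iff hiso σ.1).symm)

/-! ### The term `E²_{2,0}` -/

/-- The sum of the coefficients of a chain over the subdividing points over a cell. -/
noncomputable def ptSum (P : T.Prototiles) (k : ℕ) (c : T.cell k) : (RotCell P → ℤ) →+ ℤ where
  toFun x := ∑ a ∈ (finite_angles (P := P) c.2).toFinset, ptVal x a k c
  map_zero' := by simp [ptVal_zero]
  map_add' x y := by simp [ptVal_add, Finset.sum_add_distrib]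

theorem ptSum_apply (k : ℕ) (c : T.cell k) (x : RotCell P → ℤ) :
    ptSum P k c x = ∑ a ∈ (finite_angles (P := P) c.2).toFinset, ptVal x a k c := rfl

theorem sum_ptVal_eq_ptSum (x : RotCell P → ℤ) {j k : ℕ} (c : T.cell k) (d : T.cell j)
    (h : d.1 ⊆ c.1) :
    ∑ a ∈ (finite_angles (P := P) d.2).toFinset, ptVal x a k c = ptSum P k c x := by
  symm
  refine Finset.sum_subset (fun a ha => ?_) fun a _ ha => ?_
  · simp only [Set.Finite.mem_toFinset] at ha ⊢
    exact P.angles_anti h ha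
  · rw [Set.Finite.mem_toFinset] at ha
    rw [ptVal, dif_neg ha]

/-- At each angle the coefficients over the two tiles differ by the jump of the arc slice over the
edge, and the jumps around the fibre circle cancel. -/
theorem ptSum_left_eq_right {x : RotCell P → ℤ} (hx : boundary o P x ∈ skeleton P 0)
    (e : T.cell 1) :
    ptSum P 2 ⟨o.left e, o.left_mem e.2⟩ x = ptSum P 2 ⟨o.right e, o.right_mem e.2⟩ x := by
  have h : ∀ a, ptVal x a 2 ⟨o.left e, o.left_mem e.2⟩ - ptVal x a 2 ⟨o.right e, o.right_mem e.2⟩ =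
      arcVal x (AngleLag.left a) 1 e - arcVal x (AngleLag.right a) 1 e := fun a => by
    have h1 := congrFun (ptVal_boundary o x a 1) e
    rw [ptVal_eq_zero_of_mem_skeleton hx (by norm_num), Pi.add_apply, o.boundary_one] at h1
    have h2 : ((-1) ^ 1 * (arcVal x (AngleLag.left a) 1 - arcVal x (AngleLag.right a) 1) :
        T.cell 1 → ℤ) e = -(arcVal x (AngleLag.left a) 1 e - arcVal x (AngleLag.right a) 1 e) := by simp
    rw [h2, Pi.zero_apply] at h1
    linarith
  rw [← sub_eq_zero, ← sum_ptVal_eq_ptSum x (k := 2) ⟨o.left e, o.left_mem e.2⟩ e (o.subset_left e.2),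
    ← sum_ptVal_eq_ptSum x (k := 2) ⟨o.right e, o.right_mem e.2⟩ e (o.subset_right e.2),
    ← Finset.sum_sub_distrib, Finset.sum_congr rfl fun a _ => h a, Finset.sum_sub_distrib,
    sum_arcVal_left_eq_right, sub_self]

theorem ptSum_eq (o : T.EdgeOrientation) {x : RotCell P → ℤ}
    (hx : boundary o P x ∈ skeleton P 0) (t t' : T.cell 2) : ptSum P 2 t x = ptSum P 2 t' x := by
  classical
  have h := o.eq_of_left_eq_right
    (fun t => if h : t ∈ T.tile then ptSum P 2 ⟨t, h⟩ x else 0) (fun e he => ?_) t.2 t'.2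
  · rw [dif_pos (show t.1 ∈ T.tile from t.2), dif_pos (show t'.1 ∈ T.tile from t'.2)] at h
    exact h
  · rw [dif_pos (o.left_mem he), dif_pos (o.right_mem he)]
    exact ptSum_left_eq_right hx ⟨e, he⟩

/-- One summand lies over the `1`-skeleton; over a tile the other is a family of jumps around the
circle. -/
theorem ptSum_eq_zero_of_mem_B (t : T.cell 2) {x : RotCell P → ℤ}
    (hx : x ∈ (rotComplex o P).B 2 2 0) : ptSum P 2 t x = 0 := by
  obtain ⟨y, hy, _, ⟨z, -, rfl⟩, rfl⟩ := AddSubgroup.mem_sup.1 hx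
  have h1 : ptSum P 2 t y = 0 := Finset.sum_eq_zero fun a _ => by
    rw [ptVal_eq_zero_of_mem_skeleton (mem_Z_iff.1 hy).1.1 (by norm_num)]
    rfl
  have h2 : ptSum P 2 t (boundary o P z) = 0 := by
    have h3 : ∀ a, ptVal (boundary o P z) a 2 t =
        arcVal z (AngleLag.left a) 2 t - arcVal z (AngleLag.right a) 2 t := fun a => by
      have h4 : ptVal z a 3 = 0 := funext fun c => c.2.elim
      rw [ptVal_boundary, h4, map_zero, zero_add]
      simp
    rw [ptSum_apply, Finset.sum_congr rfl fun a _ => h3 a, Finset.sum_sub_distrib,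
      sum_arcVal_left_eq_right, sub_self]
  rw [map_add, h1, zero_add]
  exact h2

theorem Prototiles.mem_angles_tile (P : T.Prototiles) {t : Set ℂ} (ht : t ∈ T.tile)
    {a : Real.Angle} :
    a ∈ P.angles t ↔ a = P.tau t ∨ a = P.tau t + (Real.pi : Real.Angle) := by
  constructor
  · rintro ⟨t', ht', htt', h⟩
    obtain ⟨x, hx⟩ := (T.tile_connected t ht).1
    rwa [tile_eq_of_mem_interior ht ht' hx (interior_mono htt' hx)]
  · exact fun h => ⟨t, ht, subset_rfl, h⟩

theorem ptSum_two (t : T.cell 2) (x : RotCell P → ℤ) :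
    ptSum P 2 t x = ptVal x (P.tau t) 2 t + ptVal x (P.tau t + (Real.pi : Real.Angle)) 2 t := by
  classical
  have : (finite_angles (P := P) t.2).toFinset = {P.tau t, P.tau t + (Real.pi : Real.Angle)} := by
    ext a
    rw [Set.Finite.mem_toFinset, P.mem_angles_tile t.2]
    simp
  rw [ptSum_apply, this, Finset.sum_pair (P.tau_ne t)]

open Classical in
/-- The chain of half circles over the tiles, from `τ_t` to `τ_t + π`, with the coefficients of
`x` at `τ_t + π`. -/
noncomputable def halfChain (x : RotCell P → ℤ) : RotCell P → ℤ := fun y =>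
  if h : y.dim = 2 ∧ y.src ≠ y.tgt ∧ y.src = P.tau y.base then
    ptVal x (P.tau y.base + (Real.pi : Real.Angle)) 2 ⟨y.base, h.1 ▸ y.base_mem⟩
  else 0

theorem halfChain_mem_PE (hiso : T.TrivialCellIsotropy) {x : RotCell P → ℤ} {n : ℤ}
    (hx : x ∈ PE P n) : halfChain x ∈ PE P 3 := by
  obtain ⟨-, r, hr, h⟩ := (mem_PE_iff hiso).1 hx
  refine ⟨fun y hy => ?_, r, hr, fun y z hd φ hφ hyz => ?_⟩
  · have h : y.dim = 2 ∧ y.src ≠ y.tgt ∧ y.src = P.tau y.base := by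
      by_contra h
      exact hy (dif_neg h)
    rw [totalDim_of_ne h.2.1, h.1]
    norm_num
  · obtain ⟨-, hs, ht⟩ := hyz
    simp only [halfChain]
    by_cases h2 : y.dim = 2
    · have hyb : y.base ∈ T.cell 2 := h2 ▸ y.base_mem
      have hzb : z.base ∈ T.cell 2 := by
        rw [← h2, hd]
        exact z.base_mem
      have htau := P.tau_of_carriesStar hiso hyb hzb (motions_carriesStar hyb hr.le hφ)
      have hcond : (y.dim = 2 ∧ y.src ≠ y.tgt ∧ y.src = P.tau y.base) ↔
          (z.dim = 2 ∧ z.src ≠ z.tgt ∧ z.src = P.tau z.base) := by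
        rw [hd, hs, ht, htau]
        simp
      by_cases hc : y.dim = 2 ∧ y.src ≠ y.tgt ∧ y.src = P.tau y.base
      · rw [dif_pos hc, dif_pos (hcond.1 hc)]
        have := (h 2 ⟨y.base, hyb⟩ ⟨z.base, hzb⟩ φ hφ).2 (P.tau y.base + (Real.pi : Real.Angle))
        rwa [← add_assoc, ← htau] at this
      · rw [dif_neg hc, dif_neg fun h' => hc (hcond.2 h')]
    · rw [dif_neg fun h' => h2 h'.1, dif_neg fun h' => h2 (hd.trans h'.1)]

theorem arcVal_halfChain (x : RotCell P → ℤ) (f : AngleLag) (t : T.cell 2) :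
    arcVal (halfChain x) f 2 t = open Classical in if (arcOver P t f).src = P.tau t then
      ptVal x (P.tau t + (Real.pi : Real.Angle)) 2 t else 0 := by
  rw [arcVal, halfChain]
  split_ifs with h1 h2 h2
  · rfl
  · exact absurd h1.2.2 h2
  · exact absurd ⟨rfl, arcOver_ne t f, h2⟩ h1
  · rfl

theorem ptVal_boundary_halfChain {x : RotCell P → ℤ} {t : T.cell 2} (hx : ptSum P 2 t x = 0)
    (a : Real.Angle) : ptVal (boundary o P (halfChain x)) a 2 t = ptVal x a 2 t := by
  by_cases ha : a ∈ P.angles t.1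
  swap
  · rw [ptVal, ptVal, dif_neg ha, dif_neg ha]
  have h4 : ptVal (halfChain x) a 3 = 0 := funext fun c => c.2.elim
  have h5 : ptVal (boundary o P (halfChain x)) a 2 t =
      arcVal (halfChain x) (AngleLag.left a) 2 t - arcVal (halfChain x) (AngleLag.right a) 2 t := by
    rw [ptVal_boundary, h4, map_zero, zero_add]
    simp
  rw [h5, arcVal_halfChain, arcVal_halfChain]
  have hR : (arcOver P t (AngleLag.right a)).src = a :=
    (src_eq_iff (arcOver_ne _ _) ha).2 (arcOver_lt _ _)
  have hL : (arcOver P t (AngleLag.left a)).tgt = a :=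
    (tgt_eq_iff (arcOver_ne _ _) ha).2 (arcOver_lt _ _)
  have hne := arcOver_ne (P := P) t (AngleLag.left a)
  rw [hL] at hne
  have hmem := (P.mem_angles_tile t.2).1 (src_mem (arcOver P t (AngleLag.left a)))
  have hb : (arcOver P t (AngleLag.left a)).base = t.1 := rfl
  rw [hR]
  rw [ptSum_two] at hx
  -- The half circle starts at `τ_t`, where its boundary contributes minus the coefficient of `x` at
  -- `τ_t + π`; as the total is zero, this is the coefficient at `τ_t`.
  rcases (P.mem_angles_tile t.2).1 ha with rfl | rfl
  · rw [if_neg hne, if_pos rfl]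
    linarith
  · rw [if_pos (hmem.resolve_right hne), if_neg (P.tau_ne t).symm, sub_zero]

/-- Subtracting the boundary of `halfChain x` removes all coefficients over the tiles and leaves an
element of `Z¹_{1,1}`. -/
theorem mem_B_of_ptSum_eq_zero (hT : T.EFLC) (hiso : T.TrivialCellIsotropy) {x : RotCell P → ℤ}
    (hx : x ∈ (rotComplex o P).Z 2 2 0) (h0 : ∀ t, ptSum P 2 t x = 0) :
    x ∈ (rotComplex o P).B 2 2 0 := by
  obtain ⟨⟨hs, hd⟩, hb⟩ := mem_Z_iff.1 hx
  have hy := halfChain_mem_PE hiso hd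
  have hdy : boundary o P (halfChain x) ∈ PE P 2 := boundary_mem_PE hT hiso o hy
  have hsub : x - boundary o P (halfChain x) ∈ PE P 2 := sub_mem hd hdy
  refine AddSubgroup.mem_sup.2 ⟨x - boundary o P (halfChain x), ?_, boundary o P (halfChain x),
    ⟨halfChain x, ?_, rfl⟩, sub_add_cancel _ _⟩
  · refine mem_Z_iff.2 ⟨⟨fun w hw => ?_, hsub⟩, ?_⟩
    · by_contra hlt
      have hw2 : w.dim = 2 := by
        have := dim_le_two w
        omega
      by_cases hww : w.src = w.tgt
      · refine hw ?_
        have hwb : w.base ∈ T.cell 2 := hw2 ▸ w.base_mem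
        have h1 : w = pointOver ⟨w.base, hwb⟩ w.src w.src_mem :=
          RotCell.ext hw2 rfl rfl hww.symm
        have h2 := ptVal_boundary_halfChain (o := o) (h0 ⟨w.base, hwb⟩) w.src
        rw [ptVal, ptVal, dif_pos w.src_mem, dif_pos w.src_mem, ← h1] at h2
        rw [Pi.sub_apply, h2, sub_self]
      · have h1 := hsub.1 w hw
        rw [totalDim_of_ne hww, hw2] at h1
        norm_num at h1
    · rw [map_sub, RotCell.boundary_boundary, sub_zero]
      exact hb
  · exact mem_Z_iff.2 ⟨⟨mem_skeleton_two _ (by norm_num), hy⟩, mem_skeleton_two _ (by norm_num)⟩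

end PlaneTiling

/-! ### The winding chain and its boundary -/

namespace PlaneTiling

variable {L : Type*} {T : PlaneTiling L}

open RotCell

namespace EdgeRotations

variable {o : T.EdgeOrientation} {P : T.Prototiles} (ρ : EdgeRotations o P)

/-- The multiplicity with which a path from `τ_r` to `τ_l` of length `ρ_e` passes the base
point of `f`. -/
noncomputable def wind (e : Set ℂ) (f : AngleLag) : ℤ :=
  round ((ρ.rho e + f (P.tau (o.left e)) - f (P.tau (o.right e))) / (2 * Real.pi))

/-- Modulo `2π`, `ρ_e` is `τ_l - τ_r` and the difference of lifts is `τ_r - τ_l`. The quotient is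
thus an integer and the rounding changes nothing. -/
theorem two_pi_mul_wind {e : Set ℂ} (he : e ∈ T.edge) (f : AngleLag) :
    2 * Real.pi * (ρ.wind e f : ℝ) =
      ρ.rho e + (f (P.tau (o.left e)) - f (P.tau (o.right e))) := by
  have h : ((ρ.rho e + f (P.tau (o.left e)) - f (P.tau (o.right e)) : ℝ) : Real.Angle) =
      ((0 : ℝ) : Real.Angle) := by
    rw [Real.Angle.coe_sub, Real.Angle.coe_add, f.coe_toFun, f.coe_toFun,
      ρ.rho_mod e he _ (o.left_mem he) _ (o.right_mem he) (o.isLeft_left he) (o.isRight_right he),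
      Real.Angle.coe_zero]
    abel
  obtain ⟨k, hk⟩ := Real.Angle.angle_eq_iff_two_pi_dvd_sub.1 h
  rw [sub_zero] at hk
  have h2 := Real.two_pi_pos.ne'
  rw [wind, hk, mul_div_cancel_left₀ _ h2, round_intCast, ← hk]
  ring

theorem wind_eq {e e' : Set ℂ} (he : e ∈ T.edge) (he' : e' ∈ T.edge) {f f' : AngleLag}
    (h : ρ.rho e + (f (P.tau (o.left e)) - f (P.tau (o.right e))) =
      ρ.rho e' + (f' (P.tau (o.left e')) - f' (P.tau (o.right e')))) :
    ρ.wind e f = ρ.wind e' f' := by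
  rw [← ρ.two_pi_mul_wind he, ← ρ.two_pi_mul_wind he'] at h
  exact_mod_cast mul_left_cancel₀ Real.two_pi_pos.ne' h

/-- Both tile angles subdivide the fibre over the edge. Moving the cut within one arc therefore
shifts both lifts equally, and the multiplicity depends on the arc alone. -/
theorem wind_right_src (e : T.cell 1) (f : AngleLag) :
    ρ.wind e (AngleLag.right (arcOver P e f).src) = ρ.wind e f := by
  refine ρ.wind_eq e.2 e.2 ?_
  have hl := (le_and_le (arcOver_lt e f)
    (P.tau_mem_angles (o.left_mem e.2) (o.subset_left e.2))).1
  have hr := (le_and_le (arcOver_lt e f)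
    (P.tau_mem_angles (o.right_mem e.2) (o.subset_right e.2))).1
  rw [f.sub_eq_of_le hl, f.sub_eq_of_le hr]
  ring

/-- Passing the cut across `a` changes only the lift of `a`, by `2π`: the path starts at `τ_r` and
ends at `τ_l`. -/
theorem wind_left_sub_right {e : Set ℂ} (he : e ∈ T.edge) (a : Real.Angle) :
    ρ.wind e (AngleLag.left a) - ρ.wind e (AngleLag.right a) =
      (open Classical in if a = P.tau (o.left e) then 1 else 0) -
        (open Classical in if a = P.tau (o.right e) then 1 else 0) := by
  classical
  have h1 : ∀ s, AngleLag.left a s = AngleLag.right a s +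
      2 * Real.pi * (if a = s then 1 else 0) := fun s => by
    split_ifs with h
    · rw [← h, AngleLag.left_self, AngleLag.right_self]
      ring
    · rw [AngleLag.left_eq_right fun h' => h h'.symm]
      ring
  have h2 := ρ.two_pi_mul_wind he (AngleLag.left a)
  have h3 := ρ.two_pi_mul_wind he (AngleLag.right a)
  rw [h1, h1] at h2
  have h4 : ((ρ.wind e (AngleLag.left a) - ρ.wind e (AngleLag.right a) : ℤ) : ℝ) =
      ((if a = P.tau (o.left e) then 1 else 0) - (if a = P.tau (o.right e) then 1 else 0) : ℤ) := by
    push_cast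
    refine mul_left_cancel₀ Real.two_pi_pos.ne' ?_
    rw [mul_sub, h2, h3]
    ring
  exact_mod_cast h4

open Classical in
/-- The `2`-chain which lies over the tiles `t` at `τ_t`, and over the edges `e` on paths of
length `ρ_e`. -/
noncomputable def windChain : RotCell P → ℤ := fun y =>
  if y.src = y.tgt then
    if y.dim = 2 ∧ y.src = P.tau y.base then 1 else 0
  else if y.dim = 1 then ρ.wind y.base (AngleLag.right y.src) else 0

theorem arcVal_windChain (f : AngleLag) :
    arcVal ρ.windChain f 1 = fun e : T.cell 1 => ρ.wind e.1 f := by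
  funext e
  rw [arcVal, windChain, if_neg (arcOver_ne e f)]
  exact (if_pos rfl).trans (ρ.wind_right_src e f)

theorem ptVal_windChain (a : Real.Angle) (t : T.cell 2) :
    ptVal ρ.windChain a 2 t = open Classical in if a = P.tau t then 1 else 0 := by
  rw [ptVal]
  split_ifs with h1 h2 h2
  · exact (if_pos rfl).trans (if_pos ⟨rfl, h2⟩)
  · exact (if_pos rfl).trans (if_neg fun h => h2 h.2)
  · exact absurd (h2 ▸ P.tau_mem_angles t.2 subset_rfl) h1
  · rfl

/-- All coefficients are determined by the star of the base cell and its position, so any positive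
radius would do. -/
theorem windChain_mem_PE (hiso : T.TrivialCellIsotropy) : ρ.windChain ∈ PE P 2 := by
  refine ⟨fun y hy => ?_, 1, one_pos, fun y z hd φ hφ hyz => ?_⟩
  · rw [windChain] at hy
    by_cases h : y.src = y.tgt
    · rw [if_pos h] at hy
      have h2 : y.dim = 2 ∧ y.src = P.tau y.base := by
        by_contra h2
        exact hy (if_neg h2)
      rw [totalDim_of_eq h, h2.1]
      rfl
    · rw [if_neg h] at hy
      have h2 : y.dim = 1 := by
        by_contra h2
        exact hy (if_neg h2)
      rw [totalDim_of_ne h, h2]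
      rfl
  · have hst := motions_carriesStar y.base_mem zero_le_one hφ
    obtain ⟨hb, hs, ht⟩ := hyz
    have hiff : z.src = z.tgt ↔ y.src = y.tgt := by rw [hs, ht, add_right_inj]
    simp only [windChain]
    by_cases h1 : y.src = y.tgt
    · rw [if_pos h1, if_pos (hiff.2 h1)]
      classical
      refine if_congr ?_ rfl rfl
      rw [hd]
      refine and_congr_right fun h2 => ?_
      have hzb : z.base ∈ T.cell 2 := h2 ▸ z.base_mem
      have hyb : y.base ∈ T.cell 2 := by
        rw [← h2, ← hd]
        exact y.base_mem
      rw [P.tau_of_carriesStar hiso hyb hzb hst, hs, add_right_inj]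
    · rw [if_neg h1, if_neg fun h => h1 (hiff.1 h)]
      by_cases h2 : y.dim = 1
      swap
      · rw [if_neg h2, if_neg fun h => h2 (hd.trans h)]
      have h3 : z.dim = 1 := hd ▸ h2
      rw [if_pos h2, if_pos h3]
      have hyb : y.base ∈ T.edge := by
        have := y.base_mem
        rwa [h2] at this
      have hzb : z.base ∈ T.edge := by
        have := z.base_mem
        rwa [h3] at this
      have hlm := hst.tile_mem (o.left_mem hyb) (o.subset_left hyb)
      have hrm := hst.tile_mem (o.right_mem hyb) (o.subset_right hyb)
      have hl : φ.act '' o.left y.base = o.left z.base :=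
        (o.isLeft_iff_eq hzb hlm).1 ((o.isLeft_iff hyb hzb hst).2 (o.isLeft_left hyb))
      have hr : φ.act '' o.right y.base = o.right z.base :=
        (o.isRight_iff_eq hzb hrm).1 ((o.isRight_iff hyb hzb hst).2 (o.isRight_right hyb))
      have htl := P.tau_of_carriesStar hiso (o.left_mem hyb) hlm (hst.coface (o.subset_left hyb))
      have htr := P.tau_of_carriesStar hiso (o.right_mem hyb) hrm
        (hst.coface (o.subset_right hyb))
      refine ρ.wind_eq hyb hzb ?_
      rw [ρ.rho_eq _ hyb _ hzb ⟨φ, hst⟩, ← hl, ← hr, htl, htr, hs, ← AngleLag.shift_right,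
        AngleLag.shift_apply, AngleLag.shift_apply]

/-- Over an edge the boundary of the points `τ_t` is the point `τ_l` minus the point `τ_r`. The ends
of the path over the edge cancel it, with the sign `(-1)^1` of the product boundary. -/
theorem boundary_windChain_mem_skeleton (hT : T.EFLC) (hiso : T.TrivialCellIsotropy) :
    boundary o P ρ.windChain ∈ skeleton P 0 := by
  have hd := boundary_mem_PE hT hiso o (ρ.windChain_mem_PE hiso)
  intro w hw
  have h1 := hd.1 w hw
  by_cases hww : w.src = w.tgt
  · exfalso
    rw [totalDim_of_eq hww] at h1
    have hw1 : w.dim = 1 := by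
      norm_num at h1
      exact h1
    have hwb : w.base ∈ T.edge := by
      have := w.base_mem
      rwa [hw1] at this
    have h2 : w = pointOver (k := 1) ⟨w.base, hwb⟩ w.src w.src_mem :=
      RotCell.ext hw1 rfl rfl hww.symm
    have h3 := congrFun (ptVal_boundary o ρ.windChain w.src 1) ⟨w.base, hwb⟩
    rw [ptVal, dif_pos w.src_mem, ← h2, Pi.add_apply, o.boundary_one, ptVal_windChain,
      ptVal_windChain, arcVal_windChain, arcVal_windChain] at h3
    have h4 := ρ.wind_left_sub_right hwb w.src
    refine hw (h3.trans ?_)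
    simp only [pow_one, Pi.mul_apply, Pi.sub_apply, Pi.neg_apply, Pi.one_apply, h4]
    ring
  · rw [totalDim_of_ne hww] at h1
    push_cast at h1
    linarith

theorem windChain_mem_Z (hT : T.EFLC) (hiso : T.TrivialCellIsotropy) :
    ρ.windChain ∈ (rotComplex o P).Z 2 2 0 :=
  mem_Z_iff.2 ⟨⟨mem_skeleton_two _ le_rfl, ρ.windChain_mem_PE hiso⟩,
    ρ.boundary_windChain_mem_skeleton hT hiso⟩

theorem ptSum_windChain (t : T.cell 2) : ptSum P 2 t ρ.windChain = 1 := by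
  rw [ptSum_two, ptVal_windChain, ptVal_windChain, if_pos rfl, if_neg (P.tau_ne t).symm, add_zero]

/-- The boundary of the winding chain goes `-turning v / 2π` times round the circle over `v`. -/
theorem turning_eq (f : AngleLag) (v : T.cell 0) :
    2 * Real.pi * ((-arcVal (boundary o P ρ.windChain) f 0 v : ℤ) : ℝ) = ρ.turning v := by
  classical
  rw [arcVal_boundary, arcVal_windChain, o.boundary_zero _ (fun e => ρ.wind e f) fun _ => rfl]
  have h0 := o.sum_inc_mul_left_sub_right (fun t => f (P.tau t)) v
  have h1 : ∀ e ∈ (T.finite_cofaces 1 v.2).toFinset,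
      (if v.1 = {o.tail e} then (1 : ℝ) else -1) * ρ.rho e =
      -(2 * Real.pi * ((o.inc 0 e v.1 * ρ.wind e f : ℤ) : ℝ)) +
        (o.inc 0 e v.1 : ℝ) * (f (P.tau (o.left e)) - f (P.tau (o.right e))) := by
    intro e he
    obtain ⟨he, hve⟩ := (mem_cofaces v e).1 he
    have h2 := ρ.two_pi_mul_wind he f
    -- A vertex on an edge is one of its ends. The incidence number is positive at the head while
    -- `ε` is positive at the tail, which accounts for the minus sign.
    have h3 : (o.inc 0 e v.1 : ℝ) = -(if v.1 = {o.tail e} then (1 : ℝ) else -1) := by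
      obtain ⟨w, hw, hvw⟩ := v.2
      have h4 : o.inc 0 e v.1 = (if v.1 = {o.head e} then 1 else 0) -
        (if v.1 = {o.tail e} then 1 else 0) := rfl
      rw [h4, hvw]
      simp only [Set.singleton_eq_singleton_iff]
      have hwe : w ∈ segment ℝ (o.tail e) (o.head e) := by
        rw [← (o.ends e he).2]
        exact hve (hvw ▸ rfl)
      by_cases ht : w = o.tail e
      · rw [if_pos ht, if_pos ht, if_neg (ht ▸ (o.ends e he).1)]
        norm_num
      · have hh : w = o.head e := by
          by_contra hh
          exact Set.disjoint_left.1 (edge_ends (o.segment_mem he)).2.2.2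
            (mem_openSegment_of_ne_left_right (Ne.symm ht) (Ne.symm hh) hwe) hw
        rw [if_neg ht, if_neg ht, if_pos hh]
        norm_num
    push_cast
    rw [h3]
    linear_combination -(if v.1 = {o.tail e} then (1 : ℝ) else -1) * h2
  rw [turning, Finset.sum_congr rfl h1, Finset.sum_add_distrib, h0, add_zero,
    Finset.sum_neg_distrib, ← Finset.mul_sum]
  push_cast
  ring

end EdgeRotations

end PlaneTiling

/-! ### Assembly of the theorem -/

theorem mainTheorem2 {L : Type*} (T : PlaneTiling L) (hT : T.EFLC)
    (hiso : T.TrivialCellIsotropy) (o : T.EdgeOrientation) (P : T.Prototiles)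
    (ρ : PlaneTiling.EdgeRotations o P) :
    -- the pattern-equivariant chains form a filtered complex, and so have a spectral sequence
    ∃ hK : (PlaneTiling.rotComplex o P).IsComplex,
      -- from the second page on, every differential except `E²_{2,0} → E²_{0,1}` vanishes
      (∀ (r p q p' q' : ℤ) (hp : p' = p - r) (hq : q' = q + r - 1), 2 ≤ r →
        ¬ (r = 2 ∧ p = 2 ∧ q = 0) → FilteredData.diff hK r p q p' q' hp hq = 0) ∧
      (T.ePE 1).map (o.boundary 0) ≤ T.ePE 0 ∧
      -- the canonical isomorphism `E²_{0,1} ≅ H_0(T⁰)`, `[∑ σ(v) ν_v] ↦ [σ]`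
      ∃ Φ : (PlaneTiling.rotComplex o P).E 2 0 1 ≃+ o.H0,
        (∀ σ : T.ePE 0, ∃ hσ : PlaneTiling.fibreChain P σ.1 ∈
            (PlaneTiling.rotComplex o P).Z 2 0 1,
          Φ (QuotientAddGroup.mk ⟨PlaneTiling.fibreChain P σ.1, hσ⟩) = QuotientAddGroup.mk σ) ∧
        -- the winding numbers are integers and form an ePE chain `ω`
        ∃ ω : T.ePE 0, (∀ v : T.cell 0, 2 * Real.pi * (ω.1 v : ℝ) = ρ.turning v) ∧
          -- a generator `Γ` of `E²_{2,0} ≅ ℤ` is sent to the class of `ω`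
          ∃ (Ψ : (PlaneTiling.rotComplex o P).E 2 2 0 ≃+ ℤ)
            (Γ : (PlaneTiling.rotComplex o P).E 2 2 0), Ψ Γ = 1 ∧
            Φ (FilteredData.diff hK 2 2 0 0 1 (by norm_num) (by norm_num) Γ) =
              QuotientAddGroup.mk ω := by
  have hK := PlaneTiling.rotComplex_isComplex hT hiso o P
  -- Any tile will do: by `ptSum_eq` the total coefficient of a cycle is the same over all tiles.
  obtain ⟨t, ht, -⟩ := T.exists_tile 0
  let t₀ : T.cell 2 := ⟨t, ht⟩
  -- the coefficient of a cycle over the tiles, with the sign of `-Γ`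
  let s : (PlaneTiling.rotComplex o P).Z 2 2 0 →+ ℤ :=
    -((PlaneTiling.ptSum P 2 t₀).comp ((PlaneTiling.rotComplex o P).Z 2 2 0).subtype)
  have hs : ∀ x, s x = -PlaneTiling.ptSum P 2 t₀ x.1 := fun _ => rfl
  have hker : ((PlaneTiling.rotComplex o P).B 2 2 0).addSubgroupOf
      ((PlaneTiling.rotComplex o P).Z 2 2 0) = s.ker := by
    ext x
    rw [AddSubgroup.mem_addSubgroupOf, AddMonoidHom.mem_ker, hs, neg_eq_zero]
    refine ⟨PlaneTiling.ptSum_eq_zero_of_mem_B t₀, fun h => ?_⟩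
    refine PlaneTiling.mem_B_of_ptSum_eq_zero hT hiso x.2 fun t' => ?_
    rw [PlaneTiling.ptSum_eq o x.2.2 t' t₀, h]
  -- The generator is `-windChain`, because `∂ windChain` runs `-ω(v)` times around the circle over
  -- `v`.
  have hgen := neg_mem (ρ.windChain_mem_Z hT hiso)
  have hs1 : s ⟨-ρ.windChain, hgen⟩ = 1 := by
    rw [hs, map_neg, ρ.ptSum_windChain, neg_neg]
  have hsurj : Function.Surjective s := fun n =>
    ⟨n • ⟨-ρ.windChain, hgen⟩, by rw [map_zsmul, hs1, smul_eq_mul, mul_one]⟩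
  have hdgen : PlaneTiling.RotCell.boundary o P (-ρ.windChain) ∈
      (PlaneTiling.rotComplex o P).Z 2 0 1 :=
    hK.d_mem_Z (r := 2) (p := 2) (q := 0) (by norm_num) (by norm_num) hgen
  obtain ⟨hω, hdω⟩ := PlaneTiling.eq_circleChain_of_mem_Z hiso hdgen (AngleLag.right 0)
  refine ⟨hK, PlaneTiling.diff_eq_zero hK, ?_, (PlaneTiling.homologyEquiv hiso o P).symm,
    fun σ => ⟨PlaneTiling.circleChain_mem_Z hiso σ.2, ?_⟩, ⟨_, hω⟩, fun v => ?_,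
    (QuotientAddGroup.quotientAddEquivOfEq hker).trans
      (QuotientAddGroup.quotientKerEquivOfSurjective s hsurj),
    QuotientAddGroup.mk ⟨-ρ.windChain, hgen⟩, hs1, ?_⟩
  · rintro _ ⟨σ, hσ, rfl⟩
    exact PlaneTiling.boundary_mem_ePE hT o hσ
  · rw [AddEquiv.symm_apply_eq]
    rfl
  · rw [← ρ.turning_eq (AngleLag.right 0) v]
    simp only [map_neg]
    rfl
  · rw [AddEquiv.symm_apply_eq]
    exact congrArg QuotientAddGroup.mk (Subtype.ext hdω)
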